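/- Let $0<q<1$ and $\kappa=(1-q)/2$. On $\mathbb R^4$ with coordinates $(t,x_1,x_2,x_3)$ put $r=(x_1^2+x_2^2+x_3^2)^{1/2}$, $\rho_\pm=t\pm ir$, $\partial_\pm=\partial/\partial\rho_\pm=\frac12(\partial_t\mp i\partial_r)$, $\hat x=\sum_j x_j\sigma_j/r$, $x=t\,1_2+i\sum_j x_j\sigma_j$, and work on $D=\{r>0,\ t^2+r^2<\kappa^{-2}\}$ (where the series below converge). Write $(a;q)_n=\prod_{k<n}(1-aq^k)$, $(a;q)_\infty=\prod_{k\ge 0}(1-aq^k)$, $e_q(z)=\prod_{n\ge0}(1-q^nz)^{-1}$ (for matrices, and for bases larger than $1$: $e_q(Z)=\sum_n Z^n/(q;q)_n$), $E_q(z)=\prod_{n\ge0}(1+q^nz)$, $$\Lambda_\pm=\tfrac{1-q}{2}\Big\{\sum_{n\ge0}\tfrac{(q\rho_+/\rho_-;q)_{2n}}{(q;q)_{2n+1}}(i\kappa\rho_-)^{2n}\pm(\rho_+\leftrightarrow\rho_-)\Big\},\quad L^\pm=\Lambda_+\pm\Lambda_-,\quad M_\pm=M(\rho_\pm),\quad M(\rho)=\sum_{n\ge0}\tfrac{1-q}{1-q^{2n+1}}(-\kappa^2\rho^2)^n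 ,$$ $p_\pm=p(\rho_\pm)$, $m_\pm=m(\rho_\pm)$ with $p(\rho)=(i\kappa\rho;q)_\infty$, $m(\rho)=(-i\kappa\rho;q)_\infty$, and $g=m/p$, $g_\pm=g(\rho_\pm)$. Let $v=e_q(ix^\dagger(1-q)z)N$ with $N=\frac12(n_++n_-)1_2+\frac12(n_+-n_-)\hat x$, where $n_\pm$ is any choice, at the parameters $q$ and $q^{-1}$, of branches of $(L^\pm)^{-1/2}$ as functions of $(t,r)$, continuous on $D$ for the parameter $q$, whose values at $q^{-1}$ are the complex conjugates of those at $q$, and with $n_+n_-=(L^+L^-)^{-1/2}$ (principal value) at $q$; such branches exist. Let $v^*(x,z;q)=v(x,qz;q^{-1})^\dagger$ and $\langle w,v\rangle_q=\int_{-1/2}^{1/2}w^*v\,d_qz$ be the Thomae–Jackson integral. The curvature of a one-form $A$ is $F=dA-iA\wedge A$, and $A$ is anti-selfdual (ASD) if $F_{\mu\nu}=-\frac12\epsilon_{\mu\nu\kappa\lambda}F_{\kappa\lambda}$, $\epsilon_{0123}=1$. **(0) Reduction of Witten's ansatz.** For real $A_0,A_1,\phi_1,\phi_2$ depending on $(t,r)$,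 Witten's axisymmetric form is $A=\frac12A^a_\mu\sigma_a dx_\mu$ with $$A^a_0=-A_0\frac{x_a}{r},\qquad A^a_i=-A_1\frac{x_ix_a}{r^2}-\frac{\phi_1}{r^3}(\delta_{ia}r^2-x_ix_a)-\frac{\phi_2+1}{r^2}\epsilon_{iak}x_k .$$ Let $V$ be an open subset of the half plane $r>0$, let $\psi,\phi_1,\phi_2$ be $C^2$ on $V$ with $\phi_1^2+\phi_2^2\neq0$, and let $A_0=-\partial_r\psi$, $A_1=\partial_t\psi$. Then $A$ is ASD over $V$ if and only if $e^{-\psi}\phi_1+ie^{-\psi}\phi_2$ satisfies the Cauchy–Riemann equations in the variable $r+it$ and $\phi=-\ln\big(-(\phi_1^2+\phi_2^2)/4r^2\big)$ satisfies the Liouville equation $\partial_+\partial_-\phi=2e^{-\phi}$ on $V$. (Here and below the logarithm is the principal one; its argument is negative, so $\phi$ is a real function minus $\pi i$.) **(1) The $q$-ADHMN connection.** On $D$ all series, products and $q$-integrals involved converge, $v$ is differentiable in $x$, $(iD_q+x^\dagger)v=0$ on $I_q=\{\pm q^n/2\}$ with $D_qf(z)=\frac{f(z)-f(qz)}{(1-q)z}$,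 $\langle v,v\rangle_q=1_2$, and $A=i\langle v,dv\rangle_q$ is the smooth one-form $$A=\tfrac14(-\partial_r\Omega\,dt+\partial_t\Omega\,dr)+f\,d\hat x+g_A\,\epsilon_{ijk}\tfrac{x_i}{r^2}dx_j\sigma_k,$$ $$\Omega=\log\tfrac{L^+}{L^-}1_2+\log(L^+L^-)\hat x,\quad f=-\tfrac i4(M_+-M_-)(L^+L^-)^{-1/2},\quad g_A=-\tfrac12\{1-\tfrac{M_++M_-}2(L^+L^-)^{-1/2}\},$$ with $L^+L^->0$ (derivatives of logarithms are logarithmic derivatives). **(2) Witten's form.** Put $\psi=-\frac12\ln(L^+L^-)$, $A_0=-\partial_r\psi$, $A_1=\partial_t\psi$, $\phi_1=-2f$, $\phi_2=-(1+2g_A)$; the functions $\psi,\phi_1,\phi_2$ are real and smooth, and $\phi_1^2+\phi_2^2>0$. The traceless part of $A$ is Witten's form for these functions, and the trace part is an abelian pure gauge: for some smooth $u>0$ on $D$, the gauge transform of $A$ by $u\,1_2$ equals Witten's form. Both connections are ASD. **(3) Cauchy–Riemann and Liouville equations.** On $D$: $e^{-\psi}\phi_1+ie^{-\psi}\phi_2=-iM_-$,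 and it satisfies the Cauchy–Riemann equations of (0). Moreover $$\partial_+\partial_-\ln\tfrac{L^+}{L^-}=0,\qquad \partial_+\partial_-\ln(L^+L^-)=\tfrac1{2r^2}\Big(1-\tfrac{M_+M_-}{L^+L^-}\Big).$$ The function $\phi=-\ln\dfrac{g_+'g_-'}{(g_+-g_-)^2}$ is smooth, $g_+\ne g_-$, $\phi$ coincides with the Liouville field $-\ln(-(\phi_1^2+\phi_2^2)/4r^2)$ of the connection, and $\partial_+\partial_-\phi=2e^{-\phi}$. The functions $1/g_\pm$ generate the same $\phi$. **(4) The generating function.** $g$ is meromorphic on $\mathbb C$. For $|\rho|<\kappa^{-1}$ the values $p(\rho),m(\rho),M(\rho)$ are nonzero and $g'(\rho)=i\,g(\rho)M(\rho)$. Where $p(\rho)\ne0$, $$g(\rho)=\frac{m(\rho)}{p(\rho)}=\prod_{n\ge0}\frac{\frac{2iq^{-n}}{1-q}-\rho}{\frac{2iq^{-n}}{1-q}+\rho}=e_q\big(\tfrac{(1-q)i\rho}{2}\big)E_q\big(\tfrac{(1-q)i\rho}{2}\big),$$ and where $m(\rho)\neq0$, $$\frac1{g(\rho)}=\frac{p(\rho)}{m(\rho)}=\prod_{n\ge0}\frac{\frac{2iq^{-n}}{1-q}+\rho}{\frac{2iq^{-n}}{1-q}-\rho}=e_q\big(-\tfrac{(1-q)i\rho}{2}\big)E_q\big(-\tfrac{(1-q)i\rho}{2}\big).$$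 **(5) The two identities.** On $D$, $L^-\neq0$ and $$\frac{L^+}{L^-}=\frac{(-\kappa^2\rho_+^2;q^2)_\infty}{(-\kappa^2\rho_-^2;q^2)_\infty},\qquad L^+L^-=-\frac{(p_-m_+-p_+m_-)^2}{p_+m_+p_-m_-(\rho_+-\rho_-)^2}.$$ -/

import Mathlib

open Complex Set
open scoped Matrix ContDiff

noncomputable section

namespace QADHMN

/-! ### Spacetime, Pauli matrices, gauge theory on `ℝ⁴` -/

/-- Euclidean spacetime with coordinates `x 0 = t`, `x 1, x 2, x 3`. -/
abbrev Spacetime := Fin 4 → ℝ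

/-- `2 × 2` complex matrices. -/
abbrev M2 := Matrix (Fin 2) (Fin 2) ℂ

/-- The components `A_μ` of a matrix-valued one-form `A = ∑ A_μ dx_μ`. -/
abbrev Connection := Fin 4 → Spacetime → M2

/-- The Pauli matrices `σ₁, σ₂, σ₃`. -/
def pauli : Fin 3 → M2 :=
  ![!![0, 1; 1, 0], !![0, -I; I, 0], !![1, 0; 0, -1]]

/-- The totally antisymmetric symbol on three indices, normalised by `ε₁₂₃ = 1`. -/
def epsilon (i j k : Fin 3) : ℝ :=
  (((j : ℕ) : ℝ) - ((i : ℕ) : ℝ)) * (((k : ℕ) : ℝ) - ((i : ℕ) : ℝ)) *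
    (((k : ℕ) : ℝ) - ((j : ℕ) : ℝ)) / 2

/-- The spatial radius `r`. -/
def radius (x : Spacetime) : ℝ := Real.sqrt (x 1 ^ 2 + x 2 ^ 2 + x 3 ^ 2)

/-- `x̂ = ∑ x_j σ_j / r`. -/
def xhat (x : Spacetime) : M2 := ∑ j : Fin 3, ((x j.succ / radius x : ℝ) : ℂ) • pauli j

/-- The quaternion `x = x₀ 1 + i ∑ x_j σ_j`. -/
def quat (x : Spacetime) : M2 :=
  (x 0 : ℂ) • (1 : M2) + ∑ j : Fin 3, (I * (x j.succ : ℂ)) • pauli j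

/-- The entrywise partial derivative `∂F / ∂x_μ` of a matrix-valued function. -/
def pd (μ : Fin 4) (F : Spacetime → M2) (x : Spacetime) : M2 :=
  Matrix.of fun i j => deriv (fun s : ℝ => F (Function.update x μ s) i j) (x μ)

/-- The components of the curvature `F = dA - i A ∧ A`. -/
def curvature (A : Connection) (μ ν : Fin 4) (x : Spacetime) : M2 :=
  pd μ (A ν) x - pd ν (A μ) x - I • (A μ x * A ν x - A ν x * A μ x)

/-- Anti-selfduality `F_{μν} = -½ ε_{μνκλ} F_{κλ}` at a point, with `ε₀₁₂₃ = 1`. -/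
def IsASDAt (A : Connection) (x : Spacetime) : Prop :=
  curvature A 0 1 x = -curvature A 2 3 x ∧
  curvature A 0 2 x = -curvature A 3 1 x ∧
  curvature A 0 3 x = -curvature A 1 2 x

/-- The gauge transform `g⁻¹ A g + g⁻¹ i dg`. -/
def gaugeTransform (g : Spacetime → M2) (A : Connection) : Connection := fun μ x =>
  (g x)⁻¹ * A μ x * g x + I • ((g x)⁻¹ * pd μ g x)

/-! ### Witten's axisymmetric ansatz -/

/-- Witten's components `A^a_μ` for functions `A₀, A₁, φ₁, φ₂` of `(t, r)`. -/
def wittenComponent (A₀ A₁ φ₁ φ₂ : ℝ → ℝ → ℝ) (a : Fin 3) (μ : Fin 4) (x : Spacetime) : ℝ :=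
  Fin.cases
    (-A₀ (x 0) (radius x) * (x a.succ / radius x))
    (fun i : Fin 3 =>
      -A₁ (x 0) (radius x) * (x i.succ * x a.succ / radius x ^ 2)
      - φ₁ (x 0) (radius x) / radius x ^ 3 *
          ((if i = a then radius x ^ 2 else 0) - x i.succ * x a.succ)
      - (φ₂ (x 0) (radius x) + 1) / radius x ^ 2 * ∑ k : Fin 3, epsilon i a k * x k.succ)
    μ

/-- The `su(2)` connection `A = ∑_a A^a σ_a / 2` of Witten's form. -/
def wittenConnection (A₀ A₁ φ₁ φ₂ : ℝ → ℝ → ℝ) : Connection := fun μ x =>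
  (1 / 2 : ℂ) • ∑ a : Fin 3, (wittenComponent A₀ A₁ φ₁ φ₂ a μ x : ℂ) • pauli a

/-- The potentials `A_μ = -ε_{μν} ∂_ν ψ` (`ε₀₁ = 1`): `A₀ = -∂ψ/∂r`. -/
def potA0 (ψ : ℝ → ℝ → ℝ) (t r : ℝ) : ℝ := -deriv (fun s => ψ t s) r

/-- The potentials `A_μ = -ε_{μν} ∂_ν ψ` (`ε₀₁ = 1`): `A₁ = ∂ψ/∂t`. -/
def potA1 (ψ : ℝ → ℝ → ℝ) (t r : ℝ) : ℝ := deriv (fun s => ψ s r) t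

/-- The Cauchy–Riemann equations for `X + i Y` as a function of `r + i t`; equivalently
`X + i Y` is annihilated by `∂ / ∂ρ₊`, where `ρ₊ = t + i r`. -/
def CauchyRiemannOn (X Y : ℝ → ℝ → ℝ) (V : Set (ℝ × ℝ)) : Prop :=
  ∀ z ∈ V,
    deriv (fun s => X z.1 s) z.2 = deriv (fun s => Y s z.2) z.1 ∧
    deriv (fun s => X s z.2) z.1 = -deriv (fun s => Y z.1 s) z.2

/-- `∂₊ = ∂/∂ρ₊ = ½ (∂_t - i ∂_r)` for `ρ± = t ± i r`. -/
def dPlus (F : ℝ → ℝ → ℂ) : ℝ → ℝ → ℂ := fun t r =>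
  (1 / 2 : ℂ) * (deriv (fun s : ℝ => F s r) t - I * deriv (fun s : ℝ => F t s) r)

/-- `∂₋ = ∂/∂ρ₋ = ½ (∂_t + i ∂_r)` for `ρ± = t ± i r`. -/
def dMinus (F : ℝ → ℝ → ℂ) : ℝ → ℝ → ℂ := fun t r =>
  (1 / 2 : ℂ) * (deriv (fun s : ℝ => F s r) t + I * deriv (fun s : ℝ => F t s) r)

/-- The Liouville equation `∂₊ ∂₋ φ = 2 e^{-φ}` on a set of points `(t, r)`. -/
def LiouvilleOn (φ : ℝ → ℝ → ℂ) (V : Set (ℝ × ℝ)) : Prop :=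
  ∀ z ∈ V, dPlus (dMinus φ) z.1 z.2 = 2 * exp (-φ z.1 z.2)

/-- The Liouville field attached to Witten's functions,
`φ = -log (-(φ₁² + φ₂²) / (4 r²))`; the argument of the logarithm is a negative real number, so
`φ` is a real function minus the constant `π i`. -/
def wittenLiouville (φ₁ φ₂ : ℝ → ℝ → ℝ) (t r : ℝ) : ℂ :=
  -log ((-(φ₁ t r ^ 2 + φ₂ t r ^ 2) / (4 * r ^ 2) : ℝ) : ℂ)

/-- `ρ₊ = t + i r`. -/
def rhoP (t r : ℝ) : ℂ := t + I * r

/-- `ρ₋ = t - i r`. -/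
def rhoM (t r : ℝ) : ℂ := t - I * r

/-- The solution `φ = -log (g₊' g₋' / (g₊ - g₋)²)` of the Liouville equation generated by
`g₊(ρ₊)` and `g₋(ρ₋)`. -/
def liouvilleSol (gp gm : ℂ → ℂ) (t r : ℝ) : ℂ :=
  -log (deriv gp (rhoP t r) * deriv gm (rhoM t r) / (gp (rhoP t r) - gm (rhoM t r)) ^ 2)

/-! ### `q`-analysis -/

/-- `(a; q)_n`. -/
def qPoch (a : ℂ) (q : ℝ) (n : ℕ) : ℂ := ∏ k ∈ Finset.range n, (1 - a * (q : ℂ) ^ k)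

/-- `(a; q)_∞`. -/
def qPochInf (a : ℂ) (q : ℝ) : ℂ := ∏' k : ℕ, (1 - a * (q : ℂ) ^ k)

/-- `e_q(z) = ∏ (1 - qⁿ z)⁻¹`. -/
def qexp (q : ℝ) (z : ℂ) : ℂ := ∏' n : ℕ, (1 - (q : ℂ) ^ n * z)⁻¹

/-- `E_q(z) = ∏ (1 + qⁿ z)`. -/
def qExp (q : ℝ) (z : ℂ) : ℂ := ∏' n : ℕ, (1 + (q : ℂ) ^ n * z)

/-- The terms `Zⁿ / (q; q)_n` of the series of `e_q(Z)` for a matrix `Z`. -/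
def qexpTerm (q : ℝ) (Z : M2) (n : ℕ) : M2 := (qPoch (q : ℂ) q n)⁻¹ • Z ^ n

/-- `e_q(Z) = ∑ Zⁿ / (q; q)_n` for a matrix `Z`; also used with base larger than `1`. -/
def qexpMat (q : ℝ) (Z : M2) : M2 := ∑' n : ℕ, qexpTerm q Z n

/-- The `q`-derivative `D_q f(z) = (f(z) - f(qz)) / ((1 - q) z)`. -/
def qDeriv (q : ℝ) (f : ℝ → M2) (z : ℝ) : M2 :=
  (((1 - q) * z : ℝ) : ℂ)⁻¹ • (f z - f (q * z))

/-- The terms of the Thomae–Jackson integral over `[0, a]`. -/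
def jacksonTerm (q a : ℝ) (f : ℝ → M2) (n : ℕ) : M2 :=
  ((a * (1 - q) * q ^ n : ℝ) : ℂ) • f (a * q ^ n)

/-- `∫₀ᵃ f(z) d_q z = a (1 - q) ∑ f(a qⁿ) qⁿ`. -/
def jackson (q a : ℝ) (f : ℝ → M2) : M2 := ∑' n : ℕ, jacksonTerm q a f n

/-- The `q`-interval `I_q = {± qⁿ / 2}`. -/
def qInterval (q : ℝ) : Set ℝ := {z | ∃ n : ℕ, z = q ^ n / 2 ∨ z = -(q ^ n / 2)}

/-! ### The `q`-ADHMN construction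

Vectors are families `v p x z`, where `p` is the deformation parameter (both `p = q` and
`p = q⁻¹` are used), `x` the spacetime point and `z` the point of the `q`-interval. -/

/-- Vectors depending on the deformation parameter, on spacetime and on the `q`-interval. -/
abbrev QVector := ℝ → Spacetime → ℝ → M2

/-- `v*(x, z; q) = v(x, q z; q⁻¹)†`. -/
def qStar (q : ℝ) (v : QVector) (x : Spacetime) (z : ℝ) : M2 := (v q⁻¹ x (q * z))ᴴ

/-- The inner product `<w, v>_q`, the `q`-integral of `w* v` from `-1/2` to `1/2`. -/
def qInner (q : ℝ) (w v : QVector) (x : Spacetime) : M2 :=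
  jackson q (1 / 2) (fun z => qStar q w x z * v q x z) -
    jackson q (-(1 / 2)) (fun z => qStar q w x z * v q x z)

/-- The two `q`-integrals that make up `<w, v>_q` converge. -/
def QInnerConverges (q : ℝ) (w v : QVector) (x : Spacetime) : Prop :=
  Summable (jacksonTerm q (1 / 2) (fun z => qStar q w x z * v q x z)) ∧
    Summable (jacksonTerm q (-(1 / 2)) (fun z => qStar q w x z * v q x z))

/-- `∂v / ∂x_μ`. -/
def vpd (μ : Fin 4) (v : QVector) : QVector := fun p x z => pd μ (fun y => v p y z) x

/-- The connection one-form `A = i <v, dv>_q`. -/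
def qConnection (q : ℝ) (v : QVector) : Connection := fun μ x => I • qInner q v (vpd μ v) x

/-- The region `r > 0`, `t² + r² < (2 / (1 - q))²` of the `(t, r)` half plane, where the series
defining the solution converge. -/
def halfDisc (q : ℝ) : Set (ℝ × ℝ) := {z | 0 < z.2 ∧ z.1 ^ 2 + z.2 ^ 2 < (2 / (1 - q)) ^ 2}

/-- The corresponding region of spacetime. -/
def region (q : ℝ) : Set Spacetime := {x | (x 0, radius x) ∈ halfDisc q}

/-- The terms `(q ρ'/ρ; q)_{2n} / (q; q)_{2n+1} (i (1 - q) ρ / 2)^{2n}`. -/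
def lambdaTerm (q : ℝ) (ρ ρ' : ℂ) (n : ℕ) : ℂ :=
  qPoch ((q : ℂ) * (ρ' / ρ)) q (2 * n) / qPoch (q : ℂ) q (2 * n + 1) *
    (I * ((1 - q) * ρ / 2)) ^ (2 * n)

/-- `Λ₊(t, r; q)`. -/
def LambdaP (q t r : ℝ) : ℂ :=
  (1 - q) / 2 * ((∑' n, lambdaTerm q (rhoM t r) (rhoP t r) n) +
    ∑' n, lambdaTerm q (rhoP t r) (rhoM t r) n)

/-- `Λ₋(t, r; q)`. -/
def LambdaM (q t r : ℝ) : ℂ :=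
  (1 - q) / 2 * ((∑' n, lambdaTerm q (rhoM t r) (rhoP t r) n) -
    ∑' n, lambdaTerm q (rhoP t r) (rhoM t r) n)

/-- `L⁺ = Λ₊ + Λ₋`. -/
def LP (q t r : ℝ) : ℂ := LambdaP q t r + LambdaM q t r

/-- `L⁻ = Λ₊ - Λ₋`. -/
def LM (q t r : ℝ) : ℂ := LambdaP q t r - LambdaM q t r

/-- The terms `(1 - q) / (1 - q^{2n+1}) (-(1 - q)² ρ² / 4)ⁿ` of `M±`. -/
def MTerm (q : ℝ) (ρ : ℂ) (n : ℕ) : ℂ :=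
  (1 - q) / (1 - (q : ℂ) ^ (2 * n + 1)) * (-((1 - q) ^ 2 * ρ ^ 2 / 4)) ^ n

/-- `M(ρ)`, so that `M₊ = M(ρ₊)` and `M₋ = M(ρ₋)`. -/
def MFun (q : ℝ) (ρ : ℂ) : ℂ := ∑' n, MTerm q ρ n

/-- A choice of branches `np`, `nm` of `(Λ₊ + Λ₋)^{-1/2}`, `(Λ₊ - Λ₋)^{-1/2}` at the parameters `q`
and `q⁻¹`. The branches are continuous, their product is the principal value of
`(L⁺ L⁻)^{-1/2}`, and the values at `q` and at `q⁻¹` are complex conjugate (as they are for the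
principal branch), which makes the normalization function selfconjugate under `*`. -/
structure IsNormBranch (q : ℝ) (np nm : ℝ → ℝ → ℝ → ℂ) : Prop where
  contP : ContinuousOn (fun z : ℝ × ℝ => np q z.1 z.2) (halfDisc q)
  contM : ContinuousOn (fun z : ℝ × ℝ => nm q z.1 z.2) (halfDisc q)
  sq : ∀ p : ℝ, (p = q ∨ p = q⁻¹) → ∀ z ∈ halfDisc q,
    np p z.1 z.2 ^ 2 * (LambdaP p z.1 z.2 + LambdaM p z.1 z.2) = 1 ∧
    nm p z.1 z.2 ^ 2 * (LambdaP p z.1 z.2 - LambdaM p z.1 z.2) = 1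
  mul : ∀ z ∈ halfDisc q,
    np q z.1 z.2 * nm q z.1 z.2 = (LP q z.1 z.2 * LM q z.1 z.2) ^ (-(1 / 2) : ℂ)
  conj : ∀ z ∈ halfDisc q,
    np q⁻¹ z.1 z.2 = (starRingEnd ℂ) (np q z.1 z.2) ∧
    nm q⁻¹ z.1 z.2 = (starRingEnd ℂ) (nm q z.1 z.2)

/-- The normalization function `N`. -/
def normFun (np nm : ℝ → ℝ → ℝ → ℂ) (p : ℝ) (x : Spacetime) : M2 :=
  ((1 / 2 : ℂ) * (np p (x 0) (radius x) + nm p (x 0) (radius x))) • (1 : M2) +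
    ((1 / 2 : ℂ) * (np p (x 0) (radius x) - nm p (x 0) (radius x))) • xhat x

/-- The vector `v = e_q(i x† (1 - q) z) N`. -/
def vSol (np nm : ℝ → ℝ → ℝ → ℂ) : QVector := fun p x z =>
  qexpMat p ((I * (((1 - p) * z : ℝ) : ℂ)) • (quat x)ᴴ) * normFun np nm p x

/-- `f(t, r) = -(i/4) (M₊ - M₋) (L⁺ L⁻)^{-1/2}`. -/
def fFun (q t r : ℝ) : ℂ :=
  -(I / 4) * (MFun q (rhoP t r) - MFun q (rhoM t r)) * (LP q t r * LM q t r) ^ (-(1 / 2) : ℂ)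

/-- `g(t, r) = -½ {1 - ½ (M₊ + M₋) (L⁺ L⁻)^{-1/2}}`. -/
def gFun (q t r : ℝ) : ℂ :=
  -(1 / 2) * (1 - (MFun q (rhoP t r) + MFun q (rhoM t r)) / 2 *
    (LP q t r * LM q t r) ^ (-(1 / 2) : ℂ))

/-- `∂Ω/∂t` for `Ω = log (L⁺/L⁻) 1 + log (L⁺ L⁻) x̂`, written with logarithmic derivatives, which do
not depend on the branches of the logarithms. -/
def dtOmega (q : ℝ) (x : Spacetime) : M2 :=
  logDeriv (fun s : ℝ => LP q s (radius x) / LM q s (radius x)) (x 0) • (1 : M2) +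
    logDeriv (fun s : ℝ => LP q s (radius x) * LM q s (radius x)) (x 0) • xhat x

/-- `∂Ω/∂r`, as above. -/
def drOmega (q : ℝ) (x : Spacetime) : M2 :=
  logDeriv (fun s : ℝ => LP q (x 0) s / LM q (x 0) s) (radius x) • (1 : M2) +
    logDeriv (fun s : ℝ => LP q (x 0) s * LM q (x 0) s) (radius x) • xhat x

/-- The one-form
`A = ¼ (-∂_r Ω dt + ∂_t Ω dr) + f dx̂ + g ε_{ijk} (x_i / r²) dx_j σ_k`. -/
def qbps (q : ℝ) : Connection := fun μ x =>
  Fin.cases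
    (-(1 / 4 : ℂ) • drOmega q x)
    (fun j : Fin 3 =>
      ((1 / 4 : ℂ) * ((x j.succ / radius x : ℝ) : ℂ)) • dtOmega q x
      + fFun q (x 0) (radius x) • pd j.succ xhat x
      + gFun q (x 0) (radius x) • ∑ i : Fin 3, ∑ k : Fin 3,
          ((epsilon i j k * (x i.succ / radius x ^ 2) : ℝ) : ℂ) • pauli k)
    μ

/-- `ψ = -½ log (L⁺ L⁻)`. -/
def psiQ (q t r : ℝ) : ℝ := -(1 / 2) * Real.log (LP q t r * LM q t r).re

/-- `φ₁ = -2 f`. -/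
def phi1Q (q t r : ℝ) : ℝ := (-2 * fFun q t r).re

/-- `φ₂ = -(1 + 2 g)`. -/
def phi2Q (q t r : ℝ) : ℝ := (-(1 + 2 * gFun q t r)).re

/-- `p(ρ) = (i (1 - q) ρ / 2; q)_∞`. -/
def pFun (q : ℝ) (ρ : ℂ) : ℂ := qPochInf (I * ((1 - q) / 2) * ρ) q

/-- `m(ρ) = (-i (1 - q) ρ / 2; q)_∞`. -/
def mFun (q : ℝ) (ρ : ℂ) : ℂ := qPochInf (-I * ((1 - q) / 2) * ρ) q

/-- `g = m / p`, so that `g₊ = g(ρ₊)` and `g₋ = g(ρ₋)`. -/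
def gMero (q : ℝ) (ρ : ℂ) : ℂ := mFun q ρ / pFun q ρ

/-- `2 i q^{-n} / (1 - q)`. -/
def pole (q : ℝ) (n : ℕ) : ℂ := 2 * I * ((q : ℂ) ^ n)⁻¹ / (1 - q)

end QADHMN

end

noncomputable section

namespace QADHMN

open Filter Topology

/-! ### Infinite products and the `q`-binomial theorem -/

/-! Everything reduces to `q`-analysis in one complex variable. Since x̂² = 1, all matrices built
from x̂ have the form `spec x a b`: a on P₊ and b on P₋, where P± = (1 ± x̂)/2. There x† has the
eigenvalues ρ₋ and ρ₊ (`conjTranspose_quat`). Hence v is a pair of scalar `q`-exponentials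
1/(i(1-q)zρ; q)_∞ with ρ = ρ₋, ρ₊, normalised by branches of (L±)^{-1/2}. The operation * turns the
reciprocal products into products at qz and exchanges ρ₊ with ρ₋ (`qStar_vSol`).

The integrand of <v, v> is therefore a quotient with two different parameters ρ' and ρ, and it is an
exact `q`-difference (`lKernel_sub`). Its Jackson integral telescopes to boundary terms at ±1/2.
These equal L±, because the series of L± is the odd part of a `q`-binomial series
(`hasSum_lambdaTerm`, `LP_eq_lPair`). For ρ' = ρ the integrand collapses to 1/(1 - i(1-q)zρ), and
its integral is M(ρ) (`hasJackson_MFun`).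

In <v, dv> differentiation reaches only the second parameter of L±, while the normalisation
subtracts half of the full derivative. What remains is half of the difference of ∂₋ and ∂₊, that is,
the rotated gradient in Ω (`hasJackson_dRad`). The terms with dx̂ pair exponentials of equal
parameter as well; they produce M± and thereby f and g_A (`qConnection_eq_qbps`).

For Witten's form, rotational symmetry reduces anti-selfduality to three scalar equations in (t, r)
(`isASDAt_wittenConnection_iff`). Two are the Cauchy–Riemann equations for e^{-ψ}(φ₁ + iφ₂); the
third prescribes the Laplacian of ψ. Given the first two, log(φ₁² + φ₂²) - 2ψ is harmonic, so the
third is Liouville's equation (`liouvilleOn_iff`).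

For the solution at hand, complex conjugation exchanges L⁺ and L⁻, so e^{-ψ} = |L⁺| and e^{-ψ}(φ₁ +
iφ₂) = -iM(ρ₋) depends on ρ₋ alone. The third equation comes from differentiating L⁺L⁻ = -(g₊ -
g₋)²/(g₊g₋(ρ₊ - ρ₋)²) by means of g' = igM. That differential equation holds because the defect δ =
g'/g - iM satisfies δ(ρ) = qδ(qρ), which forces δ = 0 (`deriv_gMero`). Nonvanishing of L± rests on
|m| < |p| in the upper half plane (`norm_mFun_lt_norm_pFun`). Finally L⁺/L⁻ = h(ρ₊)/h(ρ₋) with h =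
pm has the logarithm 2i arg h(ρ₊), whose rotated gradient is the exact form of log |h|; so the trace
part is pure gauge (`exists_gauge`). -/

lemma norm_ofReal_pow {q : ℝ} (hq0 : 0 < q) (k : ℕ) : ‖(q : ℂ) ^ k‖ = q ^ k := by
  rw [norm_pow, norm_real, Real.norm_of_nonneg hq0.le]

lemma norm_ofReal_pow_le_one {q : ℝ} (hq0 : 0 < q) (hq1 : q < 1) (k : ℕ) :
    ‖(q : ℂ) ^ k‖ ≤ 1 := by
  rw [norm_ofReal_pow hq0]; exact pow_le_one₀ hq0.le hq1.le

lemma tendsto_ofReal_pow {q : ℝ} (hq0 : 0 < q) (hq1 : q < 1) :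
    Tendsto (fun k : ℕ => (q : ℂ) ^ k) atTop (𝓝 0) :=
  tendsto_pow_atTop_nhds_zero_of_norm_lt_one
    (by rwa [norm_real, Real.norm_of_nonneg hq0.le])

lemma one_sub_ofReal_pow_ne_zero {q : ℝ} (hq0 : 0 < q) (hq1 : q < 1) (k : ℕ) :
    1 - (q : ℂ) ^ (k + 1) ≠ 0 := by
  have h : q ^ (k + 1) < 1 := pow_lt_one₀ hq0.le hq1 (Nat.succ_ne_zero k)
  rw [sub_ne_zero]
  exact_mod_cast h.ne'

lemma qPoch_zero (a : ℂ) (q : ℝ) : qPoch a q 0 = 1 := by simp [qPoch]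

lemma qPoch_succ (a : ℂ) (q : ℝ) (n : ℕ) :
    qPoch a q (n + 1) = qPoch a q n * (1 - a * (q : ℂ) ^ n) := Finset.prod_range_succ _ _

lemma qPoch_succ' (a : ℂ) (q : ℝ) (n : ℕ) :
    qPoch a q (n + 1) = (1 - a) * qPoch (q * a) q n := by
  rw [qPoch, Finset.prod_range_succ', mul_comm, qPoch]
  simp [pow_succ, mul_assoc, mul_comm]

lemma qPoch_self_ne_zero {q : ℝ} (hq0 : 0 < q) (hq1 : q < 1) (n : ℕ) :
    qPoch (q : ℂ) q n ≠ 0 := by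
  refine Finset.prod_ne_zero_iff.2 fun k _ => ?_
  rw [← pow_succ']
  exact one_sub_ofReal_pow_ne_zero hq0 hq1 k

lemma summable_norm_mul_pow {q : ℝ} (hq0 : 0 < q) (hq1 : q < 1) (a : ℂ) :
    Summable fun k : ℕ => ‖-(a * (q : ℂ) ^ k)‖ := by
  simp only [norm_neg, norm_mul, norm_ofReal_pow hq0]
  exact (summable_geometric_of_lt_one hq0.le hq1).mul_left _

lemma multipliable_qPoch {q : ℝ} (hq0 : 0 < q) (hq1 : q < 1) (a : ℂ) :
    Multipliable fun k : ℕ => 1 - a * (q : ℂ) ^ k := by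
  simpa [sub_eq_add_neg] using
    multipliable_one_add_of_summable (summable_norm_mul_pow hq0 hq1 a)

lemma tendsto_qPoch {q : ℝ} (hq0 : 0 < q) (hq1 : q < 1) (a : ℂ) :
    Tendsto (qPoch a q) atTop (𝓝 (qPochInf a q)) :=
  (multipliable_qPoch hq0 hq1 a).hasProd.tendsto_prod_nat

lemma qPochInf_ne_zero {q : ℝ} (hq0 : 0 < q) (hq1 : q < 1) {a : ℂ}
    (h : ∀ k : ℕ, 1 - a * (q : ℂ) ^ k ≠ 0) : qPochInf a q ≠ 0 := by
  simpa [qPochInf, sub_eq_add_neg] using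
    tprod_one_add_ne_zero_of_summable (f := fun k : ℕ => -(a * (q : ℂ) ^ k))
      (fun k => by simpa [sub_eq_add_neg] using h k) (summable_norm_mul_pow hq0 hq1 a)

lemma one_sub_ne_zero_of_norm_lt {w : ℂ} (h : ‖w‖ < 1) : 1 - w ≠ 0 := by
  rw [sub_ne_zero]
  rintro rfl
  simp at h

lemma norm_mul_pow_lt_one {q : ℝ} (hq0 : 0 < q) (hq1 : q < 1) {a : ℂ} (h : ‖a‖ < 1) (k : ℕ) :
    ‖a * (q : ℂ) ^ k‖ < 1 := by
  rw [norm_mul]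
  exact (mul_le_of_le_one_right (norm_nonneg _) (norm_ofReal_pow_le_one hq0 hq1 k)).trans_lt h

lemma qPochInf_ne_zero_of_norm_lt {q : ℝ} (hq0 : 0 < q) (hq1 : q < 1) {a : ℂ} (h : ‖a‖ < 1) :
    qPochInf a q ≠ 0 :=
  qPochInf_ne_zero hq0 hq1 fun k =>
    one_sub_ne_zero_of_norm_lt (norm_mul_pow_lt_one hq0 hq1 h k)

lemma qPochInf_zero (q : ℝ) : qPochInf 0 q = 1 := by simp [qPochInf]

/-- This `q`-difference equation drives the functional equations of p, m and g, the equation for v,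
and the telescoping of the Jackson integrals. -/
lemma qPochInf_eq {q : ℝ} (hq0 : 0 < q) (hq1 : q < 1) (a : ℂ) :
    qPochInf a q = (1 - a) * qPochInf (q * a) q := by
  refine tendsto_nhds_unique ((tendsto_add_atTop_iff_nat 1).2 (tendsto_qPoch hq0 hq1 a)) ?_
  simp only [qPoch_succ']
  exact (tendsto_qPoch hq0 hq1 _).const_mul _

/-- Around `a`, on the ball of radius `‖a‖ + 1`, the factors differ from 1 by at most a geometric
sequence, so the product converges locally uniformly. -/
lemma differentiable_qPochInf {q : ℝ} (hq0 : 0 < q) (hq1 : q < 1) :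
    Differentiable ℂ fun a => qPochInf a q := by
  intro a
  have hK : IsOpen (Metric.ball (0 : ℂ) (‖a‖ + 1)) := Metric.isOpen_ball
  have h := Summable.hasProdLocallyUniformlyOn_nat_one_add
    (f := fun (k : ℕ) (a : ℂ) => -(a * (q : ℂ) ^ k)) hK
    (u := fun k => (‖a‖ + 1) * q ^ k)
    ((summable_geometric_of_lt_one hq0.le hq1).mul_left _)
    (Eventually.of_forall fun k b hb => by
      rw [norm_neg, norm_mul, norm_ofReal_pow hq0]
      have : ‖b‖ < ‖a‖ + 1 := by simpa using hb
      gcongr)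
    (fun k => by fun_prop)
  have h2 := (hasProdLocallyUniformlyOn_iff_tendstoLocallyUniformlyOn.1 h).differentiableOn
    (Eventually.of_forall fun s => by fun_prop) hK
  have h3 := h2.differentiableAt (hK.mem_nhds (x := a) (by simp))
  simpa [qPochInf, sub_eq_add_neg] using h3

lemma conj_qPochInf {q : ℝ} (hq0 : 0 < q) (hq1 : q < 1) (a : ℂ) :
    (starRingEnd ℂ) (qPochInf a q) = qPochInf ((starRingEnd ℂ) a) q := by
  refine tendsto_nhds_unique ((continuous_conj.tendsto _).comp (tendsto_qPoch hq0 hq1 a))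
    ((tendsto_qPoch hq0 hq1 _).congr fun n => ?_)
  simp [qPoch]

/-- A power series evaluated along `q ^ N z` tends to its constant coefficient. -/
lemma tendsto_powerSeries_scale {q : ℝ} (hq0 : 0 < q) (hq1 : q < 1) {c : ℕ → ℂ} {z : ℂ}
    (h : Summable fun n => ‖c n * z ^ n‖) :
    Tendsto (fun N : ℕ => ∑' n, c n * ((q : ℂ) ^ N * z) ^ n) atTop (𝓝 (c 0)) := by
  have key : Tendsto (fun N : ℕ => ∑' n, c n * ((q : ℂ) ^ N * z) ^ n) atTop
      (𝓝 (∑' n, if n = 0 then c 0 else 0)) := by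
    refine tendsto_tsum_of_dominated_convergence h (fun n => ?_)
      (Eventually.of_forall fun N n => ?_)
    · rcases Nat.eq_zero_or_pos n with rfl | hn
      · simp
      · have h0 : Tendsto (fun N : ℕ => (q : ℂ) ^ N * z) atTop (𝓝 0) := by
          simpa using (tendsto_ofReal_pow hq0 hq1).mul_const z
        simpa [hn.ne'] using (h0.pow n).const_mul (c n)
    · rw [mul_pow, norm_mul, norm_mul, norm_mul]
      have : ‖((q : ℂ) ^ N) ^ n‖ ≤ 1 := by
        rw [norm_pow]; exact pow_le_one₀ (norm_nonneg _) (norm_ofReal_pow_le_one hq0 hq1 N)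
      have h2 := mul_le_of_le_one_left (norm_nonneg (z ^ n)) this
      gcongr
  simpa [tsum_ite_eq] using key

/-- Ratio test: the quotient of consecutive terms tends to z. -/
lemma summable_norm_qBinomial {q : ℝ} (hq0 : 0 < q) (hq1 : q < 1) (a : ℂ) {z : ℂ}
    (hz : ‖z‖ < 1) : Summable fun n => ‖qPoch a q n / qPoch (q : ℂ) q n * z ^ n‖ := by
  obtain ⟨r, hr0, hr1⟩ := exists_between hz
  have hlim : Tendsto (fun n : ℕ => ‖(1 - a * (q : ℂ) ^ n) / (1 - (q : ℂ) ^ (n + 1)) * z‖) atTop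
      (𝓝 ‖z‖) := by
    have h0 := tendsto_ofReal_pow hq0 hq1
    have h1 := (tendsto_add_atTop_iff_nat 1).2 h0
    have := ((((h0.const_mul a).const_sub 1).div (h1.const_sub 1) (by simp)).mul_const z).norm
    simpa using this
  refine summable_of_ratio_norm_eventually_le hr1 ?_
  filter_upwards [hlim.eventually_lt_const hr0] with n hn
  have : qPoch a q (n + 1) / qPoch (q : ℂ) q (n + 1) * z ^ (n + 1) =
      (1 - a * (q : ℂ) ^ n) / (1 - (q : ℂ) ^ (n + 1)) * z *
        (qPoch a q n / qPoch (q : ℂ) q n * z ^ n) := by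
    rw [qPoch_succ, qPoch_succ, ← pow_succ' (q : ℂ)]
    have h1 := qPoch_self_ne_zero hq0 hq1 n
    have h2 := one_sub_ofReal_pow_ne_zero hq0 hq1 n
    field_simp
    ring
  rw [this, norm_norm, norm_norm, norm_mul _ (qPoch a q n / _ * _)]
  gcongr

/-- The `q`-binomial theorem. -/
lemma hasSum_qBinomial {q : ℝ} (hq0 : 0 < q) (hq1 : q < 1) (a : ℂ) {z : ℂ} (hz : ‖z‖ < 1) :
    HasSum (fun n => qPoch a q n / qPoch (q : ℂ) q n * z ^ n)
      (qPochInf (a * z) q / qPochInf z q) := by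
  set c : ℕ → ℂ := fun n => qPoch a q n / qPoch (q : ℂ) q n with hc
  set F : ℂ → ℂ := fun w => ∑' n, c n * w ^ n with hF
  have hS : ∀ w : ℂ, ‖w‖ < 1 → Summable fun n => c n * w ^ n := fun w hw =>
    (summable_norm_qBinomial hq0 hq1 a hw).of_norm
  have hcs : ∀ n, c (n + 1) * (1 - (q : ℂ) ^ (n + 1)) = c n * (1 - a * (q : ℂ) ^ n) := fun n => by
    have h1 := qPoch_self_ne_zero hq0 hq1 n
    have h2 := one_sub_ofReal_pow_ne_zero hq0 hq1 n
    simp only [hc, qPoch_succ, ← pow_succ']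
    field_simp
  -- The coefficient recursion `hcs` is the same as this `q`-difference equation, after shifting the
  -- index in the series whose constant term vanishes.
  have hfe : ∀ w : ℂ, ‖w‖ < 1 → (1 - w) * F w = (1 - a * w) * F (q * w) := fun w hw => by
    have hw' : ‖(q : ℂ) * w‖ < 1 := by
      simpa [mul_comm] using norm_mul_pow_lt_one hq0 hq1 hw 1
    have e1 : F w - F (q * w) = ∑' n, c n * (1 - (q : ℂ) ^ n) * w ^ n := by
      rw [hF, ← (hS w hw).tsum_sub (hS _ hw')]
      congr 1; ext n; ring
    have e2 : w * F w - a * w * F (q * w) = ∑' n, c n * (1 - a * (q : ℂ) ^ n) * w ^ (n + 1) := by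
      rw [hF, ← tsum_mul_left, ← tsum_mul_left,
        ← ((hS w hw).mul_left w).tsum_sub ((hS _ hw').mul_left (a * w))]
      congr 1; ext n; ring
    have e3 : ∑' n, c n * (1 - (q : ℂ) ^ n) * w ^ n =
        ∑' n, c n * (1 - a * (q : ℂ) ^ n) * w ^ (n + 1) := by
      rw [Summable.tsum_eq_zero_add]
      · simp [hcs]
      · refine ((hS w hw).sub (hS _ hw')).congr fun n => ?_
        ring
    linear_combination e1 - e2 + e3
  -- Iterating the equation N times pushes the argument to q^N z, where F tends to its constant
  -- coefficient 1.
  have hit : ∀ N, qPoch z q N * F z = qPoch (a * z) q N * F ((q : ℂ) ^ N * z) := fun N => by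
    induction N with
    | zero => simp [qPoch_zero]
    | succ N ih =>
      have := hfe ((q : ℂ) ^ N * z) (by
        simpa [mul_comm] using norm_mul_pow_lt_one hq0 hq1 hz N)
      rw [← mul_assoc (q : ℂ), ← pow_succ' (q : ℂ)] at this
      rw [qPoch_succ, qPoch_succ]
      linear_combination (1 - z * (q : ℂ) ^ N) * ih + qPoch (a * z) q N * this
  have hlim := tendsto_nhds_unique ((tendsto_qPoch hq0 hq1 z).mul_const (F z))
    (((tendsto_qPoch hq0 hq1 (a * z)).mul (tendsto_powerSeries_scale hq0 hq1
      (summable_norm_qBinomial hq0 hq1 a hz))).congr fun N => (hit N).symm)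
  have hval : F z = qPochInf (a * z) q / qPochInf z q := by
    rw [eq_div_iff (qPochInf_ne_zero_of_norm_lt hq0 hq1 hz), mul_comm, hlim]
    simp [qPoch_zero]
  rw [← hval]
  exact (hS z hz).hasSum

lemma hasSum_qexp {q : ℝ} (hq0 : 0 < q) (hq1 : q < 1) {z : ℂ} (hz : ‖z‖ < 1) :
    HasSum (fun n => (qPoch (q : ℂ) q n)⁻¹ * z ^ n) (qPochInf z q)⁻¹ := by
  simpa [qPoch, qPochInf_zero] using hasSum_qBinomial hq0 hq1 0 hz

/-- The `q`-exponential series of base `q⁻¹ > 1` is entire. -/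
lemma hasSum_qexp_inv {q : ℝ} (hq0 : 0 < q) (hq1 : q < 1) (z : ℂ) :
    HasSum (fun n => (qPoch ((q⁻¹ : ℝ) : ℂ) q⁻¹ n)⁻¹ * z ^ n) (qPochInf (q * z) q) := by
  set c : ℕ → ℂ := fun n => (qPoch ((q⁻¹ : ℝ) : ℂ) q⁻¹ n)⁻¹ with hc
  have hqc : (q : ℂ) ≠ 0 := by exact_mod_cast hq0.ne'
  have hne : ∀ n : ℕ, 1 - ((q⁻¹ : ℝ) : ℂ) ^ (n + 1) ≠ 0 := fun n => by
    have := one_sub_ofReal_pow_ne_zero hq0 hq1 n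
    push_cast
    rw [inv_pow]
    intro h
    apply this
    have h2 : (q : ℂ) ^ (n + 1) ≠ 0 := pow_ne_zero _ hqc
    field_simp at h
    linear_combination -h
  have hcs : ∀ n, c (n + 1) * (1 - ((q⁻¹ : ℝ) : ℂ) ^ (n + 1)) = c n := fun n => by
    simp only [hc, qPoch_succ, ← pow_succ', mul_inv]
    rw [mul_assoc, inv_mul_cancel₀ (hne n), mul_one]
  have hrat : ∀ n, c (n + 1) = c n * ((q : ℂ) ^ (n + 1) / ((q : ℂ) ^ (n + 1) - 1)) := fun n => by
    have h1 := hcs n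
    have h2 : (q : ℂ) ^ (n + 1) ≠ 0 := pow_ne_zero _ hqc
    have h3 : (q : ℂ) ^ (n + 1) - 1 ≠ 0 := by
      rw [← neg_ne_zero, neg_sub]; exact one_sub_ofReal_pow_ne_zero hq0 hq1 n
    rw [← h1]
    push_cast
    rw [inv_pow]
    field_simp
  have hS : ∀ w : ℂ, Summable fun n => ‖c n * w ^ n‖ := fun w => by
    have hlim : Tendsto (fun n : ℕ => ‖(q : ℂ) ^ (n + 1) / ((q : ℂ) ^ (n + 1) - 1) * w‖) atTop
        (𝓝 0) := by
      have h1 := (tendsto_add_atTop_iff_nat 1).2 (tendsto_ofReal_pow hq0 hq1)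
      have := ((h1.div (h1.sub_const 1) (by simp)).mul_const w).norm
      simpa using this
    refine summable_of_ratio_norm_eventually_le (r := 1 / 2) (by norm_num) ?_
    filter_upwards [hlim.eventually_lt_const (show (0 : ℝ) < 1 / 2 by norm_num)] with n hn
    have : c (n + 1) * w ^ (n + 1) =
        (q : ℂ) ^ (n + 1) / ((q : ℂ) ^ (n + 1) - 1) * w * (c n * w ^ n) := by
      rw [hrat, pow_succ w]; ring
    rw [this, norm_norm, norm_norm, norm_mul _ (c n * _)]
    gcongr
  set F : ℂ → ℂ := fun w => ∑' n, c n * w ^ n with hF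
  -- In base q⁻¹ the numerators of the coefficients are absent, so the equation has no denominator.
  -- The iteration therefore yields a product and needs no bound on z.
  have hfe : ∀ w : ℂ, F w = (1 - q * w) * F (q * w) := fun w => by
    have e1 : F (q * w) - F w = ∑' n, c n * (1 - ((q⁻¹ : ℝ) : ℂ) ^ n) * (q * w) ^ n := by
      rw [hF, ← (hS (q * w)).of_norm.tsum_sub (hS w).of_norm]
      congr 1; ext n
      push_cast
      rw [inv_pow, mul_pow]
      field_simp
    have e2 : q * w * F (q * w) = ∑' n, c n * (q * w) ^ (n + 1) := by
      rw [hF, ← tsum_mul_left]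
      congr 1; ext n; ring
    have e3 : ∑' n, c n * (1 - ((q⁻¹ : ℝ) : ℂ) ^ n) * (q * w) ^ n =
        ∑' n, c n * (q * w) ^ (n + 1) := by
      rw [Summable.tsum_eq_zero_add]
      · simp only [hcs, pow_zero, sub_self, mul_zero, zero_mul, zero_add]
      · refine ((hS (q * w)).of_norm.sub (hS w).of_norm).congr fun n => ?_
        push_cast
        rw [inv_pow, mul_pow]
        field_simp
    linear_combination -e1 + e2 - e3
  have hit : ∀ N, F z = qPoch (q * z) q N * F ((q : ℂ) ^ N * z) := fun N => by
    induction N with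
    | zero => simp [qPoch_zero]
    | succ N ih =>
      rw [ih, hfe ((q : ℂ) ^ N * z), qPoch_succ, ← mul_assoc (q : ℂ), ← pow_succ' (q : ℂ)]
      ring
  have hlim := tendsto_nhds_unique (tendsto_const_nhds (x := F z))
    (((tendsto_qPoch hq0 hq1 (q * z)).mul (tendsto_powerSeries_scale hq0 hq1 (hS z))).congr
      fun N => (hit N).symm)
  have hval : F z = qPochInf (q * z) q := by
    rw [hlim]; simp [hc, qPoch_zero]
  rw [← hval]
  exact (hS z).of_norm.hasSum

/-! ### The functions `p`, `m`, `M` and `g` of one complex variable -/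

lemma norm_half_mul {q : ℝ} (hq1 : q < 1) (ρ : ℂ) :
    ‖((1 - q) / 2 : ℂ) * ρ‖ = (1 - q) / 2 * ‖ρ‖ := by
  have h : ((1 - q) / 2 : ℂ) = (((1 - q) / 2 : ℝ) : ℂ) := by push_cast; ring
  rw [norm_mul, h, norm_real, Real.norm_of_nonneg (by linarith)]

lemma norm_half_mul_lt_one {q : ℝ} (hq1 : q < 1) {ρ : ℂ} (h : ‖ρ‖ < 2 / (1 - q)) :
    ‖((1 - q) / 2 : ℂ) * ρ‖ < 1 := by
  rw [norm_half_mul hq1]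
  rw [lt_div_iff₀ (by linarith)] at h
  linarith

lemma norm_I_half_mul_lt_one {q : ℝ} (hq1 : q < 1) {ρ : ℂ} (h : ‖ρ‖ < 2 / (1 - q)) :
    ‖I * ((1 - q) / 2 : ℂ) * ρ‖ < 1 := by
  rw [mul_assoc, norm_mul, norm_I, one_mul]
  exact norm_half_mul_lt_one hq1 h

lemma norm_neg_I_half_mul_lt_one {q : ℝ} (hq1 : q < 1) {ρ : ℂ} (h : ‖ρ‖ < 2 / (1 - q)) :
    ‖-I * ((1 - q) / 2 : ℂ) * ρ‖ < 1 := by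
  rw [neg_mul, neg_mul, norm_neg]
  exact norm_I_half_mul_lt_one hq1 h

lemma norm_scale_lt {q : ℝ} (hq0 : 0 < q) (hq1 : q < 1) {ρ : ℂ} {R : ℝ} (h : ‖ρ‖ < R) (n : ℕ) :
    ‖(q : ℂ) ^ n * ρ‖ < R := by
  rw [norm_mul]
  exact (mul_le_of_le_one_left (norm_nonneg _) (norm_ofReal_pow_le_one hq0 hq1 n)).trans_lt h

lemma differentiable_pFun {q : ℝ} (hq0 : 0 < q) (hq1 : q < 1) : Differentiable ℂ (pFun q) :=
  (differentiable_qPochInf hq0 hq1).comp (by fun_prop : Differentiable ℂ fun ρ : ℂ =>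
    I * ((1 - q) / 2) * ρ)

lemma differentiable_mFun {q : ℝ} (hq0 : 0 < q) (hq1 : q < 1) : Differentiable ℂ (mFun q) :=
  (differentiable_qPochInf hq0 hq1).comp (by fun_prop : Differentiable ℂ fun ρ : ℂ =>
    -I * ((1 - q) / 2) * ρ)

lemma pFun_ne_zero {q : ℝ} (hq0 : 0 < q) (hq1 : q < 1) {ρ : ℂ} (h : ‖ρ‖ < 2 / (1 - q)) :
    pFun q ρ ≠ 0 :=
  qPochInf_ne_zero_of_norm_lt hq0 hq1 (norm_I_half_mul_lt_one hq1 h)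

lemma mFun_ne_zero {q : ℝ} (hq0 : 0 < q) (hq1 : q < 1) {ρ : ℂ} (h : ‖ρ‖ < 2 / (1 - q)) :
    mFun q ρ ≠ 0 :=
  qPochInf_ne_zero_of_norm_lt hq0 hq1 (norm_neg_I_half_mul_lt_one hq1 h)

lemma pFun_eq {q : ℝ} (hq0 : 0 < q) (hq1 : q < 1) (ρ : ℂ) :
    pFun q ρ = (1 - I * ((1 - q) / 2) * ρ) * pFun q (q * ρ) := by
  rw [pFun, qPochInf_eq hq0 hq1, pFun]
  congr 2; ring

lemma mFun_eq {q : ℝ} (hq0 : 0 < q) (hq1 : q < 1) (ρ : ℂ) :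
    mFun q ρ = (1 + I * ((1 - q) / 2) * ρ) * mFun q (q * ρ) := by
  rw [mFun, qPochInf_eq hq0 hq1, mFun]
  congr 2 <;> ring

lemma pFun_zero (q : ℝ) : pFun q 0 = 1 := by simp [pFun, qPochInf_zero]

lemma mFun_zero (q : ℝ) : mFun q 0 = 1 := by simp [mFun, qPochInf_zero]

lemma conj_pFun {q : ℝ} (hq0 : 0 < q) (hq1 : q < 1) (ρ : ℂ) :
    (starRingEnd ℂ) (pFun q ρ) = mFun q ((starRingEnd ℂ) ρ) := by
  rw [pFun, conj_qPochInf hq0 hq1, mFun]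
  simp [map_ofNat]

lemma conj_mFun {q : ℝ} (hq0 : 0 < q) (hq1 : q < 1) (ρ : ℂ) :
    (starRingEnd ℂ) (mFun q ρ) = pFun q ((starRingEnd ℂ) ρ) := by
  rw [mFun, conj_qPochInf hq0 hq1, pFun]
  simp [map_ofNat]

/-- Factorwise (1 - icq^k ρ)(1 + icq^k ρ) = 1 + c²q^{2k}ρ² with c = (1-q)/2, hence the base q². -/
lemma pFun_mul_mFun {q : ℝ} (hq0 : 0 < q) (hq1 : q < 1) (ρ : ℂ) :
    pFun q ρ * mFun q ρ = qPochInf (-((1 - q) / 2) ^ 2 * ρ ^ 2) (q ^ 2) := by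
  have h2 : q ^ 2 < 1 := pow_lt_one₀ hq0.le hq1 two_ne_zero
  refine tendsto_nhds_unique ((tendsto_qPoch hq0 hq1 _).mul (tendsto_qPoch hq0 hq1 _))
    ((tendsto_qPoch (pow_pos hq0 2) h2 _).congr fun n => ?_)
  rw [qPoch, qPoch, qPoch, ← Finset.prod_mul_distrib]
  refine Finset.prod_congr rfl fun k _ => ?_
  push_cast
  linear_combination ((1 - q) / 2 : ℂ) ^ 2 * ρ ^ 2 * (q : ℂ) ^ (2 * k) * I_sq

/-- For c ≥ 0 one has |1 - icρ|² - |1 + icρ|² = 4c Im ρ ≥ 0, which compares the products factor by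
factor. The limit only preserves ≤, so strictness is taken from the first factor, split off
beforehand, and from p(qρ) ≠ 0. -/
lemma norm_mFun_lt_norm_pFun {q : ℝ} (hq0 : 0 < q) (hq1 : q < 1) {ρ : ℂ}
    (h : ‖ρ‖ < 2 / (1 - q)) (hρ : 0 < ρ.im) : ‖mFun q ρ‖ < ‖pFun q ρ‖ := by
  have hfac : ∀ c : ℝ, 0 ≤ c → normSq (1 + I * c * ρ) ≤ normSq (1 - I * c * ρ) := fun c hc => by
    simp only [normSq_apply]
    simp
    nlinarith [mul_nonneg hc hρ.le]
  have hle : ‖mFun q (q * ρ)‖ ≤ ‖pFun q (q * ρ)‖ := by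
    refine le_of_tendsto_of_tendsto' (tendsto_qPoch hq0 hq1 _).norm (tendsto_qPoch hq0 hq1 _).norm
      fun n => ?_
    rw [qPoch, qPoch, norm_prod, norm_prod]
    refine Finset.prod_le_prod (fun _ _ => norm_nonneg _) fun k _ => ?_
    have := hfac ((1 - q) / 2 * q ^ (k + 1)) (mul_nonneg (by linarith) (by positivity))
    rw [normSq_eq_norm_sq, normSq_eq_norm_sq] at this
    have e1 : 1 - -I * ((1 - q) / 2) * (q * ρ) * (q : ℂ) ^ k =
        1 + I * (((1 - q) / 2 * q ^ (k + 1) : ℝ) : ℂ) * ρ := by push_cast; ring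
    have e2 : 1 - I * ((1 - q) / 2) * (q * ρ) * (q : ℂ) ^ k =
        1 - I * (((1 - q) / 2 * q ^ (k + 1) : ℝ) : ℂ) * ρ := by push_cast; ring
    rw [e1, e2]
    exact le_of_sq_le_sq this (norm_nonneg _)
  have hlt : ‖1 + I * ((1 - q) / 2) * ρ‖ < ‖1 - I * ((1 - q) / 2) * ρ‖ := by
    refine lt_of_pow_lt_pow_left₀ 2 (norm_nonneg _) ?_
    have hc : ((1 - q) / 2 : ℂ) = (((1 - q) / 2 : ℝ) : ℂ) := by push_cast; ring
    rw [hc, ← normSq_eq_norm_sq, ← normSq_eq_norm_sq]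
    generalize hk : (1 - q) / 2 = c
    have hc0 : 0 < c := by rw [← hk]; linarith
    simp only [normSq_apply]
    simp
    nlinarith [mul_pos hc0 hρ]
  rw [mFun_eq hq0 hq1, pFun_eq hq0 hq1, norm_mul, norm_mul]
  have hp : 0 < ‖pFun q (q * ρ)‖ := norm_pos_iff.2
    (pFun_ne_zero hq0 hq1 (by simpa using norm_scale_lt hq0 hq1 h 1))
  calc _ ≤ ‖1 + I * ((1 - q) / 2) * ρ‖ * ‖pFun q (q * ρ)‖ := by gcongr
    _ < _ := by gcongr

lemma one_add_sq_ne_zero {q : ℝ} (hq1 : q < 1) {ρ : ℂ} (h : ‖ρ‖ < 2 / (1 - q)) :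
    1 + ((1 - q) / 2 * ρ : ℂ) ^ 2 ≠ 0 := by
  have := one_sub_ne_zero_of_norm_lt (w := -((1 - q) / 2 * ρ : ℂ) ^ 2) (by
    rw [norm_neg, norm_pow]
    exact pow_lt_one₀ (norm_nonneg _) (norm_half_mul_lt_one hq1 h) two_ne_zero)
  simpa using this

lemma summable_norm_MTerm {q : ℝ} (hq0 : 0 < q) (hq1 : q < 1) {ρ : ℂ} (h : ‖ρ‖ < 2 / (1 - q)) :
    Summable fun n => ‖MTerm q ρ n‖ := by
  have hw : ‖-((1 - q) ^ 2 * ρ ^ 2 / 4 : ℂ)‖ < 1 := by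
    have e : -((1 - q) ^ 2 * ρ ^ 2 / 4 : ℂ) = -((1 - q) / 2 * ρ : ℂ) ^ 2 := by ring
    rw [e, norm_neg, norm_pow]
    exact pow_lt_one₀ (norm_nonneg _) (norm_half_mul_lt_one hq1 h) two_ne_zero
  refine Summable.of_nonneg_of_le (fun _ => norm_nonneg _) (fun n => ?_)
    (summable_geometric_of_lt_one (norm_nonneg _) hw)
  rw [MTerm, norm_mul, norm_pow]
  refine mul_le_of_le_one_left (by positivity) ?_
  have hqn : q ^ (2 * n + 1) ≤ q := by
    simpa using pow_le_pow_of_le_one hq0.le hq1.le (show 1 ≤ 2 * n + 1 by omega)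
  have e : ((1 - q) / (1 - (q : ℂ) ^ (2 * n + 1)) : ℂ) =
      (((1 - q) / (1 - q ^ (2 * n + 1)) : ℝ) : ℂ) := by push_cast; ring
  rw [e, norm_real, Real.norm_of_nonneg (div_nonneg (by linarith) (by linarith))]
  exact div_le_one_of_le₀ (by linarith) (by linarith)

/-- Passing to M(ρ) - qM(qρ) multiplies the n-th coefficient by 1 - q^{2n+1}, which cancels its
denominator and leaves a geometric series. -/
lemma MFun_sub {q : ℝ} (hq0 : 0 < q) (hq1 : q < 1) {ρ : ℂ} (h : ‖ρ‖ < 2 / (1 - q)) :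
    MFun q ρ - q * MFun q (q * ρ) = (1 - q) / (1 + ((1 - q) / 2 * ρ) ^ 2) := by
  have hw : ‖-((1 - q) / 2 * ρ : ℂ) ^ 2‖ < 1 := by
    rw [norm_neg, norm_pow]
    exact pow_lt_one₀ (norm_nonneg _) (norm_half_mul_lt_one hq1 h) two_ne_zero
  have h1 := ((hasSum_geometric_of_norm_lt_one hw).mul_left (1 - q : ℂ)).tsum_eq
  rw [sub_neg_eq_add, ← div_eq_mul_inv] at h1
  rw [← h1, MFun, MFun, ← tsum_mul_left,
    ← (summable_norm_MTerm hq0 hq1 h).of_norm.tsum_sub ((summable_norm_MTerm hq0 hq1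
      (by simpa using norm_scale_lt hq0 hq1 h 1)).of_norm.mul_left _)]
  congr 1; ext n
  rw [MTerm, MTerm]
  have h2 := one_sub_ofReal_pow_ne_zero hq0 hq1 (2 * n)
  have e : -((1 - q) ^ 2 * (q * ρ) ^ 2 / 4 : ℂ) = (q : ℂ) ^ 2 * -((1 - q) / 2 * ρ : ℂ) ^ 2 := by
    ring
  have e' : -((1 - q) ^ 2 * ρ ^ 2 / 4 : ℂ) = -((1 - q) / 2 * ρ : ℂ) ^ 2 := by ring
  rw [e, e', mul_pow ((q : ℂ) ^ 2), ← pow_mul]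
  generalize (-((1 - q) / 2 * ρ : ℂ) ^ 2) ^ n = y
  field_simp
  ring

lemma tendsto_MFun_scale {q : ℝ} (hq0 : 0 < q) (hq1 : q < 1) {ρ : ℂ} (h : ‖ρ‖ < 2 / (1 - q)) :
    Tendsto (fun N : ℕ => MFun q ((q : ℂ) ^ N * ρ)) atTop (𝓝 1) := by
  have h2 : q ^ 2 < 1 := pow_lt_one₀ hq0.le hq1 two_ne_zero
  -- M is a power series in ρ², so the scaling acts with base q². Its constant coefficient is
  -- (1-q)/(1-q) = 1.
  have := tendsto_powerSeries_scale (pow_pos hq0 2) h2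
    (c := fun n => (1 - q) / (1 - (q : ℂ) ^ (2 * n + 1)))
    (summable_norm_MTerm hq0 hq1 h)
  have hc : (1 - q : ℂ) ≠ 0 := by simpa using one_sub_ofReal_pow_ne_zero hq0 hq1 0
  simp only [mul_zero, zero_add, pow_one, div_self hc] at this
  refine this.congr fun N => tsum_congr fun n => ?_
  rw [MTerm]
  congr 2
  push_cast
  ring

/-- The expansion of `M` in partial fractions. -/
lemma hasSum_MFun {q : ℝ} (hq0 : 0 < q) (hq1 : q < 1) {ρ : ℂ} (h : ‖ρ‖ < 2 / (1 - q)) :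
    HasSum (fun k : ℕ => (1 - q) * (q : ℂ) ^ k / (1 + ((1 - q) / 2 * ((q : ℂ) ^ k * ρ)) ^ 2))
      (MFun q ρ) := by
  have hS : Summable fun k : ℕ =>
      (1 - q) * (q : ℂ) ^ k / (1 + ((1 - q) / 2 * ((q : ℂ) ^ k * ρ)) ^ 2) := by
    have hlim : Tendsto (fun k : ℕ => ‖((1 - q) / (1 + ((1 - q) / 2 * ((q : ℂ) ^ k * ρ)) ^ 2) : ℂ)‖)
        atTop (𝓝 ‖(1 - q : ℂ)‖) := by
      have h0 : Tendsto (fun k : ℕ => 1 + ((1 - q) / 2 * ((q : ℂ) ^ k * ρ)) ^ 2) atTop (𝓝 1) := by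
        simpa using ((((tendsto_ofReal_pow hq0 hq1).mul_const ρ).const_mul
          ((1 - q) / 2 : ℂ)).pow 2).const_add 1
      simpa using ((tendsto_const_nhds (x := (1 - q : ℂ))).div h0 one_ne_zero).norm
    obtain ⟨B, hB⟩ := hlim.bddAbove_range
    refine Summable.of_norm_bounded ((summable_geometric_of_lt_one hq0.le hq1).mul_left B)
      fun k => ?_
    rw [mul_div_right_comm, norm_mul, norm_ofReal_pow hq0]
    gcongr
    exact hB ⟨k, rfl⟩
  -- Iteration of `MFun_sub`; the remainder q^N M(q^N ρ) tends to 0 because M(q^N ρ) tends to 1.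
  have hpart : ∀ N : ℕ, ∑ k ∈ Finset.range N,
      (1 - q) * (q : ℂ) ^ k / (1 + ((1 - q) / 2 * ((q : ℂ) ^ k * ρ)) ^ 2) =
        MFun q ρ - (q : ℂ) ^ N * MFun q ((q : ℂ) ^ N * ρ) := fun N => by
    induction N with
    | zero => simp
    | succ N ih =>
      have := MFun_sub hq0 hq1 (norm_scale_lt hq0 hq1 h N)
      rw [← mul_assoc (q : ℂ), ← pow_succ'] at this
      rw [Finset.sum_range_succ, ih, mul_div_right_comm, ← this]
      ring
  have hlim : Tendsto (fun N : ℕ => MFun q ρ - (q : ℂ) ^ N * MFun q ((q : ℂ) ^ N * ρ)) atTop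
      (𝓝 (MFun q ρ)) := by
    simpa using ((tendsto_ofReal_pow hq0 hq1).mul (tendsto_MFun_scale hq0 hq1 h)).const_sub
      (MFun q ρ)
  have := hS.hasSum
  rwa [tendsto_nhds_unique this.tendsto_sum_nat (hlim.congr fun N => (hpart N).symm)] at this

/-- Each partial fraction is a positive multiple of 1/(1 + w²) with |w| < 1, and Re(1 + w²) > 0.
This is what excludes zeros of M. -/
lemma MFun_re_pos {q : ℝ} (hq0 : 0 < q) (hq1 : q < 1) {ρ : ℂ} (h : ‖ρ‖ < 2 / (1 - q)) :
    0 < (MFun q ρ).re := by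
  have hs := hasSum_re (hasSum_MFun hq0 hq1 h)
  have hpos : ∀ k : ℕ, 0 <
      ((1 - q) * (q : ℂ) ^ k / (1 + ((1 - q) / 2 * ((q : ℂ) ^ k * ρ)) ^ 2)).re := fun k => by
    have hk := norm_half_mul_lt_one hq1 (norm_scale_lt hq0 hq1 h k)
    set w := ((1 - q) / 2 * ((q : ℂ) ^ k * ρ) : ℂ) with hw
    have hne := one_add_sq_ne_zero hq1 (norm_scale_lt hq0 hq1 h k)
    rw [← hw] at hne
    have e : ((1 - q) * (q : ℂ) ^ k : ℂ) = (((1 - q) * q ^ k : ℝ) : ℂ) := by push_cast; ring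
    rw [e, div_eq_mul_inv, re_ofReal_mul, inv_re]
    have hre : 0 < (1 + w ^ 2).re := by
      have h1 : ‖w ^ 2‖ < 1 := by
        rw [norm_pow]; exact pow_lt_one₀ (norm_nonneg _) hk two_ne_zero
      have h2 := (abs_le.1 (abs_re_le_norm (w ^ 2))).1
      simp only [add_re, one_re]
      linarith
    have := normSq_pos.2 hne
    have : 0 < 1 - q := by linarith
    positivity
  exact hs.tsum_eq ▸ hs.summable.tsum_pos (fun k => (hpos k).le) 0 (hpos 0)

lemma MFun_ne_zero {q : ℝ} (hq0 : 0 < q) (hq1 : q < 1) {ρ : ℂ} (h : ‖ρ‖ < 2 / (1 - q)) :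
    MFun q ρ ≠ 0 := fun h0 => by
  have := MFun_re_pos hq0 hq1 h
  simp [h0] at this

lemma conj_MFun (q : ℝ) (ρ : ℂ) :
    (starRingEnd ℂ) (MFun q ρ) = MFun q ((starRingEnd ℂ) ρ) := by
  rw [MFun, MFun, conj_tsum]
  congr 1; ext n
  simp [MTerm, map_ofNat]

lemma gMero_ne_zero {q : ℝ} (hq0 : 0 < q) (hq1 : q < 1) {ρ : ℂ} (h : ‖ρ‖ < 2 / (1 - q)) :
    gMero q ρ ≠ 0 := div_ne_zero (mFun_ne_zero hq0 hq1 h) (pFun_ne_zero hq0 hq1 h)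

lemma analyticAt_gMero {q : ℝ} (hq0 : 0 < q) (hq1 : q < 1) {ρ : ℂ} (h : pFun q ρ ≠ 0) :
    AnalyticAt ℂ (gMero q) ρ :=
  ((differentiable_mFun hq0 hq1).analyticAt ρ).div ((differentiable_pFun hq0 hq1).analyticAt ρ) h

lemma gMero_eq {q : ℝ} (hq0 : 0 < q) (hq1 : q < 1) {ρ : ℂ} (h : ‖ρ‖ < 2 / (1 - q)) :
    (1 - I * ((1 - q) / 2) * ρ) * gMero q ρ =
      (1 + I * ((1 - q) / 2) * ρ) * gMero q (q * ρ) := by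
  have h1 := one_sub_ne_zero_of_norm_lt (norm_I_half_mul_lt_one hq1 h)
  have h2 := pFun_ne_zero hq0 hq1 (show ‖(q : ℂ) * ρ‖ < 2 / (1 - q) by
    simpa using norm_scale_lt hq0 hq1 h 1)
  rw [gMero, gMero, mFun_eq hq0 hq1 ρ, pFun_eq hq0 hq1 ρ]
  generalize 1 - I * ((1 - q) / 2 : ℂ) * ρ = b at *
  field_simp

/-- Both g'/g and iM satisfy the same inhomogeneous `q`-difference equation. Their difference δ thus
obeys δ(ρ) = q^N δ(q^N ρ), and it is continuous at 0, so it vanishes. -/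
lemma deriv_gMero {q : ℝ} (hq0 : 0 < q) (hq1 : q < 1) {ρ : ℂ} (h : ‖ρ‖ < 2 / (1 - q)) :
    deriv (gMero q) ρ = I * gMero q ρ * MFun q ρ := by
  set c : ℂ := I * ((1 - q) / 2) with hc
  set δ : ℂ → ℂ := fun z => deriv (gMero q) z / gMero q z - I * MFun q z with hδ
  have hfe : ∀ z : ℂ, ‖z‖ < 2 / (1 - q) → δ z = q * δ (q * z) := fun z hz => by
    have hz' : ‖(q : ℂ) * z‖ < 2 / (1 - q) := by simpa using norm_scale_lt hq0 hq1 hz 1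
    have d1 := (analyticAt_gMero hq0 hq1 (pFun_ne_zero hq0 hq1 hz)).differentiableAt.hasDerivAt
    have d2 := (analyticAt_gMero hq0 hq1 (pFun_ne_zero hq0 hq1 hz')).differentiableAt.hasDerivAt
    have l1 : HasDerivAt (fun z => (1 - c * z) * gMero q z)
        (-c * gMero q z + (1 - c * z) * deriv (gMero q) z) z := by
      simpa using (((hasDerivAt_id z).const_mul c).const_sub 1).fun_mul d1
    have d3 : HasDerivAt (fun z => gMero q (q * z)) (deriv (gMero q) (q * z) * q) z :=
      d2.comp z (by simpa using (hasDerivAt_id z).const_mul (q : ℂ))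
    have l2 : HasDerivAt (fun z => (1 + c * z) * gMero q (q * z))
        (c * gMero q (q * z) + (1 + c * z) * (deriv (gMero q) (q * z) * q)) z := by
      simpa using (((hasDerivAt_id z).const_mul c).const_add 1).fun_mul d3
    have hev : (fun z => (1 - c * z) * gMero q z) =ᶠ[𝓝 z]
        fun z => (1 + c * z) * gMero q (q * z) := by
      filter_upwards [(isOpen_lt continuous_norm continuous_const).mem_nhds hz] with y hy
      exact gMero_eq hq0 hq1 hy
    have hder := (l2.congr_of_eventuallyEq hev).unique l1
    have hM := MFun_sub hq0 hq1 hz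
    have hg := gMero_eq hq0 hq1 hz
    have g1 := gMero_ne_zero hq0 hq1 hz
    have g2 := gMero_ne_zero hq0 hq1 hz'
    have n1 := one_sub_ne_zero_of_norm_lt (norm_I_half_mul_lt_one hq1 hz)
    have n2 := one_sub_ne_zero_of_norm_lt (norm_neg_I_half_mul_lt_one hq1 hz)
    have n3 := one_add_sq_ne_zero hq1 hz
    rw [← hc] at n1 hg
    have n2' : 1 + c * z ≠ 0 := by simpa [hc] using n2
    have hcc : (1 + ((1 - q) / 2 * z) ^ 2 : ℂ) = (1 - c * z) * (1 + c * z) := by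
      rw [hc]
      linear_combination ((1 - q) / 2 * z : ℂ) ^ 2 * I_sq
    -- The right side is the logarithmic derivative of (1 + cz)/(1 - cz), the factor relating g(z)
    -- to g(qz).
    have e1 : deriv (gMero q) z / gMero q z - q * (deriv (gMero q) (q * z) / gMero q (q * z)) =
        2 * c / ((1 - c * z) * (1 + c * z)) := by
      have hg2 : gMero q z = (1 + c * z) * gMero q (q * z) / (1 - c * z) := by
        rw [eq_div_iff n1, ← hg]; ring
      have hd2 : deriv (gMero q) z = (c * gMero q (q * z) + (1 + c * z) *
          (deriv (gMero q) (q * z) * q) + c * gMero q z) / (1 - c * z) := by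
        rw [eq_div_iff n1, hder]; ring
      rw [hd2, hg2]
      field_simp
      ring
    have e2 : I * (MFun q z - q * MFun q (q * z)) = 2 * c / ((1 - c * z) * (1 + c * z)) := by
      rw [hM, hcc, hc]; ring
    simp only [hδ]
    linear_combination e1 - e2
  have hit : ∀ N : ℕ, δ ρ = (q : ℂ) ^ N * δ ((q : ℂ) ^ N * ρ) := fun N => by
    induction N with
    | zero => simp
    | succ N ih =>
      rw [ih, hfe _ (norm_scale_lt hq0 hq1 h N), ← mul_assoc (q : ℂ), ← pow_succ' (q : ℂ)]
      ring
  have hlimδ : Tendsto (fun N : ℕ => δ ((q : ℂ) ^ N * ρ)) atTop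
      (𝓝 (deriv (gMero q) 0 / gMero q 0 - I * 1)) := by
    have h0 : Tendsto (fun N : ℕ => (q : ℂ) ^ N * ρ) atTop (𝓝 0) := by
      simpa using (tendsto_ofReal_pow hq0 hq1).mul_const ρ
    have ha := analyticAt_gMero hq0 hq1 (ρ := 0) (by simp [pFun_zero])
    have hg0 : gMero q 0 ≠ 0 := by simp [gMero, pFun_zero, mFun_zero]
    exact ((ha.deriv.continuousAt.tendsto.comp h0).div (ha.continuousAt.tendsto.comp h0) hg0).sub
      ((tendsto_MFun_scale hq0 hq1 h).const_mul I)
  have hzero : δ ρ = 0 := by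
    have := (tendsto_ofReal_pow hq0 hq1).mul hlimδ
    rw [zero_mul] at this
    exact tendsto_nhds_unique (tendsto_const_nhds.congr fun N => hit N) this
  have := gMero_ne_zero hq0 hq1 h
  rw [hδ, sub_eq_zero, div_eq_iff this] at hzero
  rw [hzero]; ring

lemma hasDerivAt_gMero {q : ℝ} (hq0 : 0 < q) (hq1 : q < 1) {ρ : ℂ} (h : ‖ρ‖ < 2 / (1 - q)) :
    HasDerivAt (gMero q) (I * gMero q ρ * MFun q ρ) ρ := by
  rw [← deriv_gMero hq0 hq1 h]
  exact (analyticAt_gMero hq0 hq1 (pFun_ne_zero hq0 hq1 h)).differentiableAt.hasDerivAt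

/-- Analyticity is read off from M = g'/(ig); the series of M need not be differentiated. -/
lemma analyticAt_MFun {q : ℝ} (hq0 : 0 < q) (hq1 : q < 1) {ρ : ℂ} (h : ‖ρ‖ < 2 / (1 - q)) :
    AnalyticAt ℂ (MFun q) ρ := by
  have ha := analyticAt_gMero hq0 hq1 (pFun_ne_zero hq0 hq1 h)
  refine ((ha.deriv.div (analyticAt_const (v := I).mul ha)
    (mul_ne_zero I_ne_zero (gMero_ne_zero hq0 hq1 h)))).congr ?_
  filter_upwards [(isOpen_lt continuous_norm continuous_const).mem_nhds h] with y hy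
  have := gMero_ne_zero hq0 hq1 hy
  simp only [Pi.div_apply, Pi.mul_apply]
  rw [deriv_gMero hq0 hq1 hy]
  field_simp

lemma meromorphic_gMero {q : ℝ} (hq0 : 0 < q) (hq1 : q < 1) : Meromorphic (gMero q) := fun ρ =>
  ((differentiable_mFun hq0 hq1).analyticAt ρ).meromorphicAt.div
    ((differentiable_pFun hq0 hq1).analyticAt ρ).meromorphicAt

lemma hasProd_pFun {q : ℝ} (hq0 : 0 < q) (hq1 : q < 1) (ρ : ℂ) :
    HasProd (fun n : ℕ => 1 - I * ((1 - q) / 2) * ρ * (q : ℂ) ^ n) (pFun q ρ) :=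
  (multipliable_qPoch hq0 hq1 _).hasProd

lemma hasProd_mFun {q : ℝ} (hq0 : 0 < q) (hq1 : q < 1) (ρ : ℂ) :
    HasProd (fun n : ℕ => 1 - -I * ((1 - q) / 2) * ρ * (q : ℂ) ^ n) (mFun q ρ) :=
  (multipliable_qPoch hq0 hq1 _).hasProd

lemma pole_ratio {q : ℝ} (hq0 : 0 < q) (hq1 : q < 1) (ρ : ℂ) (n : ℕ) :
    (pole q n - ρ) / (pole q n + ρ) = (1 - -I * ((1 - q) / 2) * ρ * (q : ℂ) ^ n) /
      (1 - I * ((1 - q) / 2) * ρ * (q : ℂ) ^ n) := by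
  have hqn : (q : ℂ) ^ n ≠ 0 := pow_ne_zero _ (by exact_mod_cast hq0.ne')
  have hc : (1 - q : ℂ) ≠ 0 := by simpa using one_sub_ofReal_pow_ne_zero hq0 hq1 0
  have hpole : pole q n ≠ 0 := by
    exact div_ne_zero (mul_ne_zero (mul_ne_zero two_ne_zero I_ne_zero) (inv_ne_zero hqn)) hc
  rw [← mul_div_mul_left (1 - -I * ((1 - q) / 2) * ρ * (q : ℂ) ^ n) _ hpole]
  -- So `pole q n` is the zero of the n-th factor of m, and its negative is the zero of the n-th
  -- factor of p.
  have key : pole q n * (I * ((1 - q) / 2) * ρ * (q : ℂ) ^ n) = -ρ := by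
    unfold pole
    field_simp
    linear_combination ρ * I_sq
  congr 1
  · linear_combination -key
  · linear_combination key

lemma pole_ratio' {q : ℝ} (hq0 : 0 < q) (hq1 : q < 1) (ρ : ℂ) (n : ℕ) :
    (pole q n + ρ) / (pole q n - ρ) = (1 - I * ((1 - q) / 2) * ρ * (q : ℂ) ^ n) /
      (1 - -I * ((1 - q) / 2) * ρ * (q : ℂ) ^ n) := by
  rw [← inv_div, pole_ratio hq0 hq1, inv_div]

lemma qExp_eq_mFun (q : ℝ) (ρ : ℂ) : qExp q ((1 - q) * I * ρ / 2) = mFun q ρ :=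
  tprod_congr fun n => by ring

lemma qExp_neg_eq_pFun (q : ℝ) (ρ : ℂ) : qExp q (-((1 - q) * I * ρ / 2)) = pFun q ρ :=
  tprod_congr fun n => by ring

lemma qexp_eq_inv_pFun {q : ℝ} (hq0 : 0 < q) (hq1 : q < 1) {ρ : ℂ} (h : pFun q ρ ≠ 0) :
    qexp q ((1 - q) * I * ρ / 2) = (pFun q ρ)⁻¹ := by
  rw [← ((hasProd_pFun hq0 hq1 ρ).inv₀ h).tprod_eq]
  exact tprod_congr fun n => by ring_nf

lemma qexp_neg_eq_inv_mFun {q : ℝ} (hq0 : 0 < q) (hq1 : q < 1) {ρ : ℂ} (h : mFun q ρ ≠ 0) :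
    qexp q (-((1 - q) * I * ρ / 2)) = (mFun q ρ)⁻¹ := by
  rw [← ((hasProd_mFun hq0 hq1 ρ).inv₀ h).tprod_eq]
  exact tprod_congr fun n => by ring_nf

lemma gMero_product {q : ℝ} (hq0 : 0 < q) (hq1 : q < 1) (ρ : ℂ) (h : pFun q ρ ≠ 0) :
    HasProd (fun n : ℕ => (pole q n - ρ) / (pole q n + ρ)) (gMero q ρ) ∧
      gMero q ρ = qexp q ((1 - q) * I * ρ / 2) * qExp q ((1 - q) * I * ρ / 2) := by
  constructor
  · simp only [pole_ratio hq0 hq1]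
    exact (hasProd_mFun hq0 hq1 ρ).div₀ (hasProd_pFun hq0 hq1 ρ) h
  · rw [qExp_eq_mFun, qexp_eq_inv_pFun hq0 hq1 h, gMero, div_eq_mul_inv, mul_comm]

lemma gMero_inv_product {q : ℝ} (hq0 : 0 < q) (hq1 : q < 1) (ρ : ℂ) (h : mFun q ρ ≠ 0) :
    HasProd (fun n : ℕ => (pole q n + ρ) / (pole q n - ρ)) (gMero q ρ)⁻¹ ∧
      (gMero q ρ)⁻¹ = qexp q (-((1 - q) * I * ρ / 2)) * qExp q (-((1 - q) * I * ρ / 2)) := by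
  constructor
  · simp only [pole_ratio' hq0 hq1, gMero, inv_div]
    exact (hasProd_pFun hq0 hq1 ρ).div₀ (hasProd_mFun hq0 hq1 ρ) h
  · rw [qExp_neg_eq_pFun, qexp_neg_eq_inv_mFun hq0 hq1 h, gMero, inv_div, div_eq_mul_inv, mul_comm]

/-! ### Partial derivatives in the `(t, r)` half plane -/

section Calculus

variable {E : Type*} [NormedAddCommGroup E] [NormedSpace ℝ E]

/-- The partial derivative in the first variable. -/
def dT (F : ℝ → ℝ → E) (t r : ℝ) : E := deriv (fun s => F s r) t

/-- The partial derivative in the second variable. -/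
def dR (F : ℝ → ℝ → E) (t r : ℝ) : E := deriv (fun s => F t s) r

lemma hasDerivAt_curve {F : ℝ → ℝ → E} {a b : ℝ → ℝ} {a' b' s : ℝ}
    (hF : DifferentiableAt ℝ (fun z : ℝ × ℝ => F z.1 z.2) (a s, b s))
    (ha : HasDerivAt a a' s) (hb : HasDerivAt b b' s) :
    HasDerivAt (fun s => F (a s) (b s))
      (a' • dT F (a s) (b s) + b' • dR F (a s) (b s)) s := by
  set L := fderiv ℝ (fun z : ℝ × ℝ => F z.1 z.2) (a s, b s)
  have hT : dT F (a s) (b s) = L (1, 0) := by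
    have := hF.hasFDerivAt.comp_hasDerivAt (a s)
      ((hasDerivAt_id (a s)).prodMk (hasDerivAt_const (a s) (b s)))
    exact this.deriv
  have hR : dR F (a s) (b s) = L (0, 1) := by
    have := hF.hasFDerivAt.comp_hasDerivAt (b s)
      ((hasDerivAt_const (b s) (a s)).prodMk (hasDerivAt_id (b s)))
    exact this.deriv
  have := hF.hasFDerivAt.comp_hasDerivAt s (ha.prodMk hb)
  convert! this using 1
  rw [hT, hR, ← map_smul, ← map_smul, ← map_add]
  simp [L]

lemma hasDerivAt_dT {F : ℝ → ℝ → E} {t r : ℝ}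
    (hF : DifferentiableAt ℝ (fun z : ℝ × ℝ => F z.1 z.2) (t, r)) :
    HasDerivAt (fun s => F s r) (dT F t r) t := by
  simpa using hasDerivAt_curve (a := id) (b := fun _ => r) hF (hasDerivAt_id t)
    (hasDerivAt_const t r)

lemma hasDerivAt_dR {F : ℝ → ℝ → E} {t r : ℝ}
    (hF : DifferentiableAt ℝ (fun z : ℝ × ℝ => F z.1 z.2) (t, r)) :
    HasDerivAt (fun s => F t s) (dR F t r) r := by
  simpa using hasDerivAt_curve (a := fun _ => t) (b := id) hF (hasDerivAt_const r t)
    (hasDerivAt_id r)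

lemma dT_eq_fderiv {F : ℝ → ℝ → E} {z : ℝ × ℝ}
    (hF : DifferentiableAt ℝ (fun z : ℝ × ℝ => F z.1 z.2) z) :
    dT F z.1 z.2 = fderiv ℝ (fun z : ℝ × ℝ => F z.1 z.2) z (1, 0) := by
  have := hF.hasFDerivAt.comp_hasDerivAt z.1
    ((hasDerivAt_id z.1).prodMk (hasDerivAt_const z.1 z.2))
  exact this.deriv

lemma dR_eq_fderiv {F : ℝ → ℝ → E} {z : ℝ × ℝ}
    (hF : DifferentiableAt ℝ (fun z : ℝ × ℝ => F z.1 z.2) z) :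
    dR F z.1 z.2 = fderiv ℝ (fun z : ℝ × ℝ => F z.1 z.2) z (0, 1) := by
  have := hF.hasFDerivAt.comp_hasDerivAt z.2
    ((hasDerivAt_const z.2 z.1).prodMk (hasDerivAt_id z.2))
  exact this.deriv

lemma dT_congr {F G : ℝ → ℝ → E} {V : Set (ℝ × ℝ)} (hV : IsOpen V)
    (h : ∀ z ∈ V, F z.1 z.2 = G z.1 z.2) {t r : ℝ} (hz : (t, r) ∈ V) : dT F t r = dT G t r := by
  refine EventuallyEq.deriv_eq ?_
  have : ContinuousAt (fun s : ℝ => (s, r)) t := by fun_prop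
  filter_upwards [this.preimage_mem_nhds (hV.mem_nhds hz)] with s hs using h _ hs

lemma dR_congr {F G : ℝ → ℝ → E} {V : Set (ℝ × ℝ)} (hV : IsOpen V)
    (h : ∀ z ∈ V, F z.1 z.2 = G z.1 z.2) {t r : ℝ} (hz : (t, r) ∈ V) : dR F t r = dR G t r := by
  refine EventuallyEq.deriv_eq ?_
  have : ContinuousAt (fun s : ℝ => (t, s)) r := by fun_prop
  filter_upwards [this.preimage_mem_nhds (hV.mem_nhds hz)] with s hs using h _ hs

lemma contDiffOn_dT {F : ℝ → ℝ → E} {V : Set (ℝ × ℝ)} (hV : IsOpen V) {m n : WithTop ℕ∞}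
    (hF : ContDiffOn ℝ n (fun z : ℝ × ℝ => F z.1 z.2) V) (hmn : m + 1 ≤ n) :
    ContDiffOn ℝ m (fun z : ℝ × ℝ => dT F z.1 z.2) V := by
  have h1 : n ≠ 0 := fun h => by simp [h] at hmn
  refine ((hF.fderiv_of_isOpen hV hmn).clm_apply
    (contDiffOn_const (c := ((1, 0) : ℝ × ℝ)))).congr fun z hz => ?_
  exact dT_eq_fderiv ((hF.differentiableOn h1).differentiableAt (hV.mem_nhds hz))

lemma contDiffOn_dR {F : ℝ → ℝ → E} {V : Set (ℝ × ℝ)} (hV : IsOpen V) {m n : WithTop ℕ∞}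
    (hF : ContDiffOn ℝ n (fun z : ℝ × ℝ => F z.1 z.2) V) (hmn : m + 1 ≤ n) :
    ContDiffOn ℝ m (fun z : ℝ × ℝ => dR F z.1 z.2) V := by
  have h1 : n ≠ 0 := fun h => by simp [h] at hmn
  refine ((hF.fderiv_of_isOpen hV hmn).clm_apply
    (contDiffOn_const (c := ((0, 1) : ℝ × ℝ)))).congr fun z hz => ?_
  exact dR_eq_fderiv ((hF.differentiableOn h1).differentiableAt (hV.mem_nhds hz))

/-- Both sides are values of the second Fréchet derivative, which is symmetric for C² functions. -/
lemma dT_dR_comm {F : ℝ → ℝ → E} {V : Set (ℝ × ℝ)} (hV : IsOpen V)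
    (hF : ContDiffOn ℝ 2 (fun z : ℝ × ℝ => F z.1 z.2) V) {t r : ℝ} (hz : (t, r) ∈ V) :
    dT (dR F) t r = dR (dT F) t r := by
  have hd : ∀ z ∈ V, DifferentiableAt ℝ (fun z : ℝ × ℝ => F z.1 z.2) z := fun z hz =>
    (hF.differentiableOn two_ne_zero).differentiableAt (hV.mem_nhds hz)
  have hf : DifferentiableAt ℝ (fderiv ℝ (fun z : ℝ × ℝ => F z.1 z.2)) (t, r) :=
    ((hF.fderiv_of_isOpen (m := 1) hV (by norm_num)).differentiableOn one_ne_zero).differentiableAt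
      (hV.mem_nhds hz)
  have hsymm : IsSymmSndFDerivAt ℝ (fun z : ℝ × ℝ => F z.1 z.2) (t, r) :=
    (hF.contDiffAt (hV.mem_nhds hz)).isSymmSndFDerivAt (by simp)
  have hH : ∀ v : ℝ × ℝ, HasFDerivAt (fun z => fderiv ℝ (fun z : ℝ × ℝ => F z.1 z.2) z v)
      ((fderiv ℝ (fderiv ℝ (fun z : ℝ × ℝ => F z.1 z.2)) (t, r)).flip v) (t, r) := fun v => by
    have := hf.hasFDerivAt.clm_apply (hasFDerivAt_const v (t, r))
    simpa using this
  have e1 : dT (dR F) t r =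
      fderiv ℝ (fderiv ℝ (fun z : ℝ × ℝ => F z.1 z.2)) (t, r) (1, 0) (0, 1) := by
    rw [dT_congr hV (G := fun t r => fderiv ℝ (fun z : ℝ × ℝ => F z.1 z.2) (t, r) (0, 1))
      (fun z hz => dR_eq_fderiv (hd z hz)) hz]
    have h := hH (0, 1)
    exact (dT_eq_fderiv (F := fun t r => fderiv ℝ (fun z : ℝ × ℝ => F z.1 z.2) (t, r) (0, 1))
      (z := (t, r)) h.differentiableAt).trans (by rw [h.fderiv]; rfl)
  have e2 : dR (dT F) t r =
      fderiv ℝ (fderiv ℝ (fun z : ℝ × ℝ => F z.1 z.2)) (t, r) (0, 1) (1, 0) := by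
    rw [dR_congr hV (G := fun t r => fderiv ℝ (fun z : ℝ × ℝ => F z.1 z.2) (t, r) (1, 0))
      (fun z hz => dT_eq_fderiv (hd z hz)) hz]
    have h := hH (1, 0)
    exact (dR_eq_fderiv (F := fun t r => fderiv ℝ (fun z : ℝ × ℝ => F z.1 z.2) (t, r) (1, 0))
      (z := (t, r)) h.differentiableAt).trans (by rw [h.fderiv]; rfl)
  rw [e1, e2]
  exact hsymm _ _

end Calculus

/-! ### Functions of `(t, r)` on spacetime -/

/-- `∂t/∂x_μ`. -/
def gradT (μ : Fin 4) : ℝ := if μ = 0 then 1 else 0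

/-- `∂r/∂x_μ`. -/
def gradR (x : Spacetime) (μ : Fin 4) : ℝ := if μ = 0 then 0 else x μ / radius x

lemma radius_sq (x : Spacetime) : radius x ^ 2 = x 1 ^ 2 + x 2 ^ 2 + x 3 ^ 2 :=
  Real.sq_sqrt (by positivity)

lemma hasDerivAt_update (x : Spacetime) (μ ν : Fin 4) :
    HasDerivAt (fun s => Function.update x μ s ν) (if ν = μ then 1 else 0) (x μ) := by
  by_cases h : ν = μ
  · subst h; simpa using hasDerivAt_id' (x ν)
  · simpa [h] using hasDerivAt_const (x μ) (x ν)

lemma hasDerivAt_radius {x : Spacetime} (hr : 0 < radius x) (μ : Fin 4) :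
    HasDerivAt (fun s => radius (Function.update x μ s)) (gradR x μ) (x μ) := by
  have hne : Function.update x μ (x μ) 1 ^ 2 + Function.update x μ (x μ) 2 ^ 2 +
      Function.update x μ (x μ) 3 ^ 2 ≠ 0 := by
    rw [Function.update_eq_self, ← radius_sq]; positivity
  have h := ((((hasDerivAt_update x μ 1).fun_pow 2).fun_add
    ((hasDerivAt_update x μ 2).fun_pow 2)).fun_add ((hasDerivAt_update x μ 3).fun_pow 2)).sqrt hne
  refine h.congr_deriv ?_
  rw [Function.update_eq_self]
  change _ / (2 * radius x) = _
  fin_cases μ <;> simp [gradR] <;> field_simp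

lemma hasDerivAt_radial {E : Type*} [NormedAddCommGroup E] [NormedSpace ℝ E] {F : ℝ → ℝ → E}
    {x : Spacetime} (hr : 0 < radius x)
    (hF : DifferentiableAt ℝ (fun z : ℝ × ℝ => F z.1 z.2) (x 0, radius x)) (μ : Fin 4) :
    HasDerivAt (fun s => F (Function.update x μ s 0) (radius (Function.update x μ s)))
      (gradT μ • dT F (x 0) (radius x) + gradR x μ • dR F (x 0) (radius x)) (x μ) := by
  have h := hasDerivAt_curve (F := F) (a := fun s => Function.update x μ s 0)
    (b := fun s => radius (Function.update x μ s)) (s := x μ) (by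
      simpa only [Function.update_eq_self] using hF) (hasDerivAt_update x μ 0)
      (hasDerivAt_radius hr μ)
  simp only [Function.update_eq_self] at h
  simpa [gradT, eq_comm] using h

/-! ### Curvature of an `su(2)` connection -/

/-- The field strength of a connection with real components `B` and partial derivatives
`D a ν μ = ∂_ν B a μ`. -/
def fieldStrength (B : Fin 3 → Fin 4 → ℝ) (D : Fin 3 → Fin 4 → Fin 4 → ℝ) (a : Fin 3)
    (μ ν : Fin 4) : ℝ :=
  D a μ ν - D a ν μ + ∑ b : Fin 3, ∑ c : Fin 3, epsilon a b c * (B b μ * B c ν)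

lemma hasDerivAt_pauli_sum {f : Fin 3 → ℝ → ℝ} {f' : Fin 3 → ℝ} {s : ℝ}
    (h : ∀ a, HasDerivAt (f a) (f' a) s) (i j : Fin 2) :
    HasDerivAt (fun s => ((1 / 2 : ℂ) • ∑ a : Fin 3, (f a s : ℂ) • pauli a) i j)
      (((1 / 2 : ℂ) • ∑ a : Fin 3, (f' a : ℂ) • pauli a) i j) s := by
  simp only [Matrix.smul_apply, Matrix.sum_apply, smul_eq_mul]
  exact (HasDerivAt.fun_sum fun a _ => (h a).ofReal_comp.mul_const _).const_mul _

/-- Since -i[σ_b/2, σ_c/2] = ∑ ε_{abc} σ_a/2, the commutator becomes the quadratic ε-term, and the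
matrix curvature is governed by real components. -/
lemma curvature_eq {C : Fin 3 → Fin 4 → Spacetime → ℝ} {D : Fin 3 → Fin 4 → Fin 4 → ℝ}
    {x : Spacetime}
    (h : ∀ a ν μ, HasDerivAt (fun s => C a μ (Function.update x ν s)) (D a ν μ) (x ν))
    (μ ν : Fin 4) :
    curvature (fun μ x => (1 / 2 : ℂ) • ∑ a : Fin 3, (C a μ x : ℂ) • pauli a) μ ν x =
      (1 / 2 : ℂ) • ∑ a : Fin 3,
        (fieldStrength (fun a μ => C a μ x) D a μ ν : ℂ) • pauli a := by
  have hpd : ∀ ν μ, pd ν (fun x => (1 / 2 : ℂ) • ∑ a : Fin 3, (C a μ x : ℂ) • pauli a) x =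
      (1 / 2 : ℂ) • ∑ a : Fin 3, (D a ν μ : ℂ) • pauli a := fun ν μ => by
    ext i j
    exact (hasDerivAt_pauli_sum (fun a => h a ν μ) i j).deriv
  rw [curvature, hpd, hpd]
  ext i j
  fin_cases i <;> fin_cases j <;>
  · simp [pauli, Fin.sum_univ_three, fieldStrength, epsilon]
    ring_nf
    simp only [I_sq]
    ring

lemma pauli_sum_eq_zero {c : Fin 3 → ℝ} :
    (1 / 2 : ℂ) • ∑ a : Fin 3, (c a : ℂ) • pauli a = 0 ↔ ∀ a, c a = 0 := by
  constructor
  · intro h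
    have h00 := congrFun (congrFun h 0) 0
    have h01 := congrFun (congrFun h 0) 1
    simp [pauli, Fin.sum_univ_three, Complex.ext_iff] at h00 h01
    intro a
    fin_cases a <;> simp_all
  · intro h
    simp [h]

lemma isASDAt_iff {C : Fin 3 → Fin 4 → Spacetime → ℝ} {D : Fin 3 → Fin 4 → Fin 4 → ℝ}
    {x : Spacetime}
    (h : ∀ a ν μ, HasDerivAt (fun s => C a μ (Function.update x ν s)) (D a ν μ) (x ν)) :
    IsASDAt (fun μ x => (1 / 2 : ℂ) • ∑ a : Fin 3, (C a μ x : ℂ) • pauli a) x ↔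
      ∀ a, (fieldStrength (fun a μ => C a μ x) D a 0 1 +
          fieldStrength (fun a μ => C a μ x) D a 2 3 = 0) ∧
        (fieldStrength (fun a μ => C a μ x) D a 0 2 +
          fieldStrength (fun a μ => C a μ x) D a 3 1 = 0) ∧
        (fieldStrength (fun a μ => C a μ x) D a 0 3 +
          fieldStrength (fun a μ => C a μ x) D a 1 2 = 0) := by
  have key : ∀ μ ν κ l,
      curvature (fun μ x => (1 / 2 : ℂ) • ∑ a : Fin 3, (C a μ x : ℂ) • pauli a) μ ν x =
        -curvature (fun μ x => (1 / 2 : ℂ) • ∑ a : Fin 3, (C a μ x : ℂ) • pauli a) κ l x ↔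
      ∀ a, fieldStrength (fun a μ => C a μ x) D a μ ν +
          fieldStrength (fun a μ => C a μ x) D a κ l = 0 := fun μ ν κ l => by
    rw [curvature_eq h, curvature_eq h, ← add_eq_zero_iff_eq_neg, ← smul_add,
      ← Finset.sum_add_distrib, ← pauli_sum_eq_zero]
    simp only [← add_smul, ofReal_add]
  rw [IsASDAt, key, key, key]
  simp only [forall_and]

/-! ### Witten's ansatz -/

/-- The general rotationally symmetric `su(2)` form, with profile functions of `(t, r)`. -/
def sphericalComponent (T U V W : ℝ → ℝ → ℝ) (a : Fin 3) (μ : Fin 4) (x : Spacetime) : ℝ :=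
  Fin.cases (T (x 0) (radius x) * x a.succ)
    (fun i : Fin 3 => U (x 0) (radius x) * (x i.succ * x a.succ)
      + V (x 0) (radius x) * (if i = a then 1 else 0)
      + W (x 0) (radius x) * ∑ k : Fin 3, epsilon i a k * x k.succ) μ

/-- The partial derivatives of `sphericalComponent`. -/
def sphericalDeriv (T U V W : ℝ → ℝ → ℝ) (x : Spacetime) (a : Fin 3) (ν μ : Fin 4) : ℝ :=
  Fin.cases
    ((gradT ν * dT T (x 0) (radius x) + gradR x ν * dR T (x 0) (radius x)) * x a.succ +
      T (x 0) (radius x) * (if a.succ = ν then 1 else 0))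
    (fun i : Fin 3 =>
      (gradT ν * dT U (x 0) (radius x) + gradR x ν * dR U (x 0) (radius x)) *
          (x i.succ * x a.succ) +
        U (x 0) (radius x) *
          ((if i.succ = ν then 1 else 0) * x a.succ + x i.succ * (if a.succ = ν then 1 else 0))
      + (gradT ν * dT V (x 0) (radius x) + gradR x ν * dR V (x 0) (radius x)) *
          (if i = a then 1 else 0)
      + ((gradT ν * dT W (x 0) (radius x) + gradR x ν * dR W (x 0) (radius x)) *
          (∑ k : Fin 3, epsilon i a k * x k.succ) +
        W (x 0) (radius x) * ∑ k : Fin 3, epsilon i a k * (if k.succ = ν then 1 else 0))) μ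

lemma hasDerivAt_sphericalComponent {T U V W : ℝ → ℝ → ℝ} {x : Spacetime} (hr : 0 < radius x)
    (hT : DifferentiableAt ℝ (fun z : ℝ × ℝ => T z.1 z.2) (x 0, radius x))
    (hU : DifferentiableAt ℝ (fun z : ℝ × ℝ => U z.1 z.2) (x 0, radius x))
    (hV : DifferentiableAt ℝ (fun z : ℝ × ℝ => V z.1 z.2) (x 0, radius x))
    (hW : DifferentiableAt ℝ (fun z : ℝ × ℝ => W z.1 z.2) (x 0, radius x))
    (a : Fin 3) (ν μ : Fin 4) :
    HasDerivAt (fun s => sphericalComponent T U V W a μ (Function.update x ν s))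
      (sphericalDeriv T U V W x a ν μ) (x ν) := by
  have hsum : ∀ i : Fin 3, HasDerivAt
      (fun s => ∑ k : Fin 3, epsilon i a k * Function.update x ν s k.succ)
      (∑ k : Fin 3, epsilon i a k * (if k.succ = ν then 1 else 0)) (x ν) := fun i =>
    HasDerivAt.fun_sum fun k _ => (hasDerivAt_update x ν k.succ).const_mul _
  induction μ using Fin.cases with
  | zero =>
    have := (hasDerivAt_radial hr hT ν).fun_mul (hasDerivAt_update x ν a.succ)
    simpa only [sphericalComponent, sphericalDeriv, Fin.cases_zero, Function.update_eq_self,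
      smul_eq_mul] using this
  | succ i =>
    have := (((hasDerivAt_radial hr hU ν).fun_mul ((hasDerivAt_update x ν i.succ).fun_mul
      (hasDerivAt_update x ν a.succ))).fun_add ((hasDerivAt_radial hr hV ν).mul_const
      (if i = a then 1 else 0))).fun_add ((hasDerivAt_radial hr hW ν).fun_mul (hsum i))
    simpa only [sphericalComponent, sphericalDeriv, Fin.cases_succ, Function.update_eq_self,
      smul_eq_mul] using this

/-- The three tensors y_i y_a, δ_{ia} and ε_{iak} y_k are independent for y ≠ 0. Contracting the
antisymmetric part with ε and y isolates `Ec`. The trace and the contraction with y y separate `Ea`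
from `Eb`. -/
lemma spherical_tensor_eq_zero {y : Fin 3 → ℝ} (hy : 0 < y 0 ^ 2 + y 1 ^ 2 + y 2 ^ 2)
    {Ea Eb Ec : ℝ} :
    (∀ a i : Fin 3, y i * y a * Ea + (if i = a then 1 else 0) * Eb +
      (∑ k : Fin 3, epsilon i a k * y k) * Ec = 0) ↔
      ((y 0 ^ 2 + y 1 ^ 2 + y 2 ^ 2) * Ea + Eb = 0 ∧ Eb = 0 ∧ Ec = 0) := by
  constructor
  · intro h
    have h00 := h 0 0
    have h01 := h 0 1
    have h02 := h 0 2
    have h10 := h 1 0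
    have h11 := h 1 1
    have h12 := h 1 2
    have h20 := h 2 0
    have h21 := h 2 1
    have h22 := h 2 2
    simp [Fin.sum_univ_three, epsilon] at h00 h01 h02 h10 h11 h12 h20 h21 h22
    have hc : (y 0 ^ 2 + y 1 ^ 2 + y 2 ^ 2) * Ec = 0 := by
      linear_combination y 2 * (h10 - h01) / 2 + y 1 * (h02 - h20) / 2 + y 0 * (h21 - h12) / 2
    have hb : (y 0 ^ 2 + y 1 ^ 2 + y 2 ^ 2) * Eb = 0 := by
      linear_combination (y 0 ^ 2 + y 1 ^ 2 + y 2 ^ 2) * (h00 + h11 + h22) / 2 -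
        (y 0 ^ 2 * h00 + y 1 ^ 2 * h11 + y 2 ^ 2 * h22 + y 0 * y 1 * (h01 + h10) +
          y 0 * y 2 * (h02 + h20) + y 1 * y 2 * (h12 + h21)) / 2
    have hb0 := (mul_eq_zero.1 hb).resolve_left hy.ne'
    refine ⟨?_, hb0, (mul_eq_zero.1 hc).resolve_left hy.ne'⟩
    linear_combination h00 + h11 + h22 - 2 * hb0
  · rintro ⟨ha, hb, hc⟩ a i
    rw [hb, add_zero] at ha
    simp [hb, hc, (mul_eq_zero.1 ha).resolve_left hy.ne']

/-- By rotational covariance the combinations that vanish under anti-selfduality are again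
spherically symmetric tensors. All nine equations at a point are therefore carried by the three
scalars `Ea`, `Eb`, `Ec`. -/
lemma sphericalComponent_asd_tensor (T U V W : ℝ → ℝ → ℝ) {x : Spacetime} (hr : 0 < radius x)
    (a : Fin 3) :
    let F := fieldStrength (fun a μ => sphericalComponent T U V W a μ x)
      (sphericalDeriv T U V W x)
    let t := x 0
    let r := radius x
    let Ea := dT U t r - dR T t r / r + T t r * W t r - dR W t r / r + W t r ^ 2 - U t r * V t r
    let Eb := dT V t r - T t r - T t r * W t r * r ^ 2 + dR W t r * r + 2 * W t r + V t r ^ 2 +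
      U t r * V t r * r ^ 2
    let Ec := dT W t r + T t r * V t r + U t r - dR V t r / r + V t r * W t r +
      U t r * W t r * r ^ 2
    let G : Fin 3 → ℝ := fun i => x i.succ * x a.succ * Ea + (if i = a then 1 else 0) * Eb +
      (∑ k : Fin 3, epsilon i a k * x k.succ) * Ec
    F a 0 1 + F a 2 3 = G 0 ∧ F a 0 2 + F a 3 1 = G 1 ∧ F a 0 3 + F a 1 2 = G 2 := by
  intro F t r Ea Eb Ec G
  -- Derivatives of `radius` enter only through x_μ/r; putting the remaining r into the form r²/r
  -- leaves a polynomial identity in the coordinates and r⁻¹.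
  have hWr : dR W t r * r = dR W t r / r * (x 1 ^ 2 + x 2 ^ 2 + x 3 ^ 2) := by
    rw [← radius_sq]
    change _ = dR W t r / r * r ^ 2
    have : r ≠ 0 := hr.ne'
    field_simp
  have hr2 : r ^ 2 = x 1 ^ 2 + x 2 ^ 2 + x 3 ^ 2 := radius_sq x
  have s1 : (1 : Fin 4) = Fin.succ 0 := rfl
  have s2 : (2 : Fin 4) = Fin.succ 1 := rfl
  have s3 : (3 : Fin 4) = Fin.succ 2 := rfl
  simp only [F, G, Ea, Eb, Ec]
  rw [hWr, hr2]
  fin_cases a <;> refine ⟨?_, ?_, ?_⟩ <;>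
  · simp only [fieldStrength, sphericalDeriv, sphericalComponent, Fin.sum_univ_three, s1, s2, s3,
      Fin.cases_zero, Fin.cases_succ]
    simp [epsilon, gradT, gradR]
    ring

/-! ### Reduction of the anti-selfduality equations -/

lemma wittenConnection_eq_spherical (A₀ A₁ φ₁ φ₂ : ℝ → ℝ → ℝ) :
    wittenConnection A₀ A₁ φ₁ φ₂ = fun μ x => (1 / 2 : ℂ) • ∑ a : Fin 3,
      (sphericalComponent (fun t r => -A₀ t r / r) (fun t r => -A₁ t r / r ^ 2 + φ₁ t r / r ^ 3)
        (fun t r => -φ₁ t r / r) (fun t r => -(φ₂ t r + 1) / r ^ 2) a μ x : ℂ) • pauli a := by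
  funext μ x
  rw [wittenConnection]
  refine congrArg _ (Finset.sum_congr rfl fun a _ => ?_)
  congr 2
  rw [wittenComponent, sphericalComponent]
  -- At r = 0 every profile is a quotient by zero, hence 0, so both sides vanish and no positivity
  -- of r is needed.
  rcases eq_or_ne (radius x) 0 with h | h
  · induction μ using Fin.cases <;> simp [h]
  · induction μ using Fin.cases with
    | zero => simp only [Fin.cases_zero]; ring
    | succ i =>
      simp only [Fin.cases_succ]
      split_ifs <;> field_simp <;> ring

lemma eq_zero_iff_of_eq_mul {a b c : ℝ} (hc : c ≠ 0) (h : a = c * b) : a = 0 ↔ b = 0 := by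
  rw [h, mul_eq_zero, or_iff_right hc]

/-- The three equations are the radial, the transverse symmetric and the antisymmetric part of the
tensor equation. The first equates the abelian curvature of (A₀, A₁) with a potential term; the
others are Cauchy–Riemann equations with derivatives covariant under that abelian field. -/
lemma isASDAt_wittenConnection_iff {A₀ A₁ φ₁ φ₂ : ℝ → ℝ → ℝ} {x : Spacetime}
    (hr : 0 < radius x)
    (h0 : DifferentiableAt ℝ (fun z : ℝ × ℝ => A₀ z.1 z.2) (x 0, radius x))
    (h1 : DifferentiableAt ℝ (fun z : ℝ × ℝ => A₁ z.1 z.2) (x 0, radius x))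
    (hp1 : DifferentiableAt ℝ (fun z : ℝ × ℝ => φ₁ z.1 z.2) (x 0, radius x))
    (hp2 : DifferentiableAt ℝ (fun z : ℝ × ℝ => φ₂ z.1 z.2) (x 0, radius x)) :
    IsASDAt (wittenConnection A₀ A₁ φ₁ φ₂) x ↔
      let t := x 0
      let r := radius x
      dT A₁ t r - dR A₀ t r = (φ₁ t r ^ 2 + φ₂ t r ^ 2 - 1) / r ^ 2 ∧
      dT φ₁ t r - A₁ t r * φ₁ t r + dR φ₂ t r + A₀ t r * φ₂ t r = 0 ∧
      dR φ₁ t r + A₀ t r * φ₁ t r - dT φ₂ t r + A₁ t r * φ₂ t r = 0 := by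
  have hr2 : DifferentiableAt ℝ (fun z : ℝ × ℝ => z.2) (x 0, radius x) := by fun_prop
  rw [wittenConnection_eq_spherical]
  set T : ℝ → ℝ → ℝ := fun t r => -A₀ t r / r with hT
  set U : ℝ → ℝ → ℝ := fun t r => -A₁ t r / r ^ 2 + φ₁ t r / r ^ 3 with hU
  set V : ℝ → ℝ → ℝ := fun t r => -φ₁ t r / r with hV
  set W : ℝ → ℝ → ℝ := fun t r => -(φ₂ t r + 1) / r ^ 2 with hW
  have hrinv : DifferentiableAt ℝ (fun z : ℝ × ℝ => z.2⁻¹) (x 0, radius x) :=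
    hr2.fun_inv (by exact hr.ne')
  have dT' : DifferentiableAt ℝ (fun z : ℝ × ℝ => T z.1 z.2) (x 0, radius x) := by
    simp only [hT, div_eq_mul_inv]
    fun_prop
  have dU' : DifferentiableAt ℝ (fun z : ℝ × ℝ => U z.1 z.2) (x 0, radius x) := by
    simp only [hU, div_eq_mul_inv, ← inv_pow]
    fun_prop
  have dV' : DifferentiableAt ℝ (fun z : ℝ × ℝ => V z.1 z.2) (x 0, radius x) := by
    simp only [hV, div_eq_mul_inv]
    fun_prop
  have dW' : DifferentiableAt ℝ (fun z : ℝ × ℝ => W z.1 z.2) (x 0, radius x) := by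
    simp only [hW, div_eq_mul_inv, ← inv_pow]
    fun_prop
  rw [isASDAt_iff fun a ν μ => hasDerivAt_sphericalComponent hr dT' dU' dV' dW' a ν μ]
  have ht := fun a => sphericalComponent_asd_tensor T U V W hr a
  simp only at ht
  have hy := radius_sq x
  have hy0 : 0 < x (Fin.succ 0) ^ 2 + x (Fin.succ 1) ^ 2 + x (Fin.succ 2) ^ 2 := by
    have : 0 < radius x ^ 2 := by positivity
    rw [hy] at this
    exact this
  have hten := fun Ea Eb Ec => spherical_tensor_eq_zero (y := fun i => x (Fin.succ i)) hy0
    (Ea := Ea) (Eb := Eb) (Ec := Ec)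
  have hy' : x (Fin.succ 0) ^ 2 + x (Fin.succ 1) ^ 2 + x (Fin.succ 2) ^ 2 = radius x ^ 2 := hy.symm
  simp only [hy', Fin.forall_fin_succ (n := 2), Fin.forall_fin_succ (n := 1),
    Fin.forall_fin_one] at hten
  simp only [Fin.forall_fin_succ (n := 2), Fin.forall_fin_succ (n := 1),
    Fin.forall_fin_one]
  have e0 := ht 0
  have e1 := ht (Fin.succ 0)
  have e2 := ht (Fin.succ (Fin.succ 0))
  rw [e0.1, e0.2.1, e0.2.2, e1.1, e1.2.1, e1.2.2, e2.1, e2.2.1, e2.2.2]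
  refine (hten _ _ _).trans ?_
  set t := x 0
  set r := radius x
  have hr0 : r ≠ 0 := hr.ne'
  have dr := hasDerivAt_id' r
  have TR : dR T t r = (-dR A₀ t r * r - -A₀ t r * 1) / r ^ 2 :=
    ((hasDerivAt_dR h0).fun_neg.fun_div dr hr0).deriv
  have UT : dT U t r = -dT A₁ t r / r ^ 2 + dT φ₁ t r / r ^ 3 :=
    (((hasDerivAt_dT h1).fun_neg.div_const _).fun_add ((hasDerivAt_dT hp1).div_const _)).deriv
  have VT : dT V t r = -dT φ₁ t r / r := ((hasDerivAt_dT hp1).fun_neg.div_const r).deriv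
  have VR : dR V t r = (-dR φ₁ t r * r - -φ₁ t r * 1) / r ^ 2 :=
    ((hasDerivAt_dR hp1).fun_neg.fun_div dr hr0).deriv
  have WT : dT W t r = -dT φ₂ t r / r ^ 2 :=
    (((hasDerivAt_dT hp2).add_const 1).fun_neg.div_const _).deriv
  have WR : dR W t r = (-dR φ₂ t r * r ^ 2 - -(φ₂ t r + 1) * (2 * r)) / (r ^ 2) ^ 2 := by
    have := ((hasDerivAt_dR hp2).add_const 1).fun_neg.fun_div (dr.fun_pow 2)
      (pow_ne_zero 2 hr0)
    simpa [hW, dR] using this.deriv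
  rw [TR, UT, VT, VR, WT, WR]
  simp only [hT, hU, hV, hW]
  -- In terms of A₀, A₁, φ₁, φ₂ each scalar equation is a nonzero multiple of the desired one; the
  -- factors are -1, -1/r and 1/r².
  refine and_congr ?_ (and_congr ?_ ?_)
  · refine (eq_zero_iff_of_eq_mul (c := -1) (b := dT A₁ t r - dR A₀ t r -
      (φ₁ t r ^ 2 + φ₂ t r ^ 2 - 1) / r ^ 2) (by norm_num) ?_).trans sub_eq_zero
    field_simp
    ring
  · refine eq_zero_iff_of_eq_mul (c := -1 / r) (div_ne_zero (by norm_num) hr0) ?_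
    field_simp
    ring
  · refine eq_zero_iff_of_eq_mul (c := 1 / r ^ 2) (by positivity) ?_
    field_simp
    ring

/-- A quarter of the Laplacian: the mixed second derivatives cancel by symmetry. -/
lemma dPlus_dMinus {F : ℝ → ℝ → ℂ} {V : Set (ℝ × ℝ)} (hV : IsOpen V)
    (hF : ContDiffOn ℝ 2 (fun z : ℝ × ℝ => F z.1 z.2) V) {t r : ℝ} (hz : (t, r) ∈ V) :
    dPlus (dMinus F) t r = 1 / 4 * (dT (dT F) t r + dR (dR F) t r) := by
  have hT := (contDiffOn_dT (m := 1) hV hF (by norm_num)).differentiableOn one_ne_zero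
  have hR := (contDiffOn_dR (m := 1) hV hF (by norm_num)).differentiableOn one_ne_zero
  have hT' := hT.differentiableAt (hV.mem_nhds hz)
  have hR' := hR.differentiableAt (hV.mem_nhds hz)
  have e1 : HasDerivAt (fun s => dMinus F s r)
      (1 / 2 * (dT (dT F) t r + I * dT (dR F) t r)) t :=
    (((hasDerivAt_dT hT').add ((hasDerivAt_dT hR').const_mul I)).const_mul (1 / 2 : ℂ))
  have e2 : HasDerivAt (fun s => dMinus F t s)
      (1 / 2 * (dR (dT F) t r + I * dR (dR F) t r)) r :=
    (((hasDerivAt_dR hT').add ((hasDerivAt_dR hR').const_mul I)).const_mul (1 / 2 : ℂ))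
  rw [dPlus, e1.deriv, e2.deriv, dT_dR_comm hV hF hz]
  linear_combination (-1 / 4 * dR (dR F) t r) * I_sq

lemma dT_ofReal {F : ℝ → ℝ → ℝ} {t r : ℝ}
    (hF : DifferentiableAt ℝ (fun z : ℝ × ℝ => F z.1 z.2) (t, r)) :
    dT (fun t r => (F t r : ℂ)) t r = dT F t r := (hasDerivAt_dT hF).ofReal_comp.deriv

lemma dR_ofReal {F : ℝ → ℝ → ℝ} {t r : ℝ}
    (hF : DifferentiableAt ℝ (fun z : ℝ × ℝ => F z.1 z.2) (t, r)) :
    dR (fun t r => (F t r : ℂ)) t r = dR F t r := (hasDerivAt_dR hF).ofReal_comp.deriv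

lemma contDiffOn_ofReal {α : Type*} [NormedAddCommGroup α] [NormedSpace ℝ α] {n : WithTop ℕ∞}
    {f : α → ℝ} {s : Set α} (hf : ContDiffOn ℝ n f s) : ContDiffOn ℝ n (fun z => (f z : ℂ)) s :=
  ofRealCLM.contDiff.comp_contDiffOn hf

lemma dPlus_dMinus_ofReal_add_const {F : ℝ → ℝ → ℝ} {V : Set (ℝ × ℝ)} (hV : IsOpen V)
    (hF : ContDiffOn ℝ 2 (fun z : ℝ × ℝ => F z.1 z.2) V) (c : ℂ) {t r : ℝ} (hz : (t, r) ∈ V) :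
    dPlus (dMinus fun t r => (F t r : ℂ) + c) t r =
      ((1 / 4 * (dT (dT F) t r + dR (dR F) t r) : ℝ) : ℂ) := by
  have hd : ∀ z ∈ V, DifferentiableAt ℝ (fun z : ℝ × ℝ => F z.1 z.2) (z.1, z.2) := fun z hz =>
    (hF.differentiableOn two_ne_zero).differentiableAt (hV.mem_nhds hz)
  have hT := ((contDiffOn_dT (m := 1) hV hF (by norm_num)).differentiableOn
    one_ne_zero).differentiableAt (hV.mem_nhds hz)
  have hR := ((contDiffOn_dR (m := 1) hV hF (by norm_num)).differentiableOn
    one_ne_zero).differentiableAt (hV.mem_nhds hz)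
  rw [dPlus_dMinus hV ((contDiffOn_ofReal hF).add contDiffOn_const) hz,
    dT_congr hV (G := fun t r => ((dT F t r : ℝ) : ℂ)) (fun z hz => ?_) hz,
    dR_congr hV (G := fun t r => ((dR F t r : ℝ) : ℂ)) (fun z hz => ?_) hz, dT_ofReal hT, dR_ofReal hR]
  · push_cast; ring
  · exact ((hasDerivAt_dR (hd z hz)).ofReal_comp.add_const c).deriv
  · exact ((hasDerivAt_dT (hd z hz)).ofReal_comp.add_const c).deriv

/-- This is harmonicity of log |f|² for a nowhere vanishing holomorphic f. X and Y are themselves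
harmonic by the Cauchy–Riemann equations and the symmetry of mixed derivatives; the first-order
terms cancel by the Cauchy–Riemann equations. -/
lemma laplacian_log_sq_add_sq {X Y : ℝ → ℝ → ℝ} {V : Set (ℝ × ℝ)} (hV : IsOpen V)
    (hX : ContDiffOn ℝ 2 (fun z : ℝ × ℝ => X z.1 z.2) V)
    (hY : ContDiffOn ℝ 2 (fun z : ℝ × ℝ => Y z.1 z.2) V)
    (hne : ∀ z ∈ V, X z.1 z.2 ^ 2 + Y z.1 z.2 ^ 2 ≠ 0) (hCR : CauchyRiemannOn X Y V)
    {t r : ℝ} (hz : (t, r) ∈ V) :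
    dT (dT fun t r => Real.log (X t r ^ 2 + Y t r ^ 2)) t r +
      dR (dR fun t r => Real.log (X t r ^ 2 + Y t r ^ 2)) t r = 0 := by
  have hd : ∀ {F : ℝ → ℝ → ℝ}, ContDiffOn ℝ 2 (fun z : ℝ × ℝ => F z.1 z.2) V → ∀ z ∈ V,
      DifferentiableAt ℝ (fun z : ℝ × ℝ => F z.1 z.2) (z.1, z.2) := fun hF z hz =>
    (hF.differentiableOn two_ne_zero).differentiableAt (hV.mem_nhds hz)
  have hdT : ∀ {F : ℝ → ℝ → ℝ}, ContDiffOn ℝ 2 (fun z : ℝ × ℝ => F z.1 z.2) V →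
      DifferentiableAt ℝ (fun z : ℝ × ℝ => dT F z.1 z.2) (t, r) := fun hF =>
    ((contDiffOn_dT (m := 1) hV hF (by norm_num)).differentiableOn
      one_ne_zero).differentiableAt (hV.mem_nhds hz)
  have hdR : ∀ {F : ℝ → ℝ → ℝ}, ContDiffOn ℝ 2 (fun z : ℝ × ℝ => F z.1 z.2) V →
      DifferentiableAt ℝ (fun z : ℝ × ℝ => dR F z.1 z.2) (t, r) := fun hF =>
    ((contDiffOn_dR (m := 1) hV hF (by norm_num)).differentiableOn
      one_ne_zero).differentiableAt (hV.mem_nhds hz)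
  have c1 : ∀ z ∈ V, dR X z.1 z.2 = dT Y z.1 z.2 := fun z hz => (hCR z hz).1
  have c2 : ∀ z ∈ V, dR Y z.1 z.2 = -dT X z.1 z.2 := fun z hz => by
    have := (hCR z hz).2
    change dT X z.1 z.2 = -dR Y z.1 z.2 at this
    linarith
  have lapX : dR (dR X) t r = -dT (dT X) t r := by
    rw [dR_congr hV c1 hz, ← dT_dR_comm hV hY hz, dT_congr hV (G := fun t r => -dT X t r) c2 hz]
    exact (hasDerivAt_dT (hdT hX)).fun_neg.deriv
  have lapY : dR (dR Y) t r = -dT (dT Y) t r := by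
    rw [dR_congr hV (G := fun t r => -dT X t r) c2 hz]
    refine (hasDerivAt_dR (hdT hX)).fun_neg.deriv.trans ?_
    rw [← dT_dR_comm hV hX hz, dT_congr hV c1 hz]
  rw [dT_congr hV (G := fun t r => (2 * X t r * dT X t r + 2 * Y t r * dT Y t r) /
      (X t r ^ 2 + Y t r ^ 2)) (fun z hz => ?_) hz,
    dR_congr hV (G := fun t r => (2 * X t r * dR X t r + 2 * Y t r * dR Y t r) /
      (X t r ^ 2 + Y t r ^ 2)) (fun z hz => ?_) hz]
  · have xT := hasDerivAt_dT (hd hX _ hz)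
    have yT := hasDerivAt_dT (hd hY _ hz)
    have xR := hasDerivAt_dR (hd hX _ hz)
    have yR := hasDerivAt_dR (hd hY _ hz)
    have h1 : dT (fun t r => (2 * X t r * dT X t r + 2 * Y t r * dT Y t r) /
        (X t r ^ 2 + Y t r ^ 2)) t r = _ :=
      ((((xT.const_mul 2).fun_mul (hasDerivAt_dT (hdT hX))).fun_add
        ((yT.const_mul 2).fun_mul (hasDerivAt_dT (hdT hY)))).fun_div
        ((xT.fun_pow 2).fun_add (yT.fun_pow 2)) (hne _ hz)).deriv
    have h2 : dR (fun t r => (2 * X t r * dR X t r + 2 * Y t r * dR Y t r) /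
        (X t r ^ 2 + Y t r ^ 2)) t r = _ :=
      ((((xR.const_mul 2).fun_mul (hasDerivAt_dR (hdR hX))).fun_add
        ((yR.const_mul 2).fun_mul (hasDerivAt_dR (hdR hY)))).fun_div
        ((xR.fun_pow 2).fun_add (yR.fun_pow 2)) (hne _ hz)).deriv
    rw [h1, h2, lapX, lapY, c1 _ hz, c2 _ hz]
    have := hne _ hz
    simp only at this ⊢
    field_simp
    ring
  · have := ((((hasDerivAt_dR (hd hX _ hz)).fun_pow 2).fun_add
      ((hasDerivAt_dR (hd hY _ hz)).fun_pow 2)).log (hne _ hz)).deriv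
    simpa [dR] using this
  · have := ((((hasDerivAt_dT (hd hX _ hz)).fun_pow 2).fun_add
      ((hasDerivAt_dT (hd hY _ hz)).fun_pow 2)).log (hne _ hz)).deriv
    simpa [dT] using this

lemma log_ofReal_of_neg' {y : ℝ} (hy : 0 < y) :
    log ((-y : ℝ) : ℂ) = (Real.log y : ℂ) + Real.pi * I := by
  have := log_ofReal_mul hy (x := -1) (by norm_num)
  rw [log_neg_one] at this
  rw [← this]
  congr 1
  push_cast
  ring

/-- Writing the field as a real logarithm plus a constant avoids the cut of the principal logarithm,
on which its argument always lies. -/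
lemma wittenLiouville_eq {φ₁ φ₂ : ℝ → ℝ → ℝ} {t r : ℝ} (hr : 0 < r)
    (h : φ₁ t r ^ 2 + φ₂ t r ^ 2 ≠ 0) :
    wittenLiouville φ₁ φ₂ t r =
      ((-Real.log ((φ₁ t r ^ 2 + φ₂ t r ^ 2) / (4 * r ^ 2)) : ℝ) : ℂ) + -(Real.pi * I) := by
  have hpos : 0 < φ₁ t r ^ 2 + φ₂ t r ^ 2 := lt_of_le_of_ne (by positivity) h.symm
  rw [wittenLiouville, neg_div, log_ofReal_of_neg' (by positivity)]
  push_cast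
  ring

lemma exp_neg_wittenLiouville {φ₁ φ₂ : ℝ → ℝ → ℝ} {t r : ℝ} (hr : 0 < r)
    (h : φ₁ t r ^ 2 + φ₂ t r ^ 2 ≠ 0) :
    exp (-wittenLiouville φ₁ φ₂ t r) =
      ((-(φ₁ t r ^ 2 + φ₂ t r ^ 2) / (4 * r ^ 2) : ℝ) : ℂ) := by
  rw [wittenLiouville, neg_neg, exp_log]
  rw [Ne, ofReal_eq_zero]
  exact div_ne_zero (neg_ne_zero.2 h) (by positivity)

lemma dMinus_congr {F G : ℝ → ℝ → ℂ} {V : Set (ℝ × ℝ)} (hV : IsOpen V)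
    (h : ∀ z ∈ V, F z.1 z.2 = G z.1 z.2) {z : ℝ × ℝ} (hz : z ∈ V) :
    dMinus F z.1 z.2 = dMinus G z.1 z.2 := by
  have a := dT_congr hV h (t := z.1) (r := z.2) hz
  have b := dR_congr hV h (t := z.1) (r := z.2) hz
  simp only [dT, dR] at a b
  rw [dMinus, dMinus, a, b]

lemma dPlus_congr {F G : ℝ → ℝ → ℂ} {V : Set (ℝ × ℝ)} (hV : IsOpen V)
    (h : ∀ z ∈ V, F z.1 z.2 = G z.1 z.2) {z : ℝ × ℝ} (hz : z ∈ V) :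
    dPlus F z.1 z.2 = dPlus G z.1 z.2 := by
  have a := dT_congr hV h (t := z.1) (r := z.2) hz
  have b := dR_congr hV h (t := z.1) (r := z.2) hz
  simp only [dT, dR] at a b
  rw [dPlus, dPlus, a, b]

/-! ### From the scalar equations to the Cauchy–Riemann and Liouville equations -/

section Reduction

variable {V : Set (ℝ × ℝ)} {ψ φ₁ φ₂ : ℝ → ℝ → ℝ}

/-- The factor e^{-ψ} is an integrating factor: it turns ∂φ - (∂ψ)φ into an ordinary derivative.
With A₀ = -∂_r ψ and A₁ = ∂_t ψ these combinations are the covariant derivatives in the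
anti-selfduality equations. -/
lemma cauchyRiemannOn_exp_iff (hV : IsOpen V)
    (hψ : ContDiffOn ℝ 2 (fun z : ℝ × ℝ => ψ z.1 z.2) V)
    (h1 : ContDiffOn ℝ 2 (fun z : ℝ × ℝ => φ₁ z.1 z.2) V)
    (h2 : ContDiffOn ℝ 2 (fun z : ℝ × ℝ => φ₂ z.1 z.2) V) :
    CauchyRiemannOn (fun t r => Real.exp (-ψ t r) * φ₁ t r)
        (fun t r => Real.exp (-ψ t r) * φ₂ t r) V ↔
      ∀ z ∈ V,
        (dT φ₁ z.1 z.2 - dT ψ z.1 z.2 * φ₁ z.1 z.2 + dR φ₂ z.1 z.2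
          - dR ψ z.1 z.2 * φ₂ z.1 z.2 = 0) ∧
        dR φ₁ z.1 z.2 - dR ψ z.1 z.2 * φ₁ z.1 z.2 - dT φ₂ z.1 z.2
          + dT ψ z.1 z.2 * φ₂ z.1 z.2 = 0 := by
  refine forall₂_congr fun z hz => ?_
  have hd : ∀ {F : ℝ → ℝ → ℝ}, ContDiffOn ℝ 2 (fun z : ℝ × ℝ => F z.1 z.2) V →
      DifferentiableAt ℝ (fun z : ℝ × ℝ => F z.1 z.2) (z.1, z.2) := fun hF =>
    (hF.differentiableOn two_ne_zero).differentiableAt (hV.mem_nhds hz)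
  have eR := fun {F : ℝ → ℝ → ℝ} (hF : ContDiffOn ℝ 2 (fun z : ℝ × ℝ => F z.1 z.2) V) =>
    ((hasDerivAt_dR (hd hψ)).fun_neg.exp.fun_mul (hasDerivAt_dR (hd hF))).deriv
  have eT := fun {F : ℝ → ℝ → ℝ} (hF : ContDiffOn ℝ 2 (fun z : ℝ × ℝ => F z.1 z.2) V) =>
    ((hasDerivAt_dT (hd hψ)).fun_neg.exp.fun_mul (hasDerivAt_dT (hd hF))).deriv
  have he := (Real.exp_pos (-ψ z.1 z.2)).ne'
  rw [eR h1, eR h2, eT h1, eT h2, and_comm]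
  refine and_congr (sub_eq_zero.symm.trans (eq_zero_iff_of_eq_mul he ?_))
    (sub_eq_zero.symm.trans (eq_zero_iff_of_eq_mul he ?_)) <;> ring

lemma isASD_witten_iff (hV : IsOpen V) (hpos : ∀ z ∈ V, 0 < z.2)
    (hψ : ContDiffOn ℝ 2 (fun z : ℝ × ℝ => ψ z.1 z.2) V)
    (h1 : ContDiffOn ℝ 2 (fun z : ℝ × ℝ => φ₁ z.1 z.2) V)
    (h2 : ContDiffOn ℝ 2 (fun z : ℝ × ℝ => φ₂ z.1 z.2) V) :
    (∀ x : Spacetime, (x 0, radius x) ∈ V →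
      IsASDAt (wittenConnection (potA0 ψ) (potA1 ψ) φ₁ φ₂) x) ↔
    CauchyRiemannOn (fun t r => Real.exp (-ψ t r) * φ₁ t r)
        (fun t r => Real.exp (-ψ t r) * φ₂ t r) V ∧
      ∀ z ∈ V, dT (dT ψ) z.1 z.2 + dR (dR ψ) z.1 z.2 =
        (φ₁ z.1 z.2 ^ 2 + φ₂ z.1 z.2 ^ 2 - 1) / z.2 ^ 2 := by
  have hT := (contDiffOn_dT (m := 1) hV hψ (by norm_num)).differentiableOn one_ne_zero
  have hR := (contDiffOn_dR (m := 1) hV hψ (by norm_num)).differentiableOn one_ne_zero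
  have key : ∀ x : Spacetime, (x 0, radius x) ∈ V →
      (IsASDAt (wittenConnection (potA0 ψ) (potA1 ψ) φ₁ φ₂) x ↔
        let t := x 0
        let r := radius x
        dT (dT ψ) t r + dR (dR ψ) t r = (φ₁ t r ^ 2 + φ₂ t r ^ 2 - 1) / r ^ 2 ∧
        dT φ₁ t r - dT ψ t r * φ₁ t r + dR φ₂ t r - dR ψ t r * φ₂ t r = 0 ∧
        dR φ₁ t r - dR ψ t r * φ₁ t r - dT φ₂ t r + dT ψ t r * φ₂ t r = 0) := fun x hx => by
    have hT' := hT.differentiableAt (hV.mem_nhds hx)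
    have hR' := hR.differentiableAt (hV.mem_nhds hx)
    rw [isASDAt_wittenConnection_iff (A₀ := potA0 ψ) (A₁ := potA1 ψ) (hpos _ hx) hR'.neg hT'
      ((h1.differentiableOn two_ne_zero).differentiableAt (hV.mem_nhds hx))
      ((h2.differentiableOn two_ne_zero).differentiableAt (hV.mem_nhds hx))]
    have e : dR (potA0 ψ) (x 0) (radius x) = -dR (dR ψ) (x 0) (radius x) :=
      (hasDerivAt_dR hR').fun_neg.deriv
    have e0 : potA0 ψ (x 0) (radius x) = -dR ψ (x 0) (radius x) := rfl
    have e1 : potA1 ψ (x 0) (radius x) = dT ψ (x 0) (radius x) := rfl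
    have e2 : dT (potA1 ψ) (x 0) (radius x) = dT (dT ψ) (x 0) (radius x) := rfl
    simp only [e, e0, e1, e2, sub_neg_eq_add, neg_mul, ← sub_eq_add_neg]
  rw [cauchyRiemannOn_exp_iff hV hψ h1 h2, ← forall₂_and]
  constructor
  · intro h z hz
    -- Every (t, r) with r > 0 is attained, for instance on the half plane x₁ > 0, x₂ = x₃ = 0.
    have hx0 : (![z.1, z.2, 0, 0] : Spacetime) 0 = z.1 := rfl
    have hx1 : radius ![z.1, z.2, 0, 0] = z.2 := by
      simp [radius, Real.sqrt_sq (hpos z hz).le]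
    have := (key ![z.1, z.2, 0, 0] (by rw [hx0, hx1]; exact hz)).1 (h _ (by rw [hx0, hx1]; exact hz))
    rw [hx0, hx1] at this
    exact ⟨this.2, this.1⟩
  · intro h x hx
    exact (key x hx).2 ⟨(h _ hx).2, (h _ hx).1⟩

/-- With X + iY = e^{-ψ}(φ₁ + iφ₂), log(φ₁² + φ₂²) is log(X² + Y²) + 2ψ, whose first summand is
harmonic. In the (t, r) plane the Laplacian of log r is -1/r². Hence the Laplacian of φ is -2Δψ -
2/r², and Liouville's equation becomes the equation for Δψ. -/
lemma liouvilleOn_iff (hV : IsOpen V) (hpos : ∀ z ∈ V, 0 < z.2)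
    (hψ : ContDiffOn ℝ 2 (fun z : ℝ × ℝ => ψ z.1 z.2) V)
    (h1 : ContDiffOn ℝ 2 (fun z : ℝ × ℝ => φ₁ z.1 z.2) V)
    (h2 : ContDiffOn ℝ 2 (fun z : ℝ × ℝ => φ₂ z.1 z.2) V)
    (hne : ∀ z ∈ V, φ₁ z.1 z.2 ^ 2 + φ₂ z.1 z.2 ^ 2 ≠ 0)
    (hCR : CauchyRiemannOn (fun t r => Real.exp (-ψ t r) * φ₁ t r)
        (fun t r => Real.exp (-ψ t r) * φ₂ t r) V) :
    LiouvilleOn (wittenLiouville φ₁ φ₂) V ↔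
      ∀ z ∈ V, dT (dT ψ) z.1 z.2 + dR (dR ψ) z.1 z.2 =
        (φ₁ z.1 z.2 ^ 2 + φ₂ z.1 z.2 ^ 2 - 1) / z.2 ^ 2 := by
  set X : ℝ → ℝ → ℝ := fun t r => Real.exp (-ψ t r) * φ₁ t r with hX
  set Y : ℝ → ℝ → ℝ := fun t r => Real.exp (-ψ t r) * φ₂ t r with hY
  have hXc : ContDiffOn ℝ 2 (fun z : ℝ × ℝ => X z.1 z.2) V := hψ.neg.exp.mul h1
  have hYc : ContDiffOn ℝ 2 (fun z : ℝ × ℝ => Y z.1 z.2) V := hψ.neg.exp.mul h2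
  have hXY : ∀ t r, X t r ^ 2 + Y t r ^ 2 =
      Real.exp (-ψ t r) ^ 2 * (φ₁ t r ^ 2 + φ₂ t r ^ 2) := fun t r => by
    simp only [hX, hY]; ring
  have hXYne : ∀ z ∈ V, X z.1 z.2 ^ 2 + Y z.1 z.2 ^ 2 ≠ 0 := fun z hz => by
    rw [hXY]; exact mul_ne_zero (pow_ne_zero 2 (Real.exp_pos _).ne') (hne z hz)
  set L : ℝ → ℝ → ℝ := fun t r => Real.log (X t r ^ 2 + Y t r ^ 2) with hL
  have hLc : ContDiffOn ℝ 2 (fun z : ℝ × ℝ => L z.1 z.2) V :=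
    ((hXc.pow 2).add (hYc.pow 2)).log hXYne
  set G : ℝ → ℝ → ℝ := fun t r => -(L t r + 2 * ψ t r - 2 * Real.log r - Real.log 4) with hG
  have hlogr : ContDiffOn ℝ 2 (fun z : ℝ × ℝ => Real.log z.2) V :=
    contDiffOn_snd.log fun z hz => (hpos z hz).ne'
  have hGc : ContDiffOn ℝ 2 (fun z : ℝ × ℝ => G z.1 z.2) V :=
    (((hLc.add (contDiffOn_const.mul hψ)).sub (contDiffOn_const.mul hlogr)).sub
      contDiffOn_const).neg
  have hWG : ∀ z ∈ V, wittenLiouville φ₁ φ₂ z.1 z.2 = (G z.1 z.2 : ℂ) + -(Real.pi * I) :=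
    fun z hz => by
      have hr := hpos z hz
      rw [wittenLiouville_eq hr (hne z hz)]
      congr 3
      rw [hL]
      simp only
      rw [hXY, Real.log_mul (pow_ne_zero 2 (Real.exp_pos _).ne') (hne z hz), Real.log_pow,
        Real.log_exp, Real.log_div (hne z hz) (by positivity), Real.log_mul (by norm_num)
        (by positivity), Real.log_pow]
      push_cast
      ring
  have hd : ∀ {F : ℝ → ℝ → ℝ}, ContDiffOn ℝ 2 (fun z : ℝ × ℝ => F z.1 z.2) V → ∀ z ∈ V,
      DifferentiableAt ℝ (fun z : ℝ × ℝ => F z.1 z.2) (z.1, z.2) := fun hF z hz =>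
    (hF.differentiableOn two_ne_zero).differentiableAt (hV.mem_nhds hz)
  have hdT : ∀ {F : ℝ → ℝ → ℝ}, ContDiffOn ℝ 2 (fun z : ℝ × ℝ => F z.1 z.2) V → ∀ z ∈ V,
      DifferentiableAt ℝ (fun z : ℝ × ℝ => dT F z.1 z.2) (z.1, z.2) := fun hF z hz =>
    ((contDiffOn_dT (m := 1) hV hF (by norm_num)).differentiableOn
      one_ne_zero).differentiableAt (hV.mem_nhds hz)
  have hdR : ∀ {F : ℝ → ℝ → ℝ}, ContDiffOn ℝ 2 (fun z : ℝ × ℝ => F z.1 z.2) V → ∀ z ∈ V,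
      DifferentiableAt ℝ (fun z : ℝ × ℝ => dR F z.1 z.2) (z.1, z.2) := fun hF z hz =>
    ((contDiffOn_dR (m := 1) hV hF (by norm_num)).differentiableOn
      one_ne_zero).differentiableAt (hV.mem_nhds hz)
  have lapG : ∀ z ∈ V, dT (dT G) z.1 z.2 + dR (dR G) z.1 z.2 =
      -(2 * (dT (dT ψ) z.1 z.2 + dR (dR ψ) z.1 z.2) + 2 / z.2 ^ 2) := fun z hz => by
    have eT : ∀ z ∈ V, dT G z.1 z.2 = -(dT L z.1 z.2 + 2 * dT ψ z.1 z.2) := fun z hz =>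
      ((((hasDerivAt_dT (hd hLc z hz)).fun_add
        ((hasDerivAt_dT (hd hψ z hz)).const_mul 2)).sub_const _).sub_const _).fun_neg.deriv
    have eR : ∀ z ∈ V, dR G z.1 z.2 = -(dR L z.1 z.2 + 2 * dR ψ z.1 z.2 - 2 * z.2⁻¹) :=
      fun z hz =>
        ((((hasDerivAt_dR (hd hLc z hz)).fun_add
          ((hasDerivAt_dR (hd hψ z hz)).const_mul 2)).fun_sub
          ((Real.hasDerivAt_log (hpos z hz).ne').const_mul 2)).sub_const _).fun_neg.deriv
    have eTT : dT (dT G) z.1 z.2 = -(dT (dT L) z.1 z.2 + 2 * dT (dT ψ) z.1 z.2) := by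
      rw [dT_congr hV (G := fun t r => -(dT L t r + 2 * dT ψ t r)) eT hz]
      exact ((hasDerivAt_dT (hdT hLc z hz)).fun_add
        ((hasDerivAt_dT (hdT hψ z hz)).const_mul 2)).fun_neg.deriv
    have eRR : dR (dR G) z.1 z.2 = -(dR (dR L) z.1 z.2 + 2 * dR (dR ψ) z.1 z.2 -
        2 * -(z.2 ^ 2)⁻¹) := by
      rw [dR_congr hV (G := fun t r => -(dR L t r + 2 * dR ψ t r - 2 * r⁻¹)) eR hz]
      exact (((hasDerivAt_dR (hdR hLc z hz)).fun_add
        ((hasDerivAt_dR (hdR hψ z hz)).const_mul 2)).fun_sub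
        ((hasDerivAt_inv (hpos z hz).ne').const_mul 2)).fun_neg.deriv
    have := laplacian_log_sq_add_sq hV hXc hYc hXYne hCR (t := z.1) (r := z.2) hz
    rw [eTT, eRR, div_eq_mul_inv]
    linear_combination -this
  refine forall₂_congr fun z hz => ?_
  have e1 : dPlus (dMinus (wittenLiouville φ₁ φ₂)) z.1 z.2 =
      dPlus (dMinus fun t r => (G t r : ℂ) + -(Real.pi * I)) z.1 z.2 :=
    dPlus_congr hV (fun w hw => dMinus_congr hV hWG hw) hz
  rw [e1, dPlus_dMinus_ofReal_add_const hV hGc _ hz, exp_neg_wittenLiouville (hpos z hz) (hne z hz),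
    lapG z hz]
  have hr := (hpos z hz).ne'
  have e2 : (2 : ℂ) * ((-(φ₁ z.1 z.2 ^ 2 + φ₂ z.1 z.2 ^ 2) / (4 * z.2 ^ 2) : ℝ) : ℂ) =
      ((2 * (-(φ₁ z.1 z.2 ^ 2 + φ₂ z.1 z.2 ^ 2) / (4 * z.2 ^ 2)) : ℝ) : ℂ) := by push_cast; ring
  rw [e2, ofReal_inj, ← sub_eq_zero, ← sub_eq_zero (a := dT (dT ψ) _ _ + _)]
  refine eq_zero_iff_of_eq_mul (c := -1 / 2) (by norm_num) ?_
  field_simp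
  ring

lemma witten_reduction (hV : IsOpen V) (hpos : ∀ z ∈ V, 0 < z.2)
    (hψ : ContDiffOn ℝ 2 (fun z : ℝ × ℝ => ψ z.1 z.2) V)
    (h1 : ContDiffOn ℝ 2 (fun z : ℝ × ℝ => φ₁ z.1 z.2) V)
    (h2 : ContDiffOn ℝ 2 (fun z : ℝ × ℝ => φ₂ z.1 z.2) V)
    (hne : ∀ z ∈ V, φ₁ z.1 z.2 ^ 2 + φ₂ z.1 z.2 ^ 2 ≠ 0) :
    (∀ x : Spacetime, (x 0, radius x) ∈ V →
      IsASDAt (wittenConnection (potA0 ψ) (potA1 ψ) φ₁ φ₂) x) ↔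
    CauchyRiemannOn (fun t r => Real.exp (-ψ t r) * φ₁ t r)
        (fun t r => Real.exp (-ψ t r) * φ₂ t r) V ∧
      LiouvilleOn (wittenLiouville φ₁ φ₂) V := by
  rw [isASD_witten_iff hV hpos hψ h1 h2]
  exact and_congr_right fun hCR => (liouvilleOn_iff hV hpos hψ h1 h2 hne hCR).symm

end Reduction

/-! ### The half disc -/

lemma isOpen_halfDisc (q : ℝ) : IsOpen (halfDisc q) :=
  (isOpen_lt continuous_const continuous_snd).inter
    (isOpen_lt (by fun_prop : Continuous fun z : ℝ × ℝ => z.1 ^ 2 + z.2 ^ 2) continuous_const)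

lemma conj_rhoP (t r : ℝ) : (starRingEnd ℂ) (rhoP t r) = rhoM t r := by
  simp [rhoP, rhoM, sub_eq_add_neg]

lemma conj_rhoM (t r : ℝ) : (starRingEnd ℂ) (rhoM t r) = rhoP t r := by
  simp [rhoP, rhoM]

lemma rhoP_im (t r : ℝ) : (rhoP t r).im = r := by simp [rhoP]

lemma norm_rhoP_lt {q t r : ℝ} (hq1 : q < 1) (h : (t, r) ∈ halfDisc q) :
    ‖rhoP t r‖ < 2 / (1 - q) := by
  refine lt_of_pow_lt_pow_left₀ 2 (div_nonneg zero_le_two (by linarith)) ?_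
  rw [← normSq_eq_norm_sq, normSq_apply]
  simpa [rhoP, ← sq] using h.2

lemma norm_rhoM_lt {q t r : ℝ} (hq1 : q < 1) (h : (t, r) ∈ halfDisc q) :
    ‖rhoM t r‖ < 2 / (1 - q) := by
  rw [← conj_rhoP, RCLike.norm_conj]
  exact norm_rhoP_lt hq1 h

lemma rhoP_sub_rhoM (t r : ℝ) : rhoP t r - rhoM t r = 2 * I * r := by
  rw [rhoP, rhoM]; ring

lemma rhoP_ne_rhoM {t r : ℝ} (hr : 0 < r) : rhoP t r - rhoM t r ≠ 0 := by
  rw [rhoP_sub_rhoM]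
  exact mul_ne_zero (mul_ne_zero two_ne_zero I_ne_zero) (by exact_mod_cast hr.ne')

lemma rhoP_ne_zero {t r : ℝ} (hr : 0 < r) : rhoP t r ≠ 0 := fun h => by
  have := rhoP_im t r
  rw [h, zero_im] at this
  exact hr.ne this

lemma rhoM_ne_zero {t r : ℝ} (hr : 0 < r) : rhoM t r ≠ 0 := by
  rw [← conj_rhoP]
  exact (map_ne_zero _).2 (rhoP_ne_zero hr)

/-! ### Closed forms of `L⁺` and `L⁻` -/

/-- In half the difference of the series at z and at -z the even terms vanish, so the sum may be
taken along the injection n ↦ 2n + 1. -/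
lemma hasSum_odd_part {c : ℕ → ℂ} {z a b : ℂ} (h1 : HasSum (fun n => c n * z ^ n) a)
    (h2 : HasSum (fun n => c n * (-z) ^ n) b) :
    HasSum (fun n => c (2 * n + 1) * z ^ (2 * n + 1)) ((a - b) / 2) := by
  have h := (h1.sub h2).div_const 2
  have hinj : Function.Injective fun n : ℕ => 2 * n + 1 := fun a b h => by simpa using h
  rw [← hinj.hasSum_iff] at h
  · refine h.congr_fun fun n => ?_
    simp only [Function.comp]
    rw [Odd.neg_pow ⟨n, rfl⟩]
    ring
  · intro n hn
    rcases Nat.even_or_odd n with he | ⟨k, hk⟩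
    · rw [he.neg_pow]; ring
    · exact absurd ⟨k, hk.symm⟩ hn

/-- `h = p m`, so that `L⁺/L⁻ = h(ρ₊)/h(ρ₋)`. -/
def hFun (q : ℝ) (ρ : ℂ) : ℂ := pFun q ρ * mFun q ρ

/-- Multiplication by (1 - ρ'/ρ) i(1-q)ρ/2 completes the n-th term to the term of degree 2n + 1 in
the `q`-binomial series with a = ρ'/ρ and z = i(1-q)ρ/2. Since az depends on ρ' only, the values at
±z are p(ρ')/p(ρ) and m(ρ')/m(ρ). -/
lemma hasSum_lambdaTerm {q : ℝ} (hq0 : 0 < q) (hq1 : q < 1) {ρ ρ' : ℂ} (h : ‖ρ‖ < 2 / (1 - q))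
    (h0 : ρ ≠ 0) (hne : ρ ≠ ρ') :
    HasSum (lambdaTerm q ρ ρ') ((pFun q ρ' * mFun q ρ - mFun q ρ' * pFun q ρ) /
      ((1 - q) * I * (ρ - ρ') * hFun q ρ)) := by
  have hp := pFun_ne_zero hq0 hq1 h
  have hm := mFun_ne_zero hq0 hq1 h
  have hc : (1 - q : ℂ) ≠ 0 := by simpa using one_sub_ofReal_pow_ne_zero hq0 hq1 0
  have hd : ρ - ρ' ≠ 0 := sub_ne_zero.2 hne
  have h1 := hasSum_qBinomial hq0 hq1 (ρ' / ρ) (norm_I_half_mul_lt_one hq1 h)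
  have h2 := hasSum_qBinomial hq0 hq1 (ρ' / ρ) (norm_neg_I_half_mul_lt_one hq1 h)
  have hs := hasSum_odd_part h1 (by simpa only [neg_mul] using h2)
  have e1 : ρ' / ρ * (I * ((1 - q) / 2) * ρ) = I * ((1 - q) / 2) * ρ' := by field_simp
  have e2 : ρ' / ρ * -(I * ((1 - q) / 2) * ρ) = -I * ((1 - q) / 2) * ρ' := by field_simp
  have e3 : -(I * ((1 - q) / 2) * ρ) = -I * ((1 - q) / 2) * ρ := by ring
  rw [e1, e2, e3] at hs
  have hs2 := hs.div_const ((1 - ρ' / ρ) * (I * ((1 - q) / 2) * ρ))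
  have hk : (1 - ρ' / ρ) * (I * ((1 - q) / 2) * ρ) = (1 - q) * I * (ρ - ρ') / 2 := by
    field_simp
  have hk0 : (1 - ρ' / ρ) * (I * ((1 - q) / 2) * ρ) ≠ 0 := by
    rw [hk]
    exact div_ne_zero (mul_ne_zero (mul_ne_zero hc I_ne_zero) hd) two_ne_zero
  have hval : ((qPochInf (I * ((1 - q) / 2) * ρ') q / qPochInf (I * ((1 - q) / 2) * ρ) q -
      qPochInf (-I * ((1 - q) / 2) * ρ') q / qPochInf (-I * ((1 - q) / 2) * ρ) q) / 2) /
        ((1 - ρ' / ρ) * (I * ((1 - q) / 2) * ρ)) =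
      (pFun q ρ' * mFun q ρ - mFun q ρ' * pFun q ρ) / ((1 - q) * I * (ρ - ρ') * hFun q ρ) := by
    change (pFun q ρ' / pFun q ρ - mFun q ρ' / mFun q ρ) / 2 / _ = _
    rw [hk, hFun]
    have := I_ne_zero
    field_simp
  rw [← hval]
  refine hs2.congr_fun fun n => ?_
  rw [lambdaTerm, qPoch_succ' (ρ' / ρ), pow_succ (I * ((1 - q) / 2) * ρ),
    show I * ((1 - q) * ρ / 2) = I * ((1 - q) / 2) * ρ by ring, eq_div_iff hk0]
  ring

/-- Inverting the base inverts the argument of each factor, 1 - a/s = -(a/s)(1 - s/a), which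
exchanges the two parameters. The ratios of consecutive terms then agree, and the factor -q comes
from n = 0. -/
lemma lambdaTerm_inv {q : ℝ} (hq0 : 0 < q) (hq1 : q < 1) {ρ ρ' : ℂ} (h : ρ ≠ 0) (h' : ρ' ≠ 0)
    (n : ℕ) : lambdaTerm q⁻¹ ρ ρ' n = -q * lambdaTerm q ρ' ρ n := by
  have hqc : (q : ℂ) ≠ 0 := by exact_mod_cast hq0.ne'
  induction n with
  | zero =>
    have h1 := one_sub_ofReal_pow_ne_zero hq0 hq1 0
    simp only [zero_add, pow_one] at h1
    have h3 : 1 - (q : ℂ)⁻¹ = -(1 - q) / q := by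
      field_simp
      ring
    simp [lambdaTerm, qPoch, h3]
    field_simp
    rw [div_eq_iff (by rw [← neg_ne_zero, neg_sub]; exact h1)]
    ring
  | succ n ih =>
    have step : ∀ (p : ℝ) (ρ ρ' : ℂ), lambdaTerm p ρ ρ' (n + 1) = lambdaTerm p ρ ρ' n *
        ((1 - p * (ρ' / ρ) * p ^ (2 * n)) * (1 - p * (ρ' / ρ) * p ^ (2 * n + 1)) /
          ((1 - p * p ^ (2 * n + 1)) * (1 - p * p ^ (2 * n + 2))) *
            (I * ((1 - p) * ρ / 2)) ^ 2) := fun p ρ ρ' => by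
      simp only [lambdaTerm, mul_add, mul_one, qPoch_succ _ _ (2 * n + 1), qPoch_succ _ _ (2 * n),
        qPoch_succ _ _ (2 * n + 1 + 1),
        show 2 * n + 2 = 2 * n + 1 + 1 from rfl]
      rw [pow_succ _ (2 * n + 1), pow_succ _ (2 * n)]
      simp only [div_eq_mul_inv, mul_inv]
      ring
    rw [step, step, ih]
    have h3 := one_sub_ofReal_pow_ne_zero hq0 hq1 (2 * n + 1)
    have h4 := one_sub_ofReal_pow_ne_zero hq0 hq1 (2 * n + 2)
    rw [mul_assoc (-(q : ℂ))]
    congr 2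
    push_cast
    have hy : (q : ℂ) ^ (2 * n) ≠ 0 := pow_ne_zero _ hqc
    simp only [pow_succ _ (2 * n + 2), pow_succ _ (2 * n + 1), pow_succ _ (2 * n), inv_pow] at h3 h4 ⊢
    generalize (q : ℂ) ^ (2 * n) = y at *
    have k3 : 1 - q * (y * q) ≠ 0 := by convert h3 using 1; ring
    have k4 : 1 - q * (y * q * q) ≠ 0 := by convert h4 using 1; ring
    have e3 : 1 - (q : ℂ)⁻¹ * (y⁻¹ * (q : ℂ)⁻¹) = -(1 - q * (y * q)) / (q * (y * q)) := by
      field_simp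
      ring
    have e4 : 1 - (q : ℂ)⁻¹ * (y⁻¹ * (q : ℂ)⁻¹ * (q : ℂ)⁻¹) =
        -(1 - q * (y * q * q)) / (q * (y * q * q)) := by
      field_simp
      ring
    rw [e3, e4]
    generalize 1 - q * (y * q) = u at *
    generalize 1 - q * (y * q * q) = w at *
    field_simp
    ring

section Lambda

variable {q t r : ℝ}

/-- `p₋ m₊ - p₊ m₋`. -/
def wFun (q t r : ℝ) : ℂ :=
  pFun q (rhoM t r) * mFun q (rhoP t r) - pFun q (rhoP t r) * mFun q (rhoM t r)

/-- Conjugation sends p(ρ₊) to m(ρ₋) and m(ρ₊) to p(ρ₋), so both products are squared absolute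
values. The sign is then that of |m₊| - |p₊|. -/
lemma wFun_eq_normSq (hq0 : 0 < q) (hq1 : q < 1) (t r : ℝ) :
    wFun q t r = ((normSq (mFun q (rhoP t r)) - normSq (pFun q (rhoP t r)) : ℝ) : ℂ) := by
  push_cast
  rw [normSq_eq_conj_mul_self, normSq_eq_conj_mul_self, conj_pFun hq0 hq1, conj_mFun hq0 hq1,
    conj_rhoP, wFun]
  ring

lemma normSq_sub_neg (hq0 : 0 < q) (hq1 : q < 1) (h : (t, r) ∈ halfDisc q) :
    normSq (mFun q (rhoP t r)) - normSq (pFun q (rhoP t r)) < 0 := by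
  have := norm_mFun_lt_norm_pFun hq0 hq1 (norm_rhoP_lt hq1 h) (by rw [rhoP_im]; exact h.1)
  rw [normSq_eq_norm_sq, normSq_eq_norm_sq, sub_neg]
  gcongr

lemma wFun_ne_zero (hq0 : 0 < q) (hq1 : q < 1) (h : (t, r) ∈ halfDisc q) : wFun q t r ≠ 0 := by
  rw [wFun_eq_normSq hq0 hq1]
  exact_mod_cast (normSq_sub_neg hq0 hq1 h).ne

lemma hFun_ne_zero (hq0 : 0 < q) (hq1 : q < 1) {ρ : ℂ} (h : ‖ρ‖ < 2 / (1 - q)) :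
    hFun q ρ ≠ 0 := mul_ne_zero (pFun_ne_zero hq0 hq1 h) (mFun_ne_zero hq0 hq1 h)

lemma conj_hFun (hq0 : 0 < q) (hq1 : q < 1) (ρ : ℂ) :
    (starRingEnd ℂ) (hFun q ρ) = hFun q ((starRingEnd ℂ) ρ) := by
  rw [hFun, hFun, map_mul, conj_pFun hq0 hq1, conj_mFun hq0 hq1, mul_comm]

lemma LP_eq_tsum (q t r : ℝ) : LP q t r = (1 - q) * ∑' n, lambdaTerm q (rhoM t r) (rhoP t r) n := by
  rw [LP, LambdaP, LambdaM]; ring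

lemma LM_eq_tsum (q t r : ℝ) : LM q t r = (1 - q) * ∑' n, lambdaTerm q (rhoP t r) (rhoM t r) n := by
  rw [LM, LambdaP, LambdaM]; ring

lemma LM_eq (hq0 : 0 < q) (hq1 : q < 1) (h : (t, r) ∈ halfDisc q) :
    LM q t r = wFun q t r / (I * (rhoP t r - rhoM t r) * hFun q (rhoP t r)) := by
  have hc : (1 - q : ℂ) ≠ 0 := by simpa using one_sub_ofReal_pow_ne_zero hq0 hq1 0
  have hh := hFun_ne_zero hq0 hq1 (norm_rhoP_lt hq1 h)
  have hd := rhoP_ne_rhoM (t := t) h.1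
  have := I_ne_zero
  rw [LM_eq_tsum, (hasSum_lambdaTerm hq0 hq1 (norm_rhoP_lt hq1 h) (rhoP_ne_zero h.1)
    (sub_ne_zero.1 (rhoP_ne_rhoM h.1))).tsum_eq, wFun]
  generalize rhoP t r - rhoM t r = d at *
  field_simp

lemma LP_eq (hq0 : 0 < q) (hq1 : q < 1) (h : (t, r) ∈ halfDisc q) :
    LP q t r = wFun q t r / (I * (rhoP t r - rhoM t r) * hFun q (rhoM t r)) := by
  have hc : (1 - q : ℂ) ≠ 0 := by simpa using one_sub_ofReal_pow_ne_zero hq0 hq1 0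
  have hh := hFun_ne_zero hq0 hq1 (norm_rhoM_lt hq1 h)
  have hd := rhoP_ne_rhoM (t := t) h.1
  have := I_ne_zero
  rw [LP_eq_tsum, (hasSum_lambdaTerm hq0 hq1 (norm_rhoM_lt hq1 h) (rhoM_ne_zero h.1)
    (sub_ne_zero.1 (rhoP_ne_rhoM h.1)).symm).tsum_eq, wFun, ← neg_sub (rhoP t r)]
  generalize rhoP t r - rhoM t r = d at *
  field_simp
  ring

/-- In the closed forms the numerator is real, ρ₊ - ρ₋ is purely imaginary, and conjugation
exchanges h(ρ₋) with h(ρ₊). Positivity of L⁺L⁻ = |L⁺|² follows. -/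
lemma conj_LP (hq0 : 0 < q) (hq1 : q < 1) (h : (t, r) ∈ halfDisc q) :
    (starRingEnd ℂ) (LP q t r) = LM q t r := by
  rw [LP_eq hq0 hq1 h, LM_eq hq0 hq1 h, map_div₀, map_mul, map_mul, map_sub, conj_hFun hq0 hq1,
    conj_rhoM, conj_rhoP, conj_I, wFun_eq_normSq hq0 hq1, conj_ofReal]
  ring

lemma LP_ne_zero (hq0 : 0 < q) (hq1 : q < 1) (h : (t, r) ∈ halfDisc q) : LP q t r ≠ 0 := by
  rw [LP_eq hq0 hq1 h]
  exact div_ne_zero (wFun_ne_zero hq0 hq1 h) (mul_ne_zero (mul_ne_zero I_ne_zero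
    (rhoP_ne_rhoM h.1)) (hFun_ne_zero hq0 hq1 (norm_rhoM_lt hq1 h)))

lemma LM_ne_zero (hq0 : 0 < q) (hq1 : q < 1) (h : (t, r) ∈ halfDisc q) : LM q t r ≠ 0 := by
  rw [← conj_LP hq0 hq1 h]
  exact (map_ne_zero _).2 (LP_ne_zero hq0 hq1 h)

lemma LP_mul_LM_eq_normSq (hq0 : 0 < q) (hq1 : q < 1) (h : (t, r) ∈ halfDisc q) :
    LP q t r * LM q t r = (normSq (LP q t r) : ℂ) := by
  rw [normSq_eq_conj_mul_self, conj_LP hq0 hq1 h, mul_comm]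

lemma LP_div_LM (hq0 : 0 < q) (hq1 : q < 1) (h : (t, r) ∈ halfDisc q) :
    LP q t r / LM q t r = hFun q (rhoP t r) / hFun q (rhoM t r) := by
  have h1 := hFun_ne_zero hq0 hq1 (norm_rhoM_lt hq1 h)
  have h2 := hFun_ne_zero hq0 hq1 (norm_rhoP_lt hq1 h)
  have hd := rhoP_ne_rhoM (t := t) h.1
  have hw := wFun_ne_zero hq0 hq1 h
  have := I_ne_zero
  rw [LP_eq hq0 hq1 h, LM_eq hq0 hq1 h]
  generalize rhoP t r - rhoM t r = d at *
  field_simp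

lemma LP_mul_LM (hq0 : 0 < q) (hq1 : q < 1) (h : (t, r) ∈ halfDisc q) :
    LP q t r * LM q t r = -wFun q t r ^ 2 /
      (hFun q (rhoP t r) * hFun q (rhoM t r) * (rhoP t r - rhoM t r) ^ 2) := by
  have h1 := hFun_ne_zero hq0 hq1 (norm_rhoM_lt hq1 h)
  have h2 := hFun_ne_zero hq0 hq1 (norm_rhoP_lt hq1 h)
  have hd := rhoP_ne_rhoM (t := t) h.1
  rw [LP_eq hq0 hq1 h, LM_eq hq0 hq1 h, div_mul_div_comm]
  generalize rhoP t r - rhoM t r = d at *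
  have e : I * d * hFun q (rhoM t r) * (I * d * hFun q (rhoP t r)) =
      -(hFun q (rhoP t r) * hFun q (rhoM t r) * d ^ 2) := by
    linear_combination d ^ 2 * hFun q (rhoP t r) * hFun q (rhoM t r) * I_sq
  rw [e, div_neg, neg_div, ← sq (wFun q t r)]

lemma wFun_eq_gMero (hq0 : 0 < q) (hq1 : q < 1) (h : (t, r) ∈ halfDisc q) :
    wFun q t r = pFun q (rhoP t r) * pFun q (rhoM t r) *
      (gMero q (rhoP t r) - gMero q (rhoM t r)) := by
  have h1 := pFun_ne_zero hq0 hq1 (norm_rhoM_lt hq1 h)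
  have h2 := pFun_ne_zero hq0 hq1 (norm_rhoP_lt hq1 h)
  rw [wFun, gMero, gMero]
  field_simp

lemma gMero_sub_ne_zero (hq0 : 0 < q) (hq1 : q < 1) (h : (t, r) ∈ halfDisc q) :
    gMero q (rhoP t r) - gMero q (rhoM t r) ≠ 0 := by
  have := wFun_ne_zero hq0 hq1 h
  rw [wFun_eq_gMero hq0 hq1 h] at this
  exact right_ne_zero_of_mul this

/-- All factors p cancel, so L⁺L⁻ depends on g alone and can be differentiated with g' = igM. -/
lemma LP_mul_LM_eq_gMero (hq0 : 0 < q) (hq1 : q < 1) (h : (t, r) ∈ halfDisc q) :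
    LP q t r * LM q t r = -(gMero q (rhoP t r) - gMero q (rhoM t r)) ^ 2 /
      (gMero q (rhoP t r) * gMero q (rhoM t r) * (rhoP t r - rhoM t r) ^ 2) := by
  have h1 := pFun_ne_zero hq0 hq1 (norm_rhoM_lt hq1 h)
  have h2 := pFun_ne_zero hq0 hq1 (norm_rhoP_lt hq1 h)
  have h3 := mFun_ne_zero hq0 hq1 (norm_rhoM_lt hq1 h)
  have h4 := mFun_ne_zero hq0 hq1 (norm_rhoP_lt hq1 h)
  have hd := rhoP_ne_rhoM (t := t) h.1
  have hm : ∀ ρ, pFun q ρ ≠ 0 → mFun q ρ = pFun q ρ * gMero q ρ := fun ρ hρ => by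
    rw [gMero, mul_div_cancel₀ _ hρ]
  have g1 := gMero_ne_zero hq0 hq1 (norm_rhoM_lt hq1 h)
  have g2 := gMero_ne_zero hq0 hq1 (norm_rhoP_lt hq1 h)
  rw [LP_mul_LM hq0 hq1 h, wFun_eq_gMero hq0 hq1 h, hFun, hFun, hm _ h1, hm _ h2]
  generalize rhoP t r - rhoM t r = d at *
  generalize gMero q (rhoP t r) - gMero q (rhoM t r) = e at *
  field_simp

/-- Inverting q exchanges the two sums with a factor -q, which the prefactor 1 - q⁻¹ = -(1-q)/q
absorbs. With the sign change of Λ₋ this means that L⁺ and L⁻ trade places. -/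
lemma LambdaP_inv (hq0 : 0 < q) (hr : 0 < r) (hq1 : q < 1) : LambdaP q⁻¹ t r = LambdaP q t r := by
  have hqc : (q : ℂ) ≠ 0 := by exact_mod_cast hq0.ne'
  have h1 := rhoP_ne_zero (t := t) hr
  have h2 := rhoM_ne_zero (t := t) hr
  simp only [LambdaP, lambdaTerm_inv hq0 hq1 h1 h2, lambdaTerm_inv hq0 hq1 h2 h1, tsum_mul_left]
  push_cast
  field_simp
  ring

lemma LambdaM_inv (hq0 : 0 < q) (hr : 0 < r) (hq1 : q < 1) :
    LambdaM q⁻¹ t r = -LambdaM q t r := by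
  have hqc : (q : ℂ) ≠ 0 := by exact_mod_cast hq0.ne'
  have h1 := rhoP_ne_zero (t := t) hr
  have h2 := rhoM_ne_zero (t := t) hr
  simp only [LambdaM, lambdaTerm_inv hq0 hq1 h1 h2, lambdaTerm_inv hq0 hq1 h2 h1, tsum_mul_left]
  push_cast
  field_simp
  ring

lemma summable_lambdaTerm (hq0 : 0 < q) (hq1 : q < 1) (h : (t, r) ∈ halfDisc q) {p : ℝ}
    (hp : p = q ∨ p = q⁻¹) :
    Summable (lambdaTerm p (rhoP t r) (rhoM t r)) ∧
      Summable (lambdaTerm p (rhoM t r) (rhoP t r)) := by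
  have h1 := rhoP_ne_zero (t := t) h.1
  have h2 := rhoM_ne_zero (t := t) h.1
  have hne := sub_ne_zero.1 (rhoP_ne_rhoM (t := t) h.1)
  have s1 := (hasSum_lambdaTerm hq0 hq1 (norm_rhoP_lt hq1 h) h1 hne).summable
  have s2 := (hasSum_lambdaTerm hq0 hq1 (norm_rhoM_lt hq1 h) h2 hne.symm).summable
  rcases hp with rfl | rfl
  · exact ⟨s1, s2⟩
  · constructor
    · exact (s2.mul_left (-q : ℂ)).congr fun n => (lambdaTerm_inv hq0 hq1 h1 h2 n).symm
    · exact (s1.mul_left (-q : ℂ)).congr fun n => (lambdaTerm_inv hq0 hq1 h2 h1 n).symm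

end Lambda

/-! ### Existence of the branches of the normalization -/

/-- On a disc h'/h has a primitive G, chosen with G(0) = 0. Then h e^{-G} is constant, equal to h(0)
= 1, and e^{G/2} is a square root of h. -/
lemma exists_holomorphic_sqrt {h : ℂ → ℂ} {R : ℝ} (hd : Differentiable ℂ h) (h0 : h 0 = 1)
    (hR : 0 < R) (hne : ∀ ρ : ℂ, ‖ρ‖ < R → h ρ ≠ 0) :
    ∃ s : ℂ → ℂ, DifferentiableOn ℂ s (Metric.ball 0 R) ∧
      ∀ ρ ∈ Metric.ball (0 : ℂ) R, s ρ ^ 2 = h ρ := by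
  have hb : ∀ ρ ∈ Metric.ball (0 : ℂ) R, h ρ ≠ 0 := fun ρ hρ => hne ρ (by simpa using hρ)
  have hlog : DifferentiableOn ℂ (fun ρ => deriv h ρ / h ρ) (Metric.ball 0 R) := fun ρ hρ =>
    (((hd.contDiff (n := 2)).differentiable_deriv_two ρ).fun_div (hd ρ)
      (hb ρ hρ)).differentiableWithinAt
  obtain ⟨G, hG0, hG⟩ := (hlog.isExactOn_ball).with_val_at 0 0
  refine ⟨fun ρ => exp (G ρ / 2), fun ρ hρ =>
    (((hG ρ hρ).div_const 2).cexp).differentiableAt.differentiableWithinAt, fun ρ hρ => ?_⟩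
  have hconst : ∀ ρ ∈ Metric.ball (0 : ℂ) R, h ρ * exp (-G ρ) = h 0 * exp (-G 0) := fun ρ hρ => by
    refine Metric.isOpen_ball.is_const_of_deriv_eq_zero
      (Metric.isPreconnected_ball (x := (0 : ℂ)) (r := R)) (f := fun ρ => h ρ * exp (-G ρ))
      (fun z hz => ((hd z).mul (hG z hz).fun_neg.cexp.differentiableAt).differentiableWithinAt)
      (fun z hz => ?_) hρ (Metric.mem_ball_self hR)
    have := ((hd z).hasDerivAt.fun_mul (hG z hz).fun_neg.cexp).deriv
    rw [this]
    have := hb z hz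
    simp only [Pi.zero_apply]
    field_simp
    ring
  have := hconst ρ hρ
  rw [h0, hG0, neg_zero, Complex.exp_zero, one_mul, exp_neg, mul_inv_eq_one₀ (exp_ne_zero _)] at this
  rw [this, ← exp_nat_mul]
  congr 1
  push_cast
  ring

lemma continuous_rhoM : Continuous fun z : ℝ × ℝ => rhoM z.1 z.2 := by
  unfold rhoM; fun_prop

/-- The numerator is a positive real number on the half disc, so a continuous (L⁺)^{-1/2} needs only
a holomorphic square root of h. -/
lemma LP_eq_real {q t r : ℝ} (hq0 : 0 < q) (hq1 : q < 1) (h : (t, r) ∈ halfDisc q) :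
    LP q t r = ((-(normSq (mFun q (rhoP t r)) - normSq (pFun q (rhoP t r))) / (2 * r) : ℝ) : ℂ) /
      hFun q (rhoM t r) := by
  rw [LP_eq hq0 hq1 h, rhoP_sub_rhoM, wFun_eq_normSq hq0 hq1]
  have h1 := hFun_ne_zero hq0 hq1 (norm_rhoM_lt hq1 h)
  have hr : (r : ℂ) ≠ 0 := by exact_mod_cast h.1.ne'
  have e : I * (2 * I * (r : ℂ)) * hFun q (rhoM t r) = -(2 * r * hFun q (rhoM t r)) := by
    linear_combination 2 * (r : ℂ) * hFun q (rhoM t r) * I_sq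
  rw [e]
  push_cast
  field_simp

lemma exists_isNormBranch {q : ℝ} (hq0 : 0 < q) (hq1 : q < 1) :
    ∃ np nm : ℝ → ℝ → ℝ → ℂ, IsNormBranch q np nm := by
  obtain ⟨s, hs, hs2⟩ := exists_holomorphic_sqrt (h := hFun q) (R := 2 / (1 - q))
    ((differentiable_pFun hq0 hq1).mul (differentiable_mFun hq0 hq1))
    (by simp [hFun, pFun_zero, mFun_zero]) (div_pos two_pos (by linarith))
    (fun ρ hρ => hFun_ne_zero hq0 hq1 hρ)
  set c : ℝ → ℝ → ℝ := fun t r =>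
    -(normSq (mFun q (rhoP t r)) - normSq (pFun q (rhoP t r))) / (2 * r) with hc
  have hcpos : ∀ t r, (t, r) ∈ halfDisc q → 0 < c t r := fun t r h =>
    div_pos (neg_pos.2 (normSq_sub_neg hq0 hq1 h)) (mul_pos two_pos h.1)
  set n : ℝ → ℝ → ℂ := fun t r => (Real.sqrt (c t r) : ℂ)⁻¹ * s (rhoM t r) with hn
  have hmem : ∀ z ∈ halfDisc q, rhoM z.1 z.2 ∈ Metric.ball (0 : ℂ) (2 / (1 - q)) := fun z hz => by
    simpa using norm_rhoM_lt hq1 hz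
  have hn2 : ∀ z ∈ halfDisc q, n z.1 z.2 ^ 2 * LP q z.1 z.2 = 1 := fun z hz => by
    have h1 := hFun_ne_zero hq0 hq1 (norm_rhoM_lt hq1 hz)
    have h2 : (c z.1 z.2 : ℂ) ≠ 0 := by exact_mod_cast (hcpos _ _ hz).ne'
    have h3 : (Real.sqrt (c z.1 z.2) : ℂ) ^ 2 = c z.1 z.2 := by
      exact_mod_cast Real.sq_sqrt (hcpos _ _ hz).le
    rw [LP_eq_real hq0 hq1 hz, hn]
    simp only
    rw [mul_pow, hs2 _ (hmem z hz), inv_pow, h3]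
    change (c z.1 z.2 : ℂ)⁻¹ * hFun q (rhoM z.1 z.2) * ((c z.1 z.2 : ℂ) / hFun q (rhoM z.1 z.2)) = 1
    field_simp
  have hcontρ : Continuous fun z : ℝ × ℝ => rhoP z.1 z.2 := by unfold rhoP; fun_prop
  have hcontc : ContinuousOn (fun z : ℝ × ℝ => c z.1 z.2) (halfDisc q) := by
    refine ContinuousOn.div (Continuous.continuousOn ?_) (by fun_prop)
      (fun z hz => (mul_pos two_pos hz.1).ne')
    exact ((continuous_normSq.comp ((differentiable_mFun hq0 hq1).continuous.comp hcontρ)).sub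
      (continuous_normSq.comp ((differentiable_pFun hq0 hq1).continuous.comp hcontρ))).neg
  have hncont : ContinuousOn (fun z : ℝ × ℝ => n z.1 z.2) (halfDisc q) := by
    refine ContinuousOn.mul (ContinuousOn.inv₀ ?_ fun z hz => ?_) ?_
    · exact continuous_ofReal.comp_continuousOn hcontc.sqrt
    · exact_mod_cast (Real.sqrt_pos.2 (hcpos _ _ hz)).ne'
    · exact hs.continuousOn.comp continuous_rhoM.continuousOn fun z hz => hmem z hz
  have hqq : q⁻¹ ≠ q := ((one_lt_inv₀ hq0).2 hq1 |>.trans' hq1).ne'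
  -- As L⁺ and L⁻ are conjugate at q and exchanged at q⁻¹, the one function n and its conjugate
  -- provide all four branches.
  refine ⟨fun p t r => if p = q then n t r else (starRingEnd ℂ) (n t r),
    fun p t r => if p = q then (starRingEnd ℂ) (n t r) else n t r, ?_, ?_, ?_, ?_, ?_⟩
  · simpa using hncont
  · simpa [Function.comp_def] using continuous_conj.comp_continuousOn hncont
  · have hconj : ∀ z ∈ halfDisc q, (starRingEnd ℂ) (n z.1 z.2) ^ 2 * LM q z.1 z.2 = 1 :=
      fun z hz => by
        rw [← conj_LP hq0 hq1 hz, ← map_pow, ← map_mul, hn2 z hz, map_one]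
    rintro p (rfl | rfl) z hz
    · simp only [if_true]
      exact ⟨hn2 z hz, hconj z hz⟩
    · simp only [if_neg hqq, LambdaP_inv hq0 hz.1 hq1, LambdaM_inv hq0 hz.1 hq1, sub_neg_eq_add,
        ← sub_eq_add_neg]
      exact ⟨hconj z hz, hn2 z hz⟩
  · intro z hz
    simp only [if_true]
    -- The product of the two branches is |n|², the positive root of (L⁺L⁻)⁻¹, hence the principal
    -- value.
    have hL := normSq_pos.2 (LP_ne_zero hq0 hq1 hz)
    rw [mul_conj, LP_mul_LM_eq_normSq hq0 hq1 hz,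
      show (-(1 / 2) : ℂ) = ((-(1 / 2) : ℝ) : ℂ) by push_cast; rfl, ← ofReal_cpow hL.le, ofReal_inj,
      Real.rpow_neg hL.le, ← Real.sqrt_eq_rpow]
    have h1 : normSq (n z.1 z.2) ^ 2 * normSq (LP q z.1 z.2) = 1 := by
      rw [← map_pow, ← map_mul, hn2 z hz, map_one]
    refine eq_inv_of_mul_eq_one_left ?_
    rw [← Real.sqrt_sq (normSq_nonneg (n z.1 z.2)), ← Real.sqrt_mul (sq_nonneg _), h1, Real.sqrt_one]
  · intro z hz
    simp [if_neg hqq]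

/-! ### Wirtinger derivatives -/

/-- `F` has partial derivatives in `t` and `r` at `(t, r)`, and `∂₊ F = a`, `∂₋ F = b`. -/
def HasWirtingerAt (F : ℝ → ℝ → ℂ) (a b : ℂ) (t r : ℝ) : Prop :=
  HasDerivAt (fun s => F s r) (a + b) t ∧ HasDerivAt (fun s => F t s) (I * (a - b)) r

namespace HasWirtingerAt

variable {F G : ℝ → ℝ → ℂ} {a b c d : ℂ} {t r : ℝ}

lemma dPlus_eq (h : HasWirtingerAt F a b t r) : dPlus F t r = a := by
  rw [dPlus, h.1.deriv, h.2.deriv]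
  linear_combination (-(a - b) / 2) * I_sq

lemma dMinus_eq (h : HasWirtingerAt F a b t r) : dMinus F t r = b := by
  rw [dMinus, h.1.deriv, h.2.deriv]
  linear_combination ((a - b) / 2) * I_sq

lemma add (h : HasWirtingerAt F a b t r) (h' : HasWirtingerAt G c d t r) :
    HasWirtingerAt (fun t r => F t r + G t r) (a + c) (b + d) t r :=
  ⟨(h.1.fun_add h'.1).congr_deriv (by ring), (h.2.fun_add h'.2).congr_deriv (by ring)⟩

lemma sub (h : HasWirtingerAt F a b t r) (h' : HasWirtingerAt G c d t r) :
    HasWirtingerAt (fun t r => F t r - G t r) (a - c) (b - d) t r :=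
  ⟨(h.1.fun_sub h'.1).congr_deriv (by ring), (h.2.fun_sub h'.2).congr_deriv (by ring)⟩

lemma neg (h : HasWirtingerAt F a b t r) : HasWirtingerAt (fun t r => -F t r) (-a) (-b) t r :=
  ⟨h.1.fun_neg.congr_deriv (by ring), h.2.fun_neg.congr_deriv (by ring)⟩

lemma mul (h : HasWirtingerAt F a b t r) (h' : HasWirtingerAt G c d t r) :
    HasWirtingerAt (fun t r => F t r * G t r) (a * G t r + F t r * c) (b * G t r + F t r * d) t r :=
  ⟨(h.1.fun_mul h'.1).congr_deriv (by ring), (h.2.fun_mul h'.2).congr_deriv (by ring)⟩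

lemma div (h : HasWirtingerAt F a b t r) (h' : HasWirtingerAt G c d t r) (h0 : G t r ≠ 0) :
    HasWirtingerAt (fun t r => F t r / G t r) ((a * G t r - F t r * c) / G t r ^ 2)
      ((b * G t r - F t r * d) / G t r ^ 2) t r :=
  ⟨(h.1.fun_div h'.1 h0).congr_deriv (by ring), (h.2.fun_div h'.2 h0).congr_deriv (by ring)⟩

lemma const_mul (e : ℂ) (h : HasWirtingerAt F a b t r) :
    HasWirtingerAt (fun t r => e * F t r) (e * a) (e * b) t r :=
  ⟨(h.1.const_mul e).congr_deriv (by ring), (h.2.const_mul e).congr_deriv (by ring)⟩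

lemma pow_two (h : HasWirtingerAt F a b t r) :
    HasWirtingerAt (fun t r => F t r ^ 2) (2 * F t r * a) (2 * F t r * b) t r :=
  ⟨(h.1.fun_pow 2).congr_deriv (by push_cast; ring),
    (h.2.fun_pow 2).congr_deriv (by push_cast; ring)⟩

end HasWirtingerAt

lemma hasWirtingerAt_rhoP {f : ℂ → ℂ} {f' : ℂ} {t r : ℝ} (h : HasDerivAt f f' (rhoP t r)) :
    HasWirtingerAt (fun t r => f (rhoP t r)) f' 0 t r := by
  have h1 : HasDerivAt (fun s : ℝ => rhoP s r) 1 t := by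
    simpa [rhoP] using (hasDerivAt_id' t).ofReal_comp.add_const (I * r)
  have h2 : HasDerivAt (fun s : ℝ => rhoP t s) I r := by
    simpa [rhoP] using ((hasDerivAt_id' r).ofReal_comp.const_mul I).const_add (t : ℂ)
  exact ⟨(h.comp t h1).congr_deriv (by ring), (h.comp r h2).congr_deriv (by ring)⟩

lemma hasWirtingerAt_rhoM {f : ℂ → ℂ} {f' : ℂ} {t r : ℝ} (h : HasDerivAt f f' (rhoM t r)) :
    HasWirtingerAt (fun t r => f (rhoM t r)) 0 f' t r := by
  have h1 : HasDerivAt (fun s : ℝ => rhoM s r) 1 t := by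
    simpa [rhoM] using (hasDerivAt_id' t).ofReal_comp.sub_const (I * r)
  have h2 : HasDerivAt (fun s : ℝ => rhoM t s) (-I) r := by
    simpa [rhoM] using ((hasDerivAt_id' r).ofReal_comp.const_mul I).const_sub (t : ℂ)
  exact ⟨(h.comp t h1).congr_deriv (by ring), (h.comp r h2).congr_deriv (by ring)⟩

lemma HasWirtingerAt.congr {F G : ℝ → ℝ → ℂ} {a b : ℂ} {t r : ℝ} {V : Set (ℝ × ℝ)}
    (hV : IsOpen V) (h : ∀ z ∈ V, G z.1 z.2 = F z.1 z.2) (hz : (t, r) ∈ V)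
    (hF : HasWirtingerAt F a b t r) : HasWirtingerAt G a b t r := by
  have c1 : ContinuousAt (fun s : ℝ => (s, r)) t := by fun_prop
  have c2 : ContinuousAt (fun s : ℝ => (t, s)) r := by fun_prop
  refine ⟨hF.1.congr_of_eventuallyEq ?_, hF.2.congr_of_eventuallyEq ?_⟩
  · filter_upwards [c1.preimage_mem_nhds (hV.mem_nhds hz)] with s hs using h _ hs
  · filter_upwards [c2.preimage_mem_nhds (hV.mem_nhds hz)] with s hs using h _ hs

/-! ### Derivatives and smoothness of `L⁺` and `L⁻` -/

section LDeriv

variable {q t r : ℝ}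

lemma differentiable_hFun (hq0 : 0 < q) (hq1 : q < 1) : Differentiable ℂ (hFun q) :=
  (differentiable_pFun hq0 hq1).mul (differentiable_mFun hq0 hq1)

lemma hasWirtingerAt_rhoP_sub_rhoM (t r : ℝ) :
    HasWirtingerAt (fun t r => rhoP t r - rhoM t r) 1 (-1) t r := by
  have := (hasWirtingerAt_rhoP (hasDerivAt_id' (rhoP t r))).sub
    (hasWirtingerAt_rhoM (hasDerivAt_id' (rhoM t r)))
  simpa using this

lemma exists_hasWirtingerAt_wFun (hq0 : 0 < q) (hq1 : q < 1) (t r : ℝ) :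
    ∃ a b, HasWirtingerAt (wFun q) a b t r := by
  have dp := differentiable_pFun hq0 hq1
  have dm := differentiable_mFun hq0 hq1
  exact ⟨_, _, ((hasWirtingerAt_rhoM (dp (rhoM t r)).hasDerivAt).mul
    (hasWirtingerAt_rhoP (dm (rhoP t r)).hasDerivAt)).sub
    ((hasWirtingerAt_rhoP (dp (rhoP t r)).hasDerivAt).mul
    (hasWirtingerAt_rhoM (dm (rhoM t r)).hasDerivAt))⟩

lemma exists_hasWirtingerAt_LP (hq0 : 0 < q) (hq1 : q < 1) (h : (t, r) ∈ halfDisc q) :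
    ∃ a b, HasWirtingerAt (LP q) a b t r := by
  obtain ⟨a, b, hw⟩ := exists_hasWirtingerAt_wFun hq0 hq1 t r
  have hh := hasWirtingerAt_rhoM (differentiable_hFun hq0 hq1 (rhoM t r)).hasDerivAt
  exact ⟨_, _, (hw.div (((hasWirtingerAt_rhoP_sub_rhoM t r).const_mul I).mul hh)
    (mul_ne_zero (mul_ne_zero I_ne_zero (rhoP_ne_rhoM h.1))
      (hFun_ne_zero hq0 hq1 (norm_rhoM_lt hq1 h)))).congr (isOpen_halfDisc q)
      (fun z hz => LP_eq hq0 hq1 hz) h⟩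

lemma exists_hasWirtingerAt_LM (hq0 : 0 < q) (hq1 : q < 1) (h : (t, r) ∈ halfDisc q) :
    ∃ a b, HasWirtingerAt (LM q) a b t r := by
  obtain ⟨a, b, hw⟩ := exists_hasWirtingerAt_wFun hq0 hq1 t r
  have hh := hasWirtingerAt_rhoP (differentiable_hFun hq0 hq1 (rhoP t r)).hasDerivAt
  exact ⟨_, _, (hw.div (((hasWirtingerAt_rhoP_sub_rhoM t r).const_mul I).mul hh)
    (mul_ne_zero (mul_ne_zero I_ne_zero (rhoP_ne_rhoM h.1))
      (hFun_ne_zero hq0 hq1 (norm_rhoP_lt hq1 h)))).congr (isOpen_halfDisc q)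
      (fun z hz => LM_eq hq0 hq1 hz) h⟩

lemma hasWirtingerAt_LP_div_LM (hq0 : 0 < q) (hq1 : q < 1) (h : (t, r) ∈ halfDisc q) :
    HasWirtingerAt (fun t r => LP q t r / LM q t r)
      (LP q t r / LM q t r * (deriv (hFun q) (rhoP t r) / hFun q (rhoP t r)))
      (LP q t r / LM q t r * -(deriv (hFun q) (rhoM t r) / hFun q (rhoM t r))) t r := by
  have h1 := hFun_ne_zero hq0 hq1 (norm_rhoM_lt hq1 h)
  have h2 := hFun_ne_zero hq0 hq1 (norm_rhoP_lt hq1 h)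
  have := ((hasWirtingerAt_rhoP (differentiable_hFun hq0 hq1 (rhoP t r)).hasDerivAt).div
    (hasWirtingerAt_rhoM (differentiable_hFun hq0 hq1 (rhoM t r)).hasDerivAt) h1).congr
    (G := fun t r => LP q t r / LM q t r)
    (isOpen_halfDisc q) (fun z hz => LP_div_LM hq0 hq1 hz) h
  rw [LP_div_LM hq0 hq1 h]
  convert! this using 1 <;> field_simp <;> ring

/-- Derivative of the closed form in g, with g' = igM inserted. The value itself is kept as a factor
so that logarithmic derivatives can be read off. -/
lemma hasWirtingerAt_LP_mul_LM (hq0 : 0 < q) (hq1 : q < 1) (h : (t, r) ∈ halfDisc q) :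
    let gP := gMero q (rhoP t r)
    let gM := gMero q (rhoM t r)
    let mP := MFun q (rhoP t r)
    let mM := MFun q (rhoM t r)
    HasWirtingerAt (fun t r => LP q t r * LM q t r)
      (LP q t r * LM q t r * (2 * I * gP * mP / (gP - gM) - I * mP - 2 / (rhoP t r - rhoM t r)))
      (LP q t r * LM q t r * (-(2 * I * gM * mM / (gP - gM)) - I * mM + 2 / (rhoP t r - rhoM t r)))
      t r := by
  intro gP gM mP mM
  have h1 : gM ≠ 0 := gMero_ne_zero hq0 hq1 (norm_rhoM_lt hq1 h)
  have h2 : gP ≠ 0 := gMero_ne_zero hq0 hq1 (norm_rhoP_lt hq1 h)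
  have hd := rhoP_ne_rhoM (t := t) h.1
  have hg : gP - gM ≠ 0 := gMero_sub_ne_zero hq0 hq1 h
  have wP := hasWirtingerAt_rhoP (hasDerivAt_gMero hq0 hq1 (norm_rhoP_lt hq1 h))
  have wM := hasWirtingerAt_rhoM (hasDerivAt_gMero hq0 hq1 (norm_rhoM_lt hq1 h))
  have := (((wP.sub wM).pow_two.neg).div ((wP.mul wM).mul
    (hasWirtingerAt_rhoP_sub_rhoM t r).pow_two)
    (mul_ne_zero (mul_ne_zero h2 h1) (pow_ne_zero 2 hd))).congr (G := fun t r => LP q t r * LM q t r)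
    (isOpen_halfDisc q) (fun z hz => LP_mul_LM_eq_gMero hq0 hq1 hz) h
  rw [LP_mul_LM_eq_gMero hq0 hq1 h]
  change HasWirtingerAt _ (-(gP - gM) ^ 2 / (gP * gM * (rhoP t r - rhoM t r) ^ 2) * _)
    (-(gP - gM) ^ 2 / (gP * gM * (rhoP t r - rhoM t r) ^ 2) * _) t r
  convert! this using 1
  · change _ = (-(2 * (gP - gM) * (I * gP * mP - 0)) * (gP * gM * (rhoP t r - rhoM t r) ^ 2) -
      -(gP - gM) ^ 2 * ((I * gP * mP * gM + gP * 0) * (rhoP t r - rhoM t r) ^ 2 +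
        gP * gM * (2 * (rhoP t r - rhoM t r) * 1))) / (gP * gM * (rhoP t r - rhoM t r) ^ 2) ^ 2
    generalize rhoP t r - rhoM t r = d at *
    field_simp
    ring
  · change _ = (-(2 * (gP - gM) * (0 - I * gM * mM)) * (gP * gM * (rhoP t r - rhoM t r) ^ 2) -
      -(gP - gM) ^ 2 * ((0 * gM + gP * (I * gM * mM)) * (rhoP t r - rhoM t r) ^ 2 +
        gP * gM * (2 * (rhoP t r - rhoM t r) * -1))) / (gP * gM * (rhoP t r - rhoM t r) ^ 2) ^ 2
    generalize rhoP t r - rhoM t r = d at *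
    field_simp
    ring

/-- The quotient is h(ρ₊)/h(ρ₋), whose logarithmic ∂₋-derivative is a function of ρ₋ alone. -/
lemma dPlus_dMinus_log_div (hq0 : 0 < q) (hq1 : q < 1) (h : (t, r) ∈ halfDisc q) :
    dPlus (fun t r => dMinus (fun t' r' => LP q t' r' / LM q t' r') t r /
      (LP q t r / LM q t r)) t r = 0 := by
  have hbase : ∀ z ∈ halfDisc q, dMinus (fun t' r' => LP q t' r' / LM q t' r') z.1 z.2 /
      (LP q z.1 z.2 / LM q z.1 z.2) =
        -(deriv (hFun q) (rhoM z.1 z.2) / hFun q (rhoM z.1 z.2)) := fun z hz => by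
    rw [(hasWirtingerAt_LP_div_LM hq0 hq1 hz).dMinus_eq, mul_div_cancel_left₀]
    exact div_ne_zero (LP_ne_zero hq0 hq1 hz) (LM_ne_zero hq0 hq1 hz)
  have dh := differentiable_hFun hq0 hq1
  have hd : HasDerivAt (fun ρ => -(deriv (hFun q) ρ / hFun q ρ)) _ (rhoM t r) :=
    ((((dh.contDiff (n := 2)).differentiable_deriv_two (rhoM t r)).fun_div (dh (rhoM t r))
      (hFun_ne_zero hq0 hq1 (norm_rhoM_lt hq1 h))).fun_neg).hasDerivAt
  exact ((hasWirtingerAt_rhoM hd).congr (isOpen_halfDisc q) hbase h).dPlus_eq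

/-- In the logarithmic ∂₋-derivative ρ₊ occurs only in g₊ - g₋ and ρ₊ - ρ₋. Applying ∂₊ gives
2g₊'g₋'/(g₊ - g₋)², which becomes the M-term, and -2/(ρ₊ - ρ₋)² = 1/(2r²). -/
lemma dPlus_dMinus_log_mul (hq0 : 0 < q) (hq1 : q < 1) (h : (t, r) ∈ halfDisc q) :
    dPlus (fun t r => dMinus (fun t' r' => LP q t' r' * LM q t' r') t r /
      (LP q t r * LM q t r)) t r =
      1 / (2 * (r : ℂ) ^ 2) * (1 - MFun q (rhoP t r) * MFun q (rhoM t r) /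
        (LP q t r * LM q t r)) := by
  have hbase : ∀ z ∈ halfDisc q, dMinus (fun t' r' => LP q t' r' * LM q t' r') z.1 z.2 /
      (LP q z.1 z.2 * LM q z.1 z.2) =
        -(2 * I * gMero q (rhoM z.1 z.2) * MFun q (rhoM z.1 z.2) /
          (gMero q (rhoP z.1 z.2) - gMero q (rhoM z.1 z.2))) - I * MFun q (rhoM z.1 z.2) +
          2 / (rhoP z.1 z.2 - rhoM z.1 z.2) := fun z hz => by
    rw [(hasWirtingerAt_LP_mul_LM hq0 hq1 hz).dMinus_eq, mul_div_cancel_left₀]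
    exact mul_ne_zero (LP_ne_zero hq0 hq1 hz) (LM_ne_zero hq0 hq1 hz)
  have h1 := gMero_ne_zero hq0 hq1 (norm_rhoM_lt hq1 h)
  have h2 := gMero_ne_zero hq0 hq1 (norm_rhoP_lt hq1 h)
  have hd := rhoP_ne_rhoM (t := t) h.1
  have hg := gMero_sub_ne_zero hq0 hq1 h
  have wP := hasWirtingerAt_rhoP (hasDerivAt_gMero hq0 hq1 (norm_rhoP_lt hq1 h))
  have wM := hasWirtingerAt_rhoM (hasDerivAt_gMero hq0 hq1 (norm_rhoM_lt hq1 h))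
  have wMM := hasWirtingerAt_rhoM
    (analyticAt_MFun hq0 hq1 (norm_rhoM_lt hq1 h)).differentiableAt.hasDerivAt
  have wc : HasWirtingerAt (fun _ _ => 2) 0 0 t r :=
    ⟨(hasDerivAt_const t (2 : ℂ)).congr_deriv (by simp),
      (hasDerivAt_const r (2 : ℂ)).congr_deriv (by simp)⟩
  have key := (((((wM.const_mul (2 * I)).mul wMM).div (wP.sub wM) hg).neg.sub
    (wMM.const_mul I)).add (wc.div (hasWirtingerAt_rhoP_sub_rhoM t r) hd)).congr
      (G := fun t r => dMinus (fun t' r' => LP q t' r' * LM q t' r') t r / (LP q t r * LM q t r))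
      (isOpen_halfDisc q) hbase h
  rw [key.dPlus_eq, LP_mul_LM_eq_gMero hq0 hq1 h]
  have hr2 : (r : ℂ) ^ 2 = -(rhoP t r - rhoM t r) ^ 2 / 4 := by
    rw [rhoP_sub_rhoM]
    linear_combination (r : ℂ) ^ 2 * I_sq
  rw [hr2]
  generalize rhoP t r - rhoM t r = d at *
  generalize gMero q (rhoP t r) = gP at *
  generalize gMero q (rhoM t r) = gM at *
  field_simp
  linear_combination (4 * MFun q (rhoM t r) * gM * gP * MFun q (rhoP t r) * d ^ 2) * I_sq

lemma contDiff_rhoP {n : WithTop ℕ∞} : ContDiff ℝ n fun z : ℝ × ℝ => rhoP z.1 z.2 :=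
  (ofRealCLM.contDiff.comp contDiff_fst).add
    (contDiff_const.mul (ofRealCLM.contDiff.comp contDiff_snd))

lemma contDiff_rhoM {n : WithTop ℕ∞} : ContDiff ℝ n fun z : ℝ × ℝ => rhoM z.1 z.2 :=
  (ofRealCLM.contDiff.comp contDiff_fst).sub
    (contDiff_const.mul (ofRealCLM.contDiff.comp contDiff_snd))

lemma contDiffOn_comp_rhoP {f : ℂ → ℂ} {n : WithTop ℕ∞} (hq1 : q < 1)
    (hf : ∀ ρ : ℂ, ‖ρ‖ < 2 / (1 - q) → AnalyticAt ℂ f ρ) :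
    ContDiffOn ℝ n (fun z : ℝ × ℝ => f (rhoP z.1 z.2)) (halfDisc q) := fun z hz =>
  (((hf _ (norm_rhoP_lt hq1 hz)).contDiffAt.restrict_scalars ℝ).comp z
    contDiff_rhoP.contDiffAt).contDiffWithinAt

lemma contDiffOn_comp_rhoM {f : ℂ → ℂ} {n : WithTop ℕ∞} (hq1 : q < 1)
    (hf : ∀ ρ : ℂ, ‖ρ‖ < 2 / (1 - q) → AnalyticAt ℂ f ρ) :
    ContDiffOn ℝ n (fun z : ℝ × ℝ => f (rhoM z.1 z.2)) (halfDisc q) := fun z hz =>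
  (((hf _ (norm_rhoM_lt hq1 hz)).contDiffAt.restrict_scalars ℝ).comp z
    contDiff_rhoM.contDiffAt).contDiffWithinAt

lemma contDiffOn_wFun {n : WithTop ℕ∞} (hq0 : 0 < q) (hq1 : q < 1) :
    ContDiffOn ℝ n (fun z : ℝ × ℝ => wFun q z.1 z.2) (halfDisc q) := by
  have dp := fun (ρ : ℂ) (_ : ‖ρ‖ < 2 / (1 - q)) => (differentiable_pFun hq0 hq1).analyticAt ρ
  have dm := fun (ρ : ℂ) (_ : ‖ρ‖ < 2 / (1 - q)) => (differentiable_mFun hq0 hq1).analyticAt ρ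
  exact ((contDiffOn_comp_rhoM hq1 dp).mul (contDiffOn_comp_rhoP hq1 dm)).sub
    ((contDiffOn_comp_rhoP hq1 dp).mul (contDiffOn_comp_rhoM hq1 dm))

lemma contDiffOn_LP {n : WithTop ℕ∞} (hq0 : 0 < q) (hq1 : q < 1) :
    ContDiffOn ℝ n (fun z : ℝ × ℝ => LP q z.1 z.2) (halfDisc q) :=
  ((contDiffOn_wFun hq0 hq1).mul (((contDiffOn_const.mul (contDiff_rhoP.sub
    contDiff_rhoM).contDiffOn).mul (contDiffOn_comp_rhoM hq1 fun ρ _ =>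
      (differentiable_hFun hq0 hq1).analyticAt ρ)).inv fun z hz =>
    (mul_ne_zero (mul_ne_zero I_ne_zero (rhoP_ne_rhoM hz.1))
      (hFun_ne_zero hq0 hq1 (norm_rhoM_lt hq1 hz))))).congr fun z hz => by
        rw [LP_eq hq0 hq1 hz, div_eq_mul_inv]; rfl

lemma contDiffOn_LM {n : WithTop ℕ∞} (hq0 : 0 < q) (hq1 : q < 1) :
    ContDiffOn ℝ n (fun z : ℝ × ℝ => LM q z.1 z.2) (halfDisc q) :=
  (conjCLE.contDiff.comp_contDiffOn (contDiffOn_LP hq0 hq1)).congr fun _ hz =>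
    (conj_LP hq0 hq1 hz).symm

end LDeriv

/-! ### The profiles ψ, φ₁, φ₂ of the solution -/

section Profiles

variable {q t r : ℝ}

lemma LP_mul_LM_eq_norm_sq (hq0 : 0 < q) (hq1 : q < 1) (h : (t, r) ∈ halfDisc q) :
    LP q t r * LM q t r = ((‖LP q t r‖ ^ 2 : ℝ) : ℂ) := by
  rw [LP_mul_LM_eq_normSq hq0 hq1 h, normSq_eq_norm_sq]

lemma LP_mul_LM_cpow (hq0 : 0 < q) (hq1 : q < 1) (h : (t, r) ∈ halfDisc q) :
    (LP q t r * LM q t r) ^ (-(1 / 2) : ℂ) = ((‖LP q t r‖⁻¹ : ℝ) : ℂ) := by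
  rw [LP_mul_LM_eq_norm_sq hq0 hq1 h,
    show (-(1 / 2) : ℂ) = ((-(1 / 2) : ℝ) : ℂ) by push_cast; rfl, ← ofReal_cpow (by positivity),
    Real.rpow_neg (by positivity), ← Real.sqrt_eq_rpow, Real.sqrt_sq (norm_nonneg _)]

lemma conj_MFun_rhoM (q t r : ℝ) : (starRingEnd ℂ) (MFun q (rhoM t r)) = MFun q (rhoP t r) := by
  rw [conj_MFun, conj_rhoM]

lemma fFun_eq (hq0 : 0 < q) (hq1 : q < 1) (h : (t, r) ∈ halfDisc q) :
    fFun q t r = ((-(1 / 2) * (MFun q (rhoM t r)).im * ‖LP q t r‖⁻¹ : ℝ) : ℂ) := by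
  rw [fFun, LP_mul_LM_cpow hq0 hq1 h, ← conj_MFun_rhoM]
  have : (starRingEnd ℂ) (MFun q (rhoM t r)) - MFun q (rhoM t r) =
      -(2 * (MFun q (rhoM t r)).im * I) := by
    apply Complex.ext
    · simp
    · simp; ring
  rw [this]
  push_cast
  linear_combination (1 / 2 * ((MFun q (rhoM t r)).im : ℂ) * (‖LP q t r‖ : ℂ)⁻¹) * I_sq

lemma gFun_eq (hq0 : 0 < q) (hq1 : q < 1) (h : (t, r) ∈ halfDisc q) :
    gFun q t r = ((-(1 / 2) * (1 - (MFun q (rhoM t r)).re * ‖LP q t r‖⁻¹) : ℝ) : ℂ) := by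
  rw [gFun, LP_mul_LM_cpow hq0 hq1 h, ← conj_MFun_rhoM]
  have : (starRingEnd ℂ) (MFun q (rhoM t r)) + MFun q (rhoM t r) =
      2 * (MFun q (rhoM t r)).re := by
    apply Complex.ext
    · simp; ring
    · simp
  rw [this]
  push_cast
  ring

lemma phi1Q_eq (hq0 : 0 < q) (hq1 : q < 1) (h : (t, r) ∈ halfDisc q) :
    phi1Q q t r = (MFun q (rhoM t r)).im * ‖LP q t r‖⁻¹ := by
  rw [phi1Q, fFun_eq hq0 hq1 h, show (-2 : ℂ) = ((-2 : ℝ) : ℂ) by push_cast; rfl, ← ofReal_mul,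
    ofReal_re]
  ring

lemma phi2Q_eq (hq0 : 0 < q) (hq1 : q < 1) (h : (t, r) ∈ halfDisc q) :
    phi2Q q t r = -((MFun q (rhoM t r)).re * ‖LP q t r‖⁻¹) := by
  rw [phi2Q, gFun_eq hq0 hq1 h]
  rw [show ∀ y : ℝ, -(1 + 2 * (y : ℂ)) = ((-(1 + 2 * y) : ℝ) : ℂ) by intro y; push_cast; rfl,
    ofReal_re]
  ring

lemma psiQ_eq (hq0 : 0 < q) (hq1 : q < 1) (h : (t, r) ∈ halfDisc q) :
    psiQ q t r = -Real.log ‖LP q t r‖ := by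
  rw [psiQ, LP_mul_LM_eq_norm_sq hq0 hq1 h, ofReal_re, Real.log_pow]
  push_cast
  ring

lemma norm_LP_pos (hq0 : 0 < q) (hq1 : q < 1) (h : (t, r) ∈ halfDisc q) : 0 < ‖LP q t r‖ :=
  norm_pos_iff.2 (LP_ne_zero hq0 hq1 h)

lemma exp_neg_psiQ (hq0 : 0 < q) (hq1 : q < 1) (h : (t, r) ∈ halfDisc q) :
    Real.exp (-psiQ q t r) = ‖LP q t r‖ := by
  rw [psiQ_eq hq0 hq1 h, neg_neg, Real.exp_log (norm_LP_pos hq0 hq1 h)]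

lemma exp_mul_phi1Q (hq0 : 0 < q) (hq1 : q < 1) (h : (t, r) ∈ halfDisc q) :
    Real.exp (-psiQ q t r) * phi1Q q t r = (MFun q (rhoM t r)).im := by
  have := (norm_LP_pos hq0 hq1 h).ne'
  rw [exp_neg_psiQ hq0 hq1 h, phi1Q_eq hq0 hq1 h]
  field_simp

lemma exp_mul_phi2Q (hq0 : 0 < q) (hq1 : q < 1) (h : (t, r) ∈ halfDisc q) :
    Real.exp (-psiQ q t r) * phi2Q q t r = -(MFun q (rhoM t r)).re := by
  have := (norm_LP_pos hq0 hq1 h).ne'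
  rw [exp_neg_psiQ hq0 hq1 h, phi2Q_eq hq0 hq1 h]
  field_simp

/-- Since e^{-ψ} = |L⁺|, it cancels the factor 1/|L⁺| common to φ₁ and φ₂, leaving the imaginary and
real parts of M(ρ₋). -/
lemma exp_mul_phi_eq (hq0 : 0 < q) (hq1 : q < 1) (h : (t, r) ∈ halfDisc q) :
    ((Real.exp (-psiQ q t r) * phi1Q q t r : ℝ) : ℂ) +
      I * ((Real.exp (-psiQ q t r) * phi2Q q t r : ℝ) : ℂ) = -I * MFun q (rhoM t r) := by
  rw [exp_mul_phi1Q hq0 hq1 h, exp_mul_phi2Q hq0 hq1 h]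
  apply Complex.ext <;> simp

lemma phi_sq_add_sq (hq0 : 0 < q) (hq1 : q < 1) (h : (t, r) ∈ halfDisc q) :
    phi1Q q t r ^ 2 + phi2Q q t r ^ 2 = normSq (MFun q (rhoM t r)) / ‖LP q t r‖ ^ 2 := by
  have := (norm_LP_pos hq0 hq1 h).ne'
  rw [phi1Q_eq hq0 hq1 h, phi2Q_eq hq0 hq1 h, normSq_apply]
  field_simp
  ring

lemma phi_sq_add_sq_pos (hq0 : 0 < q) (hq1 : q < 1) (h : (t, r) ∈ halfDisc q) :
    0 < phi1Q q t r ^ 2 + phi2Q q t r ^ 2 := by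
  rw [phi_sq_add_sq hq0 hq1 h]
  exact div_pos (normSq_pos.2 (MFun_ne_zero hq0 hq1 (norm_rhoM_lt hq1 h)))
    (pow_pos (norm_LP_pos hq0 hq1 h) 2)

lemma ofReal_phi_sq_add_sq (hq0 : 0 < q) (hq1 : q < 1) (h : (t, r) ∈ halfDisc q) :
    ((phi1Q q t r ^ 2 + phi2Q q t r ^ 2 : ℝ) : ℂ) =
      MFun q (rhoP t r) * MFun q (rhoM t r) / (LP q t r * LM q t r) := by
  rw [phi_sq_add_sq hq0 hq1 h, LP_mul_LM_eq_norm_sq hq0 hq1 h, ofReal_div, normSq_eq_conj_mul_self,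
    conj_MFun_rhoM]

lemma contDiffOn_norm_LP {n : WithTop ℕ∞} (hq0 : 0 < q) (hq1 : q < 1) :
    ContDiffOn ℝ n (fun z : ℝ × ℝ => ‖LP q z.1 z.2‖) (halfDisc q) :=
  (contDiffOn_LP hq0 hq1).norm ℝ fun _ hz => LP_ne_zero hq0 hq1 hz

lemma contDiffOn_psiQ {n : WithTop ℕ∞} (hq0 : 0 < q) (hq1 : q < 1) :
    ContDiffOn ℝ n (fun z : ℝ × ℝ => psiQ q z.1 z.2) (halfDisc q) :=
  ((contDiffOn_norm_LP hq0 hq1).log fun _ hz => (norm_LP_pos hq0 hq1 hz).ne').neg.congr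
    fun _ hz => psiQ_eq hq0 hq1 hz

lemma contDiffOn_phi1Q {n : WithTop ℕ∞} (hq0 : 0 < q) (hq1 : q < 1) :
    ContDiffOn ℝ n (fun z : ℝ × ℝ => phi1Q q z.1 z.2) (halfDisc q) :=
  ((imCLM.contDiff.comp_contDiffOn (contDiffOn_comp_rhoM hq1 fun _ => analyticAt_MFun hq0 hq1)).mul
    ((contDiffOn_norm_LP hq0 hq1).inv fun _ hz => (norm_LP_pos hq0 hq1 hz).ne')).congr
    fun _ hz => phi1Q_eq hq0 hq1 hz

lemma contDiffOn_phi2Q {n : WithTop ℕ∞} (hq0 : 0 < q) (hq1 : q < 1) :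
    ContDiffOn ℝ n (fun z : ℝ × ℝ => phi2Q q z.1 z.2) (halfDisc q) :=
  ((reCLM.contDiff.comp_contDiffOn (contDiffOn_comp_rhoM hq1 fun _ => analyticAt_MFun hq0 hq1)).mul
    ((contDiffOn_norm_LP hq0 hq1).inv fun _ hz => (norm_LP_pos hq0 hq1 hz).ne')).neg.congr
    fun _ hz => phi2Q_eq hq0 hq1 hz

/-- The function M(ρ₋) is annihilated by ∂₊; the two equations are the real and imaginary parts of
this. -/
lemma cauchyRiemannOn_phiQ (hq0 : 0 < q) (hq1 : q < 1) :
    CauchyRiemannOn (fun t r => Real.exp (-psiQ q t r) * phi1Q q t r)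
      (fun t r => Real.exp (-psiQ q t r) * phi2Q q t r) (halfDisc q) := by
  intro z hz
  have hw := hasWirtingerAt_rhoM
    (analyticAt_MFun hq0 hq1 (norm_rhoM_lt hq1 hz)).differentiableAt.hasDerivAt
  have hV := isOpen_halfDisc q
  have e1 := fun z hz => exp_mul_phi1Q hq0 hq1 (t := Prod.fst z) (r := Prod.snd z) hz
  have e2 := fun z hz => exp_mul_phi2Q hq0 hq1 (t := Prod.fst z) (r := Prod.snd z) hz
  have a1 := dR_congr hV (F := fun t r => Real.exp (-psiQ q t r) * phi1Q q t r)
    (G := fun t r => (MFun q (rhoM t r)).im) e1 hz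
  have a2 := dT_congr hV (F := fun t r => Real.exp (-psiQ q t r) * phi1Q q t r)
    (G := fun t r => (MFun q (rhoM t r)).im) e1 hz
  have b1 := dR_congr hV (F := fun t r => Real.exp (-psiQ q t r) * phi2Q q t r)
    (G := fun t r => -(MFun q (rhoM t r)).re) e2 hz
  have b2 := dT_congr hV (F := fun t r => Real.exp (-psiQ q t r) * phi2Q q t r)
    (G := fun t r => -(MFun q (rhoM t r)).re) e2 hz
  have c1 := (imCLM.hasFDerivAt.comp_hasDerivAt _ hw.2).deriv
  have c2 := (imCLM.hasFDerivAt.comp_hasDerivAt _ hw.1).deriv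
  have d1 := (reCLM.hasFDerivAt.comp_hasDerivAt _ hw.2).fun_neg.deriv
  have d2 := (reCLM.hasFDerivAt.comp_hasDerivAt _ hw.1).fun_neg.deriv
  constructor
  · refine (a1.trans c1).trans (Eq.trans ?_ (b2.trans d2).symm)
    simp
  · refine (a2.trans c2).trans (Eq.trans ?_ (congrArg Neg.neg (b1.trans d1).symm))
    simp

lemma LP_mul_LM_eq_exp (hq0 : 0 < q) (hq1 : q < 1) (h : (t, r) ∈ halfDisc q) :
    LP q t r * LM q t r = ((Real.exp (-2 * psiQ q t r) : ℝ) : ℂ) := by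
  rw [LP_mul_LM_eq_norm_sq hq0 hq1 h, ← exp_neg_psiQ hq0 hq1 h, ← Real.exp_nat_mul]
  congr 2
  push_cast
  ring

/-- Here -2ψ is the real logarithm of L⁺L⁻, and φ₁² + φ₂² = M₊M₋/(L⁺L⁻), so the formula for the
logarithm of L⁺L⁻ is the claim. -/
lemma laplacian_psiQ (hq0 : 0 < q) (hq1 : q < 1) (h : (t, r) ∈ halfDisc q) :
    dT (dT (psiQ q)) t r + dR (dR (psiQ q)) t r =
      (phi1Q q t r ^ 2 + phi2Q q t r ^ 2 - 1) / r ^ 2 := by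
  have hV := isOpen_halfDisc q
  have hψ := contDiffOn_psiQ (n := 2) hq0 hq1
  have hd : ∀ z ∈ halfDisc q, DifferentiableAt ℝ (fun z : ℝ × ℝ => psiQ q z.1 z.2) (z.1, z.2) :=
    fun z hz => (hψ.differentiableOn two_ne_zero).differentiableAt (hV.mem_nhds hz)
  have hQ : ∀ z ∈ halfDisc q, LP q z.1 z.2 * LM q z.1 z.2 =
      ((Real.exp (-2 * psiQ q z.1 z.2) : ℝ) : ℂ) := fun z hz => LP_mul_LM_eq_exp hq0 hq1 hz
  -- The logarithmic derivative is the derivative of -2ψ; the summand 0 only matches the form of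
  -- `dPlus_dMinus_ofReal_add_const`.
  have hM : ∀ z ∈ halfDisc q, dMinus (fun t r => LP q t r * LM q t r) z.1 z.2 /
      (LP q z.1 z.2 * LM q z.1 z.2) =
        dMinus (fun t r => ((-2 * psiQ q t r : ℝ) : ℂ) + 0) z.1 z.2 := fun z hz => by
    have h1 := (hasDerivAt_dT (hd z hz)).const_mul (-2)
    have h2 := (hasDerivAt_dR (hd z hz)).const_mul (-2)
    rw [dMinus_congr hV (G := fun t r => ((Real.exp (-2 * psiQ q t r) : ℝ) : ℂ)) hQ hz, hQ z hz,
      dMinus, dMinus, h1.exp.ofReal_comp.deriv, h2.exp.ofReal_comp.deriv,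
      (h1.ofReal_comp.add_const 0).deriv, (h2.ofReal_comp.add_const 0).deriv]
    have : ((Real.exp (-2 * psiQ q z.1 z.2) : ℝ) : ℂ) ≠ 0 := by
      exact_mod_cast (Real.exp_pos _).ne'
    push_cast at this ⊢
    field_simp
  have hψ2 : ContDiffOn ℝ 2 (fun z : ℝ × ℝ => -2 * psiQ q z.1 z.2) (halfDisc q) :=
    contDiffOn_const.mul hψ
  have key := dPlus_dMinus_log_mul hq0 hq1 h
  rw [dPlus_congr hV (G := fun t r => dMinus (fun t r => ((-2 * psiQ q t r : ℝ) : ℂ) + 0) t r)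
    hM (z := (t, r)) h, ← ofReal_phi_sq_add_sq hq0 hq1 h] at key
  have key2 := (dPlus_dMinus_ofReal_add_const hV (F := fun t r => -2 * psiQ q t r) hψ2 0
    h).symm.trans key
  have e1 : dT (dT fun t r => -2 * psiQ q t r) t r = -2 * dT (dT (psiQ q)) t r := by
    rw [dT_congr hV (G := fun t r => -2 * dT (psiQ q) t r)
      (fun z hz => ((hasDerivAt_dT (hd z hz)).const_mul (-2)).deriv) h]
    exact ((hasDerivAt_dT (((contDiffOn_dT (m := 1) hV hψ (by norm_num)).differentiableOn
      one_ne_zero).differentiableAt (hV.mem_nhds h))).const_mul (-2)).deriv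
  have e2 : dR (dR fun t r => -2 * psiQ q t r) t r = -2 * dR (dR (psiQ q)) t r := by
    rw [dR_congr hV (G := fun t r => -2 * dR (psiQ q) t r)
      (fun z hz => ((hasDerivAt_dR (hd z hz)).const_mul (-2)).deriv) h]
    exact ((hasDerivAt_dR (((contDiffOn_dR (m := 1) hV hψ (by norm_num)).differentiableOn
      one_ne_zero).differentiableAt (hV.mem_nhds h))).const_mul (-2)).deriv
  rw [e1, e2] at key2
  have key3 : 1 / 4 * (-2 * dT (dT (psiQ q)) t r + -2 * dR (dR (psiQ q)) t r) =
      1 / (2 * r ^ 2) * (1 - (phi1Q q t r ^ 2 + phi2Q q t r ^ 2)) := by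
    exact_mod_cast key2
  have hr := h.1.ne'
  have : (1 / (2 * r ^ 2) * (1 - (phi1Q q t r ^ 2 + phi2Q q t r ^ 2))) =
    -(1 / 2) * ((phi1Q q t r ^ 2 + phi2Q q t r ^ 2 - 1) / r ^ 2) := by
    change r ≠ 0 at hr
    field_simp
    ring
  rw [this] at key3
  linarith

lemma isASDAt_wittenQ (hq0 : 0 < q) (hq1 : q < 1) {x : Spacetime} (hx : x ∈ region q) :
    IsASDAt (wittenConnection (potA0 (psiQ q)) (potA1 (psiQ q)) (phi1Q q) (phi2Q q)) x :=
  (isASD_witten_iff (isOpen_halfDisc q) (fun _ hz => hz.1) (contDiffOn_psiQ hq0 hq1)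
    (contDiffOn_phi1Q hq0 hq1) (contDiffOn_phi2Q hq0 hq1)).2
    ⟨cauchyRiemannOn_phiQ hq0 hq1, fun _ hz => laplacian_psiQ hq0 hq1 hz⟩ x hx

/-! ### The Liouville field -/

/-- The arguments of the two logarithms coincide, so no choice of branch enters: use 4r² = -(ρ₊ -
ρ₋)² and g₊'g₋' = -g₊g₋M₊M₋. -/
lemma wittenLiouville_eq_liouvilleSol (hq0 : 0 < q) (hq1 : q < 1) (h : (t, r) ∈ halfDisc q) :
    wittenLiouville (phi1Q q) (phi2Q q) t r = liouvilleSol (gMero q) (gMero q) t r := by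
  rw [wittenLiouville, liouvilleSol, deriv_gMero hq0 hq1 (norm_rhoP_lt hq1 h),
    deriv_gMero hq0 hq1 (norm_rhoM_lt hq1 h)]
  congr 2
  have h1 := gMero_ne_zero hq0 hq1 (norm_rhoM_lt hq1 h)
  have h2 := gMero_ne_zero hq0 hq1 (norm_rhoP_lt hq1 h)
  have hd := rhoP_ne_rhoM (t := t) h.1
  have hg := gMero_sub_ne_zero hq0 hq1 h
  have hr2 : (4 : ℂ) * (r : ℂ) ^ 2 = -(rhoP t r - rhoM t r) ^ 2 := by
    rw [rhoP_sub_rhoM]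
    linear_combination 4 * (r : ℂ) ^ 2 * I_sq
  rw [ofReal_div, ofReal_neg, ofReal_phi_sq_add_sq hq0 hq1 h, LP_mul_LM_eq_gMero hq0 hq1 h]
  push_cast
  rw [hr2]
  generalize rhoP t r - rhoM t r = d at *
  generalize gMero q (rhoP t r) = gP at *
  generalize gMero q (rhoM t r) = gM at *
  field_simp
  rw [I_sq]
  ring

/-- The expression under the logarithm is invariant under Möbius transformations applied to both
generating functions; inversion is one of them. -/
lemma liouvilleSol_inv (hq0 : 0 < q) (hq1 : q < 1) (h : (t, r) ∈ halfDisc q) :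
    liouvilleSol (fun ρ => (gMero q ρ)⁻¹) (fun ρ => (gMero q ρ)⁻¹) t r =
      liouvilleSol (gMero q) (gMero q) t r := by
  have h1 := gMero_ne_zero hq0 hq1 (norm_rhoM_lt hq1 h)
  have h2 := gMero_ne_zero hq0 hq1 (norm_rhoP_lt hq1 h)
  have hg := gMero_sub_ne_zero hq0 hq1 h
  have dP := hasDerivAt_gMero hq0 hq1 (norm_rhoP_lt hq1 h)
  have dM := hasDerivAt_gMero hq0 hq1 (norm_rhoM_lt hq1 h)
  rw [liouvilleSol, liouvilleSol, (dP.fun_inv h2).deriv, (dM.fun_inv h1).deriv, dP.deriv, dM.deriv]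
  congr 2
  have e : (gMero q (rhoP t r))⁻¹ - (gMero q (rhoM t r))⁻¹ =
      -(gMero q (rhoP t r) - gMero q (rhoM t r)) /
        (gMero q (rhoP t r) * gMero q (rhoM t r)) := by
    field_simp
    ring
  rw [e]
  generalize gMero q (rhoP t r) = gP at *
  generalize gMero q (rhoM t r) = gM at *
  field_simp

lemma liouvilleOn_wittenQ (hq0 : 0 < q) (hq1 : q < 1) :
    LiouvilleOn (wittenLiouville (phi1Q q) (phi2Q q)) (halfDisc q) :=
  (liouvilleOn_iff (isOpen_halfDisc q) (fun _ hz => hz.1) (contDiffOn_psiQ hq0 hq1)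
    (contDiffOn_phi1Q hq0 hq1) (contDiffOn_phi2Q hq0 hq1)
    (fun _ hz => (phi_sq_add_sq_pos hq0 hq1 hz).ne') (cauchyRiemannOn_phiQ hq0 hq1)).2
    fun _ hz => laplacian_psiQ hq0 hq1 hz

lemma liouvilleOn_liouvilleSol (hq0 : 0 < q) (hq1 : q < 1) :
    LiouvilleOn (liouvilleSol (gMero q) (gMero q)) (halfDisc q) := fun z hz => by
  have hV := isOpen_halfDisc q
  have e := fun (z : ℝ × ℝ) hz =>
    (wittenLiouville_eq_liouvilleSol hq0 hq1 (t := z.1) (r := z.2) hz).symm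
  rw [dPlus_congr hV (fun w hw => dMinus_congr hV e hw) hz, e z hz]
  exact liouvilleOn_wittenQ hq0 hq1 z hz

/-- The argument of the complex logarithm is a negative real number, on the cut, so smoothness is
obtained from the real logarithm of its absolute value. -/
lemma contDiffOn_liouvilleSol {n : WithTop ℕ∞} (hq0 : 0 < q) (hq1 : q < 1) :
    ContDiffOn ℝ n (fun z : ℝ × ℝ => liouvilleSol (gMero q) (gMero q) z.1 z.2) (halfDisc q) := by
  have hpos := fun (z : ℝ × ℝ) (hz : z ∈ halfDisc q) =>
    phi_sq_add_sq_pos hq0 hq1 (t := z.1) (r := z.2) hz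
  have h4 : ∀ z ∈ halfDisc q, 4 * z.2 ^ 2 ≠ 0 := fun z hz =>
    (mul_pos four_pos (pow_pos hz.1 2)).ne'
  refine ContDiffOn.congr (f := fun z : ℝ × ℝ => ((-Real.log ((phi1Q q z.1 z.2 ^ 2 +
    phi2Q q z.1 z.2 ^ 2) / (4 * z.2 ^ 2)) : ℝ) : ℂ) + -(Real.pi * I)) ?_ fun z hz => ?_
  · refine (contDiffOn_ofReal (ContDiffOn.neg (ContDiffOn.log (ContDiffOn.div
      (((contDiffOn_phi1Q hq0 hq1).pow 2).add ((contDiffOn_phi2Q hq0 hq1).pow 2))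
      (contDiffOn_const.mul (contDiffOn_snd.pow 2)) h4) fun z hz => ?_))).add contDiffOn_const
    exact div_ne_zero (hpos z hz).ne' (h4 z hz)
  · rw [← wittenLiouville_eq_liouvilleSol hq0 hq1 hz,
      wittenLiouville_eq hz.1 (hpos z hz).ne']

end Profiles

/-! ### Smoothness on spacetime -/

lemma contDiffAt_radius {n : WithTop ℕ∞} {x : Spacetime} (hr : 0 < radius x) :
    ContDiffAt ℝ n radius x := by
  have hne : x 1 ^ 2 + x 2 ^ 2 + x 3 ^ 2 ≠ 0 := by rw [← radius_sq]; positivity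
  have : ContDiff ℝ n fun x : Spacetime => x 1 ^ 2 + x 2 ^ 2 + x 3 ^ 2 := by fun_prop
  exact this.contDiffAt.sqrt hne

lemma continuous_radius : Continuous radius := by
  unfold radius; fun_prop

lemma isOpen_region (q : ℝ) : IsOpen (region q) :=
  (isOpen_halfDisc q).preimage ((continuous_apply 0).prodMk continuous_radius)

lemma contDiffOn_radial {E : Type*} [NormedAddCommGroup E] [NormedSpace ℝ E] {n : WithTop ℕ∞}
    {q : ℝ} {F : ℝ → ℝ → E} (hF : ContDiffOn ℝ n (fun z : ℝ × ℝ => F z.1 z.2) (halfDisc q)) :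
    ContDiffOn ℝ n (fun x : Spacetime => F (x 0) (radius x)) (region q) :=
  ContDiffOn.comp (g := fun z : ℝ × ℝ => F z.1 z.2)
    (f := fun x : Spacetime => (x 0, radius x)) hF
    ((contDiff_apply ℝ ℝ (0 : Fin 4)).contDiffOn.prodMk fun _ hx =>
      (contDiffAt_radius hx.1).contDiffWithinAt) fun _ hx => hx

lemma contDiffOn_sphericalComponent {n : WithTop ℕ∞} {q : ℝ} {T U V W : ℝ → ℝ → ℝ}
    (hT : ContDiffOn ℝ n (fun z : ℝ × ℝ => T z.1 z.2) (halfDisc q))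
    (hU : ContDiffOn ℝ n (fun z : ℝ × ℝ => U z.1 z.2) (halfDisc q))
    (hV : ContDiffOn ℝ n (fun z : ℝ × ℝ => V z.1 z.2) (halfDisc q))
    (hW : ContDiffOn ℝ n (fun z : ℝ × ℝ => W z.1 z.2) (halfDisc q)) (a : Fin 3) (μ : Fin 4) :
    ContDiffOn ℝ n (sphericalComponent T U V W a μ) (region q) := by
  have hc : ∀ i : Fin 4, ContDiffOn ℝ n (fun x : Spacetime => x i) (region q) := fun i =>
    (contDiff_apply ℝ ℝ i).contDiffOn
  induction μ using Fin.cases with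
  | zero => exact (contDiffOn_radial hT).mul (hc a.succ)
  | succ i =>
    exact (((contDiffOn_radial hU).mul ((hc i.succ).mul (hc a.succ))).add
      ((contDiffOn_radial hV).mul contDiffOn_const)).add ((contDiffOn_radial hW).mul
      (ContDiffOn.sum fun k _ => contDiffOn_const.mul (hc k.succ)))

lemma contDiffOn_wittenConnection {n : WithTop ℕ∞} {q : ℝ} {A₀ A₁ φ₁ φ₂ : ℝ → ℝ → ℝ}
    (h0 : ContDiffOn ℝ n (fun z : ℝ × ℝ => A₀ z.1 z.2) (halfDisc q))
    (h1 : ContDiffOn ℝ n (fun z : ℝ × ℝ => A₁ z.1 z.2) (halfDisc q))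
    (hp1 : ContDiffOn ℝ n (fun z : ℝ × ℝ => φ₁ z.1 z.2) (halfDisc q))
    (hp2 : ContDiffOn ℝ n (fun z : ℝ × ℝ => φ₂ z.1 z.2) (halfDisc q)) (μ : Fin 4) (i j : Fin 2) :
    ContDiffOn ℝ n (fun x => wittenConnection A₀ A₁ φ₁ φ₂ μ x i j) (region q) := by
  have hr : ∀ z ∈ halfDisc q, z.2 ≠ 0 := fun z hz => hz.1.ne'
  have hr2 : ∀ z ∈ halfDisc q, z.2 ^ 2 ≠ 0 := fun z hz => pow_ne_zero 2 hz.1.ne'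
  have hr3 : ∀ z ∈ halfDisc q, z.2 ^ 3 ≠ 0 := fun z hz => pow_ne_zero 3 hz.1.ne'
  have hs : ContDiffOn ℝ n (fun z : ℝ × ℝ => z.2) (halfDisc q) := contDiffOn_snd
  rw [wittenConnection_eq_spherical]
  simp only [Matrix.smul_apply, Matrix.sum_apply, smul_eq_mul]
  refine contDiffOn_const.mul (ContDiffOn.sum fun a _ => (contDiffOn_ofReal
    (contDiffOn_sphericalComponent ?_ ?_ ?_ ?_ a μ)).mul contDiffOn_const)
  · exact h0.neg.div hs hr
  · exact (h1.neg.div (hs.pow 2) hr2).add (hp1.div (hs.pow 3) hr3)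
  · exact hp1.neg.div hs hr
  · exact (hp2.add contDiffOn_const).neg.div (hs.pow 2) hr2

/-! ### The derivative of `x̂` -/

/-- The partial derivatives of `x̂`. -/
def dxhat (x : Spacetime) (μ : Fin 4) : M2 :=
  ∑ a : Fin 3, (((if a.succ = μ then 1 else 0) / radius x
    - x a.succ * gradR x μ / radius x ^ 2 : ℝ) : ℂ) • pauli a

lemma hasDerivAt_xhat {x : Spacetime} (hr : 0 < radius x) (μ : Fin 4) (i j : Fin 2) :
    HasDerivAt (fun s => xhat (Function.update x μ s) i j) (dxhat x μ i j) (x μ) := by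
  simp only [xhat, dxhat, Matrix.sum_apply, Matrix.smul_apply, smul_eq_mul]
  refine HasDerivAt.fun_sum fun a _ => (HasDerivAt.ofReal_comp ?_).mul_const _
  have hne : radius (Function.update x μ (x μ)) ≠ 0 := by
    rw [Function.update_eq_self]; exact hr.ne'
  refine ((hasDerivAt_update x μ a.succ).fun_div (hasDerivAt_radius hr μ) hne).congr_deriv ?_
  rw [Function.update_eq_self]
  have := hr.ne'
  field_simp

lemma pd_xhat {x : Spacetime} (hr : 0 < radius x) (μ : Fin 4) : pd μ xhat x = dxhat x μ := by
  ext i j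
  exact (hasDerivAt_xhat hr μ i j).deriv

/-! ### Partial derivatives on spacetime and their symmetry -/

lemma hasDerivAt_partial {E : Type*} [NormedAddCommGroup E] [NormedSpace ℝ E] {F : Spacetime → E}
    {x : Spacetime} (hF : DifferentiableAt ℝ F x) (μ : Fin 4) :
    HasDerivAt (fun s => F (Function.update x μ s)) (fderiv ℝ F x (Pi.single μ 1)) (x μ) := by
  have h := HasFDerivAt.comp_hasDerivAt (x μ) (f := Function.update x μ) (l := F)
    (l' := fderiv ℝ F x) (by simpa using hF.hasFDerivAt) (_root_.hasDerivAt_update x μ (x μ))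
  exact h

lemma hasDerivAt_partial_partial {F : Spacetime → ℝ} {U : Set Spacetime} (hU : IsOpen U)
    (hF : ContDiffOn ℝ 2 F U) {x : Spacetime} (hx : x ∈ U) (μ ν : Fin 4) :
    HasDerivAt (fun s => fderiv ℝ F (Function.update x μ s) (Pi.single ν 1))
      (fderiv ℝ (fderiv ℝ F) x (Pi.single μ 1) (Pi.single ν 1)) (x μ) := by
  have hf : DifferentiableAt ℝ (fderiv ℝ F) x :=
    ((hF.fderiv_of_isOpen (m := 1) hU (by norm_num)).differentiableOn one_ne_zero).differentiableAt
      (hU.mem_nhds hx)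
  have h := (hasDerivAt_partial hf μ).clm_apply
    (hasDerivAt_const (x μ) (Pi.single ν 1 : Spacetime))
  simpa using h

lemma eventually_update_mem {U : Set Spacetime} (hU : IsOpen U) {x : Spacetime} (hx : x ∈ U)
    (μ : Fin 4) : ∀ᶠ s in 𝓝 (x μ), Function.update x μ s ∈ U := by
  have : ContinuousAt (Function.update x μ) (x μ) :=
    (_root_.hasDerivAt_update x μ (x μ)).continuousAt
  exact this.preimage_mem_nhds (hU.mem_nhds (by simpa using hx))

/-- Adding a closed multiple of the identity does not change the curvature. -/
lemma curvature_add_grad {A B : Connection} {F : Spacetime → ℝ} {U : Set Spacetime}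
    (hU : IsOpen U) (hF : ContDiffOn ℝ 2 F U) (c : ℂ)
    (hB : ∀ μ i j, DifferentiableOn ℝ (fun x => B μ x i j) U)
    (h : ∀ μ, ∀ x ∈ U, A μ x = B μ x + (c * (fderiv ℝ F x (Pi.single μ 1) : ℝ)) • (1 : M2))
    {x : Spacetime} (hx : x ∈ U) (μ ν : Fin 4) : curvature A μ ν x = curvature B μ ν x := by
  have hpd : ∀ μ ν, pd μ (A ν) x = pd μ (B ν) x +
      (c * (fderiv ℝ (fderiv ℝ F) x (Pi.single μ 1) (Pi.single ν 1) : ℝ)) • (1 : M2) := by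
    intro μ ν
    ext i j
    have e : (fun s => A ν (Function.update x μ s) i j) =ᶠ[𝓝 (x μ)] fun s =>
        B ν (Function.update x μ s) i j +
          c * ((fderiv ℝ F (Function.update x μ s) (Pi.single ν 1) : ℝ) : ℂ) * (1 : M2) i j := by
      filter_upwards [eventually_update_mem hU hx μ] with s hs
      rw [h ν _ hs]
      simp
    have hd := ((hasDerivAt_partial ((hB ν i j).differentiableAt (hU.mem_nhds hx)) μ).fun_add
      (((hasDerivAt_partial_partial hU hF hx μ ν).ofReal_comp.const_mul c).mul_const
        ((1 : M2) i j)))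
    simp only [pd, Matrix.of_apply, Matrix.add_apply, Matrix.smul_apply, smul_eq_mul]
    rw [e.deriv_eq, hd.deriv, (hasDerivAt_partial ((hB ν i j).differentiableAt
      (hU.mem_nhds hx)) μ).deriv]
  have hsymm : IsSymmSndFDerivAt ℝ F x :=
    (hF.contDiffAt (hU.mem_nhds hx)).isSymmSndFDerivAt (by simp)
  rw [curvature, curvature, hpd, hpd, h μ x hx, h ν x hx,
    hsymm (Pi.single ν 1) (Pi.single μ 1)]
  simp only [add_mul, mul_add, smul_mul_assoc, mul_smul_comm, one_mul, mul_one]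
  module

/-! ### The trace part as an abelian pure gauge -/

section Gauge

variable {q t r : ℝ}

/-- The logarithm of the gauge function that removes the trace part of the connection. -/
def gaugeLog (q t r : ℝ) : ℝ := 1 / 2 * Real.log ‖hFun q (rhoP t r)‖

lemma contDiffOn_gaugeLog {n : WithTop ℕ∞} (hq0 : 0 < q) (hq1 : q < 1) :
    ContDiffOn ℝ n (fun z : ℝ × ℝ => gaugeLog q z.1 z.2) (halfDisc q) := by
  have hne := fun (z : ℝ × ℝ) (hz : z ∈ halfDisc q) => hFun_ne_zero hq0 hq1 (norm_rhoP_lt hq1 hz)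
  exact contDiffOn_const.mul (((contDiffOn_comp_rhoP hq1 fun ρ _ =>
    (differentiable_hFun hq0 hq1).analyticAt ρ).norm ℝ hne).log fun z hz =>
      norm_ne_zero_iff.2 (hne z hz))

/-- The fourth power of |h|^{1/2} splits into a function of ρ₊ times a function of ρ₋, which makes
its derivatives available. -/
lemma ofReal_exp_gaugeLog (hq0 : 0 < q) (hq1 : q < 1) (h : (t, r) ∈ halfDisc q) :
    ((Real.exp (4 * gaugeLog q t r) : ℝ) : ℂ) = hFun q (rhoP t r) * hFun q (rhoM t r) := by
  have hpos := norm_pos_iff.2 (hFun_ne_zero hq0 hq1 (norm_rhoP_lt hq1 h))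
  have e : 4 * gaugeLog q t r = (2 : ℕ) * Real.log ‖hFun q (rhoP t r)‖ := by
    rw [gaugeLog]; push_cast; ring
  rw [e, Real.exp_nat_mul, Real.exp_log hpos, ← normSq_eq_norm_sq, normSq_eq_conj_mul_self,
    conj_hFun hq0 hq1, conj_rhoP, mul_comm]

lemma gaugeLog_deriv (hq0 : 0 < q) (hq1 : q < 1) (h : (t, r) ∈ halfDisc q) :
    4 * ((dT (gaugeLog q) t r : ℝ) : ℂ) = deriv (hFun q) (rhoP t r) / hFun q (rhoP t r) +
        deriv (hFun q) (rhoM t r) / hFun q (rhoM t r) ∧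
      4 * ((dR (gaugeLog q) t r : ℝ) : ℂ) = I * (deriv (hFun q) (rhoP t r) / hFun q (rhoP t r) -
        deriv (hFun q) (rhoM t r) / hFun q (rhoM t r)) := by
  have hV := isOpen_halfDisc q
  have hd : DifferentiableAt ℝ (fun z : ℝ × ℝ => gaugeLog q z.1 z.2) (t, r) :=
    ((contDiffOn_gaugeLog (n := 1) hq0 hq1).differentiableOn one_ne_zero).differentiableAt
      (hV.mem_nhds h)
  have e := fun (z : ℝ × ℝ) (hz : z ∈ halfDisc q) => ofReal_exp_gaugeLog hq0 hq1 hz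
  have hw := ((hasWirtingerAt_rhoP (differentiable_hFun hq0 hq1 (rhoP t r)).hasDerivAt).mul
    (hasWirtingerAt_rhoM (differentiable_hFun hq0 hq1 (rhoM t r)).hasDerivAt)).congr
      (G := fun t r => ((Real.exp (4 * gaugeLog q t r) : ℝ) : ℂ)) hV e h
  have h1 := ((hasDerivAt_dT hd).const_mul 4).exp.ofReal_comp.unique hw.1
  have h2 := ((hasDerivAt_dR hd).const_mul 4).exp.ofReal_comp.unique hw.2
  rw [ofReal_mul, ofReal_exp_gaugeLog hq0 hq1 h, ofReal_mul] at h1 h2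
  have n1 := hFun_ne_zero hq0 hq1 (norm_rhoM_lt hq1 h)
  have n2 := hFun_ne_zero hq0 hq1 (norm_rhoP_lt hq1 h)
  constructor
  · refine mul_left_cancel₀ (mul_ne_zero n2 n1) ?_
    rw [← ofReal_ofNat, h1]
    field_simp
    ring
  · refine mul_left_cancel₀ (mul_ne_zero n2 n1) ?_
    rw [← ofReal_ofNat, h2]
    field_simp
    ring

/-- As h(ρ₋) is the conjugate of h(ρ₊), log(L⁺/L⁻) is 2i arg h(ρ₊). It is tied to log |h(ρ₊)| by the
Cauchy–Riemann equations, so the rotated gradient in Ω becomes an ordinary gradient. -/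
lemma logDeriv_LP_div_LM (hq0 : 0 < q) (hq1 : q < 1) (h : (t, r) ∈ halfDisc q) :
    logDeriv (fun s => LP q s r / LM q s r) t = -4 * I * (dR (gaugeLog q) t r : ℝ) ∧
      logDeriv (fun s => LP q t s / LM q t s) r = 4 * I * (dT (gaugeLog q) t r : ℝ) := by
  have hw := hasWirtingerAt_LP_div_LM hq0 hq1 h
  have hne : LP q t r / LM q t r ≠ 0 := div_ne_zero (LP_ne_zero hq0 hq1 h) (LM_ne_zero hq0 hq1 h)
  obtain ⟨e1, e2⟩ := gaugeLog_deriv hq0 hq1 h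
  constructor
  · rw [logDeriv_apply, hw.1.deriv, ← mul_add, mul_div_cancel_left₀ _ hne]
    linear_combination I * e2 + (deriv (hFun q) (rhoP t r) / hFun q (rhoP t r) -
        deriv (hFun q) (rhoM t r) / hFun q (rhoM t r)) * I_sq
  · rw [logDeriv_apply, hw.2.deriv, ← mul_sub, mul_left_comm, mul_div_cancel_left₀ _ hne]
    linear_combination -I * e1

lemma logDeriv_LP_mul_LM (hq0 : 0 < q) (hq1 : q < 1) (h : (t, r) ∈ halfDisc q) :
    logDeriv (fun s => LP q s r * LM q s r) t = -2 * (dT (psiQ q) t r : ℝ) ∧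
      logDeriv (fun s => LP q t s * LM q t s) r = -2 * (dR (psiQ q) t r : ℝ) := by
  have hV := isOpen_halfDisc q
  have hd : DifferentiableAt ℝ (fun z : ℝ × ℝ => psiQ q z.1 z.2) (t, r) :=
    ((contDiffOn_psiQ (n := 1) hq0 hq1).differentiableOn one_ne_zero).differentiableAt
      (hV.mem_nhds h)
  have e := fun (z : ℝ × ℝ) (hz : z ∈ halfDisc q) => LP_mul_LM_eq_exp hq0 hq1 hz
  have h1 := ((hasDerivAt_dT hd).const_mul (-2)).exp.ofReal_comp.deriv
  have h2 := ((hasDerivAt_dR hd).const_mul (-2)).exp.ofReal_comp.deriv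
  have a1 : deriv (fun s => LP q s r * LM q s r) t = _ := dT_congr hV
    (F := fun t r => LP q t r * LM q t r)
    (G := fun t r => ((Real.exp (-2 * psiQ q t r) : ℝ) : ℂ)) e h
  have a2 : deriv (fun s => LP q t s * LM q t s) r = _ := dR_congr hV
    (F := fun t r => LP q t r * LM q t r)
    (G := fun t r => ((Real.exp (-2 * psiQ q t r) : ℝ) : ℂ)) e h
  have hne : ((Real.exp (-2 * psiQ q t r) : ℝ) : ℂ) ≠ 0 := by
    exact_mod_cast (Real.exp_pos _).ne'
  rw [logDeriv_apply, logDeriv_apply]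
  constructor
  · rw [a1.trans h1, e (t, r) h, ofReal_mul, mul_div_cancel_left₀ _ hne]
    push_cast; rfl
  · rw [a2.trans h2, e (t, r) h, ofReal_mul, mul_div_cancel_left₀ _ hne]
    push_cast; rfl

/-- `qbps` splits into Witten's form and an abelian part. -/
lemma qbps_eq_witten_add (hq0 : 0 < q) (hq1 : q < 1) {x : Spacetime} (hx : x ∈ region q)
    (μ : Fin 4) :
    qbps q μ x = wittenConnection (potA0 (psiQ q)) (potA1 (psiQ q)) (phi1Q q) (phi2Q q) μ x +
      (-I * (gradT μ * dT (gaugeLog q) (x 0) (radius x) +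
        gradR x μ * dR (gaugeLog q) (x 0) (radius x) : ℝ)) • (1 : M2) := by
  have hr : 0 < radius x := hx.1
  have hrc : (radius x : ℂ) ≠ 0 := by exact_mod_cast hr.ne'
  obtain ⟨a1, a2⟩ := logDeriv_LP_div_LM hq0 hq1 hx
  obtain ⟨b1, b2⟩ := logDeriv_LP_mul_LM hq0 hq1 hx
  have hf : fFun q (x 0) (radius x) = ((-(1 / 2) * phi1Q q (x 0) (radius x) : ℝ) : ℂ) := by
    rw [fFun_eq hq0 hq1 hx, phi1Q_eq hq0 hq1 hx]; push_cast; ring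
  have hg : gFun q (x 0) (radius x) = ((-(1 / 2) * (1 + phi2Q q (x 0) (radius x)) : ℝ) : ℂ) := by
    rw [gFun_eq hq0 hq1 hx, phi2Q_eq hq0 hq1 hx]; push_cast; ring
  have p0 : potA0 (psiQ q) (x 0) (radius x) = -dR (psiQ q) (x 0) (radius x) := rfl
  have p1 : potA1 (psiQ q) (x 0) (radius x) = dT (psiQ q) (x 0) (radius x) := rfl
  induction μ using Fin.cases with
  | zero =>
    simp only [qbps, wittenConnection, wittenComponent, Fin.cases_zero, drOmega, a2, b2, p0, xhat,
      Fin.sum_univ_three, gradT, gradR]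
    simp only [if_true]
    push_cast
    match_scalars <;> field_simp <;> ring
  | succ j =>
    simp only [qbps, wittenConnection, wittenComponent, Fin.cases_succ, dtOmega, a1, b1, p1,
      pd_xhat hr, dxhat, xhat, hf, hg, gradT, gradR]
    fin_cases j <;>
    · simp [Fin.sum_univ_three, epsilon]
      match_scalars <;> field_simp <;> ring

lemma trace_wittenConnection (A₀ A₁ φ₁ φ₂ : ℝ → ℝ → ℝ) (μ : Fin 4) (x : Spacetime) :
    (wittenConnection A₀ A₁ φ₁ φ₂ μ x).trace = 0 := by
  simp [wittenConnection, Matrix.trace, Fin.sum_univ_three, Fin.sum_univ_two, pauli]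

/-- Witten's form is traceless, so taking the trace of the splitting identifies the coefficient of
the identity. -/
lemma qbps_traceless_part (hq0 : 0 < q) (hq1 : q < 1) {x : Spacetime} (hx : x ∈ region q)
    (μ : Fin 4) :
    qbps q μ x = wittenConnection (potA0 (psiQ q)) (potA1 (psiQ q)) (phi1Q q) (phi2Q q) μ x +
      ((qbps q μ x).trace / 2) • (1 : M2) := by
  have h := qbps_eq_witten_add hq0 hq1 hx μ
  have ht := congrArg Matrix.trace h
  rw [Matrix.trace_add, trace_wittenConnection, zero_add, Matrix.trace_smul, Matrix.trace_one,
    Fintype.card_fin, smul_eq_mul] at ht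
  rw [ht]
  push_cast
  rw [mul_div_cancel_right₀ _ two_ne_zero]
  exact_mod_cast h

lemma fderiv_gaugeLog (hq0 : 0 < q) (hq1 : q < 1) {x : Spacetime} (hx : x ∈ region q)
    (μ : Fin 4) :
    fderiv ℝ (fun x : Spacetime => gaugeLog q (x 0) (radius x)) x (Pi.single μ 1) =
      gradT μ * dT (gaugeLog q) (x 0) (radius x) +
        gradR x μ * dR (gaugeLog q) (x 0) (radius x) := by
  have h1 := hasDerivAt_partial (((contDiffOn_radial (contDiffOn_gaugeLog (n := 1) hq0
    hq1)).differentiableOn one_ne_zero).differentiableAt ((isOpen_region q).mem_nhds hx)) μ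
  exact h1.unique (hasDerivAt_radial hx.1 (((contDiffOn_gaugeLog (n := 1) hq0 hq1).differentiableOn
    one_ne_zero).differentiableAt ((isOpen_halfDisc q).mem_nhds hx)) μ)

lemma contDiffOn_wittenQ (hq0 : 0 < q) (hq1 : q < 1) (μ : Fin 4) (i j : Fin 2) :
    ContDiffOn ℝ ∞ (fun x => wittenConnection (potA0 (psiQ q)) (potA1 (psiQ q)) (phi1Q q)
      (phi2Q q) μ x i j) (region q) :=
  contDiffOn_wittenConnection
    (contDiffOn_dR (n := ∞) (isOpen_halfDisc q) (contDiffOn_psiQ hq0 hq1) (by simp)).neg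
    (contDiffOn_dT (n := ∞) (isOpen_halfDisc q) (contDiffOn_psiQ hq0 hq1) (by simp))
    (contDiffOn_phi1Q hq0 hq1) (contDiffOn_phi2Q hq0 hq1) μ i j

lemma contDiffOn_qbps (hq0 : 0 < q) (hq1 : q < 1) (μ : Fin 4) (i j : Fin 2) :
    ContDiffOn ℝ ∞ (fun x => qbps q μ x i j) (region q) := by
  have hL : ContDiffOn ℝ ∞ (fun x : Spacetime => fderiv ℝ (fun x : Spacetime =>
      gaugeLog q (x 0) (radius x)) x (Pi.single μ 1)) (region q) :=
    ((contDiffOn_radial (contDiffOn_gaugeLog (n := ∞) hq0 hq1)).fderiv_of_isOpen (m := ∞)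
      (isOpen_region q) (by simp)).clm_apply contDiffOn_const
  refine ((contDiffOn_wittenQ hq0 hq1 μ i j).add ((contDiffOn_const (c := -I)).mul
    ((contDiffOn_ofReal hL).mul (contDiffOn_const (c := (1 : M2) i j))))).congr fun x hx => ?_
  rw [qbps_eq_witten_add hq0 hq1 hx, ← fderiv_gaugeLog hq0 hq1 hx, Matrix.add_apply,
    Matrix.smul_apply, smul_eq_mul, mul_assoc]

lemma isASDAt_qbps (hq0 : 0 < q) (hq1 : q < 1) {x : Spacetime} (hx : x ∈ region q) :
    IsASDAt (qbps q) x := by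
  have h := isASDAt_wittenQ hq0 hq1 hx
  have hc := curvature_add_grad (A := qbps q) (isOpen_region q) (contDiffOn_radial
    (contDiffOn_gaugeLog (n := 2) hq0 hq1)) (-I)
    (fun μ i j => (contDiffOn_wittenQ hq0 hq1 μ i j).differentiableOn (by simp))
    (fun μ x hx => by rw [fderiv_gaugeLog hq0 hq1 hx]; exact qbps_eq_witten_add hq0 hq1 hx μ) hx
  simpa only [IsASDAt, hc] using h

/-- For a scalar gauge function the conjugation is trivial and the transform adds i d log u. The
choice u = |h(ρ₊)|^{1/2} cancels the trace part. -/
lemma exists_gauge (hq0 : 0 < q) (hq1 : q < 1) :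
    ∃ u : Spacetime → ℝ, ContDiffOn ℝ ∞ u (region q) ∧ (∀ x ∈ region q, 0 < u x) ∧
      ∀ μ : Fin 4, ∀ x ∈ region q,
        gaugeTransform (fun y => (u y : ℂ) • (1 : M2)) (qbps q) μ x =
          wittenConnection (potA0 (psiQ q)) (potA1 (psiQ q)) (phi1Q q) (phi2Q q) μ x := by
  refine ⟨fun x => Real.exp (gaugeLog q (x 0) (radius x)),
    (contDiffOn_radial (contDiffOn_gaugeLog hq0 hq1)).exp, fun x _ => Real.exp_pos _,
    fun μ x hx => ?_⟩
  set u := Real.exp (gaugeLog q (x 0) (radius x)) with hu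
  have hu0 : (u : ℂ) ≠ 0 := by exact_mod_cast (Real.exp_pos _).ne'
  have hd := hasDerivAt_radial hx.1 (((contDiffOn_gaugeLog (n := 1) hq0 hq1).differentiableOn
    one_ne_zero).differentiableAt ((isOpen_halfDisc q).mem_nhds hx)) μ
  have hpd : pd μ (fun y => ((Real.exp (gaugeLog q (y 0) (radius y)) : ℝ) : ℂ) • (1 : M2)) x =
      ((u * (gradT μ * dT (gaugeLog q) (x 0) (radius x) +
        gradR x μ * dR (gaugeLog q) (x 0) (radius x)) : ℝ) : ℂ) • (1 : M2) := by
    ext i j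
    refine (hd.exp.ofReal_comp.mul_const ((1 : M2) i j)).deriv.trans ?_
    simp [hu]
  have hinv : ((u : ℂ) • (1 : M2))⁻¹ = (u : ℂ)⁻¹ • (1 : M2) := by
    refine Matrix.inv_eq_left_inv ?_
    rw [smul_mul_smul_comm, one_mul, inv_mul_cancel₀ hu0, one_smul]
  rw [gaugeTransform, hpd, qbps_eq_witten_add hq0 hq1 hx μ]
  change ((u : ℂ) • (1 : M2))⁻¹ * _ * ((u : ℂ) • (1 : M2)) +
    I • (((u : ℂ) • (1 : M2))⁻¹ * _) = _
  rw [hinv]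
  simp only [smul_mul_assoc, mul_smul_comm, one_mul, mul_one, smul_smul, ofReal_mul]
  rw [mul_inv_cancel₀ hu0, one_smul, mul_comm (u : ℂ), mul_assoc (ofReal _), mul_inv_cancel₀ hu0]
  module

end Gauge

/-! ### Functions of `x̂` -/

/-- `a P₊ + b P₋` for the spectral projections `P± = (1 ± x̂) / 2`. -/
def spec (x : Spacetime) (a b : ℂ) : M2 := ((a + b) / 2) • (1 : M2) + ((a - b) / 2) • xhat x

section Spec

variable {x : Spacetime} {a b c d : ℂ}

lemma xhat_mul_xhat (hr : 0 < radius x) : xhat x * xhat x = 1 := by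
  have hrc : (radius x : ℂ) ≠ 0 := by exact_mod_cast hr.ne'
  have h2 : (radius x : ℂ) ^ 2 = x 1 ^ 2 + x 2 ^ 2 + x 3 ^ 2 := by exact_mod_cast radius_sq x
  ext i j
  fin_cases i <;> fin_cases j <;>
    simp [xhat, pauli, Fin.sum_univ_three, Matrix.mul_apply, Fin.sum_univ_two] <;>
    field_simp <;> ring_nf <;> simp only [I_sq, h2] <;> ring

lemma spec_mul (hr : 0 < radius x) : spec x a b * spec x c d = spec x (a * c) (b * d) := by
  simp only [spec, add_mul, mul_add, smul_mul_assoc, mul_smul_comm, one_mul, mul_one,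
    xhat_mul_xhat hr]
  module

lemma spec_one : spec x 1 1 = 1 := by simp [spec]

lemma smul_spec : c • spec x a b = spec x (c * a) (c * b) := by
  simp only [spec]; module

lemma spec_add : spec x a b + spec x c d = spec x (a + c) (b + d) := by
  simp only [spec]; module

lemma spec_sub : spec x a b - spec x c d = spec x (a - c) (b - d) := by
  simp only [spec]; module

lemma spec_eq_smul_add : spec x a b = a • spec x 1 0 + b • spec x 0 1 := by
  simp only [spec]; module

lemma spec_pow (hr : 0 < radius x) (n : ℕ) : spec x a b ^ n = spec x (a ^ n) (b ^ n) := by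
  induction n with
  | zero => simp [spec_one]
  | succ n ih => rw [pow_succ, ih, spec_mul hr, pow_succ, pow_succ]

lemma conjTranspose_pauli (a : Fin 3) : (pauli a)ᴴ = pauli a := by
  ext i j
  fin_cases a <;> fin_cases i <;> fin_cases j <;> simp [pauli]

lemma conjTranspose_xhat (x : Spacetime) : (xhat x)ᴴ = xhat x := by
  simp [xhat, Matrix.conjTranspose_sum, Matrix.conjTranspose_smul, conjTranspose_pauli]

lemma conjTranspose_spec :
    (spec x a b)ᴴ = spec x ((starRingEnd ℂ) a) ((starRingEnd ℂ) b) := by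
  simp [spec, Matrix.conjTranspose_add, Matrix.conjTranspose_smul, conjTranspose_xhat]

/-- Here x† = t - i r x̂, which acts on P± as t ∓ ir. -/
lemma conjTranspose_quat (hr : 0 < radius x) :
    (quat x)ᴴ = spec x (rhoM (x 0) (radius x)) (rhoP (x 0) (radius x)) := by
  have hrc : (radius x : ℂ) ≠ 0 := by exact_mod_cast hr.ne'
  simp only [quat, spec, xhat, rhoM, rhoP, Matrix.conjTranspose_add, Matrix.conjTranspose_smul,
    Matrix.conjTranspose_sum, conjTranspose_pauli, Matrix.conjTranspose_one]
  simp [Fin.sum_univ_three]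
  match_scalars <;> field_simp <;> ring

lemma normFun_eq_spec (np nm : ℝ → ℝ → ℝ → ℂ) (p : ℝ) (x : Spacetime) :
    normFun np nm p x = spec x (np p (x 0) (radius x)) (nm p (x 0) (radius x)) := by
  simp only [normFun, spec]
  module

lemma hasSum_spec {f g : ℕ → ℂ} {a b : ℂ} (hf : HasSum f a) (hg : HasSum g b) :
    HasSum (fun n => spec x (f n) (g n)) (spec x a b) := by
  rw [spec_eq_smul_add]
  refine ((hf.smul_const (spec x 1 0)).add (hg.smul_const (spec x 0 1))).congr_fun ?_
  intro n
  exact spec_eq_smul_add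

lemma qexpTerm_spec (hr : 0 < radius x) (p : ℝ) (c : ℂ) (n : ℕ) :
    qexpTerm p (c • spec x a b) n =
      spec x ((qPoch (p : ℂ) p n)⁻¹ * (c * a) ^ n) ((qPoch (p : ℂ) p n)⁻¹ * (c * b) ^ n) := by
  rw [qexpTerm, smul_spec, spec_pow hr, smul_spec]

end Spec

/-! ### The argument of the `q`-exponential -/

/-- `i (1 - q) z ρ`. -/
def qArg (q z : ℝ) (ρ : ℂ) : ℂ := I * (((1 - q) * z : ℝ) : ℂ) * ρ

section QArg

variable {q z : ℝ} {ρ : ℂ}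

lemma norm_qArg_lt (hq1 : q < 1) (hz : |z| ≤ 1 / 2) (h : ‖ρ‖ < 2 / (1 - q)) :
    ‖qArg q z ρ‖ < 1 := by
  have h1 : 0 < 1 - q := by linarith
  rw [qArg, norm_mul, norm_mul, norm_I, one_mul, norm_real, Real.norm_eq_abs, abs_mul,
    abs_of_pos h1]
  rw [lt_div_iff₀ h1] at h
  nlinarith [norm_nonneg ρ, mul_le_mul_of_nonneg_left hz (mul_nonneg h1.le (norm_nonneg ρ))]

lemma qArg_mul (q z : ℝ) (ρ : ℂ) : qArg q (q * z) ρ = q * qArg q z ρ := by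
  simp only [qArg]; push_cast; ring

lemma qPochInf_qArg_half (q : ℝ) (ρ : ℂ) : qPochInf (qArg q (1 / 2) ρ) q = pFun q ρ := by
  rw [pFun, qArg]; congr 1; push_cast; ring

lemma qPochInf_qArg_neg_half (q : ℝ) (ρ : ℂ) : qPochInf (qArg q (-(1 / 2)) ρ) q = mFun q ρ := by
  rw [mFun, qArg]; congr 1; push_cast; ring

lemma abs_le_of_mem_qInterval (hq0 : 0 < q) (hq1 : q < 1) (hz : z ∈ qInterval q) :
    |z| ≤ 1 / 2 := by
  obtain ⟨n, rfl | rfl⟩ := hz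
  · rw [abs_of_pos (by positivity)]
    linarith [pow_le_one₀ (n := n) hq0.le hq1.le]
  · rw [abs_neg, abs_of_pos (by positivity)]
    linarith [pow_le_one₀ (n := n) hq0.le hq1.le]

lemma ne_zero_of_mem_qInterval (hq0 : 0 < q) (hz : z ∈ qInterval q) : z ≠ 0 := by
  obtain ⟨n, rfl | rfl⟩ := hz
  · positivity
  · exact neg_ne_zero.2 (by positivity)

lemma mul_mem_qInterval (hz : z ∈ qInterval q) : q * z ∈ qInterval q := by
  obtain ⟨n, rfl | rfl⟩ := hz
  · exact ⟨n + 1, Or.inl (by ring)⟩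
  · exact ⟨n + 1, Or.inr (by ring)⟩

lemma half_mul_pow_mem_qInterval (q : ℝ) (n : ℕ) : 1 / 2 * q ^ n ∈ qInterval q :=
  ⟨n, Or.inl (by ring)⟩

lemma neg_half_mul_pow_mem_qInterval (q : ℝ) (n : ℕ) : -(1 / 2) * q ^ n ∈ qInterval q :=
  ⟨n, Or.inr (by ring)⟩

lemma qPochInf_qArg_ne_zero (hq0 : 0 < q) (hq1 : q < 1) (hz : |z| ≤ 1 / 2)
    (h : ‖ρ‖ < 2 / (1 - q)) : qPochInf (qArg q z ρ) q ≠ 0 :=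
  qPochInf_ne_zero_of_norm_lt hq0 hq1 (norm_qArg_lt hq1 hz h)

end QArg

/-! ### Jackson integrals over `[-1/2, 1/2]` -/

section Jackson

variable {E : Type*} [AddCommGroup E] [Module ℂ E] [TopologicalSpace E]

/-- Both halves of the Jackson integral of `f` from `-1/2` to `1/2` converge, and its value
is `S`. -/
def HasJackson (q : ℝ) (f : ℝ → E) (S : E) : Prop :=
  ∃ s₁ s₂, HasSum (fun n : ℕ => ((1 / 2 * (1 - q) * q ^ n : ℝ) : ℂ) • f (1 / 2 * q ^ n)) s₁ ∧
    HasSum (fun n : ℕ => ((-(1 / 2) * (1 - q) * q ^ n : ℝ) : ℂ) • f (-(1 / 2) * q ^ n)) s₂ ∧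
    S = s₁ - s₂

variable {q : ℝ} {f g : ℝ → E} {S T : E}

lemma HasJackson.congr (h : ∀ z ∈ qInterval q, g z = f z) (hf : HasJackson q f S) :
    HasJackson q g S := by
  obtain ⟨s₁, s₂, h1, h2, hS⟩ := hf
  refine ⟨s₁, s₂, ?_, ?_, hS⟩
  · simpa only [h _ (half_mul_pow_mem_qInterval q _)] using h1
  · simpa only [h _ (neg_half_mul_pow_mem_qInterval q _)] using h2

lemma HasJackson.add [ContinuousAdd E] (hf : HasJackson q f S) (hg : HasJackson q g T) :
    HasJackson q (fun z => f z + g z) (S + T) := by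
  obtain ⟨s₁, s₂, h1, h2, rfl⟩ := hf
  obtain ⟨t₁, t₂, k1, k2, rfl⟩ := hg
  refine ⟨s₁ + t₁, s₂ + t₂, ?_, ?_, by abel⟩
  · simpa only [smul_add] using h1.add k1
  · simpa only [smul_add] using h2.add k2

lemma HasJackson.smul_const [ContinuousSMul ℂ E] {f : ℝ → ℂ} {S : ℂ} (hf : HasJackson q f S)
    (A : E) : HasJackson q (fun z => f z • A) (S • A) := by
  obtain ⟨s₁, s₂, h1, h2, rfl⟩ := hf
  refine ⟨s₁ • A, s₂ • A, ?_, ?_, sub_smul _ _ _⟩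
  · simpa only [smul_assoc] using h1.smul_const A
  · simpa only [smul_assoc] using h2.smul_const A

lemma HasJackson.const_mul {f : ℝ → ℂ} {S : ℂ} (hf : HasJackson q f S) (c : ℂ) :
    HasJackson q (fun z => c * f z) (c * S) := by
  simpa only [smul_eq_mul, mul_comm c] using hf.smul_const c

lemma HasJackson.sub {f g : ℝ → ℂ} {S T : ℂ} (hf : HasJackson q f S) (hg : HasJackson q g T) :
    HasJackson q (fun z => f z - g z) (S - T) := by
  simpa only [neg_one_mul, ← sub_eq_add_neg] using hf.add (hg.const_mul (-1))

lemma HasJackson.eval {f : ℝ → M2} {S : M2} (hf : HasJackson q f S) :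
    Summable (jacksonTerm q (1 / 2) f) ∧ Summable (jacksonTerm q (-(1 / 2)) f) ∧
      jackson q (1 / 2) f - jackson q (-(1 / 2)) f = S := by
  obtain ⟨s₁, s₂, h1, h2, rfl⟩ := hf
  exact ⟨h1.summable, h2.summable, congrArg₂ _ h1.tsum_eq h2.tsum_eq⟩

/-- The fundamental theorem for Jackson integrals. -/
lemma HasJackson.of_telescope {f K : ℝ → ℂ} (hq0 : 0 < q) (hq1 : q < 1)
    (h : ∀ z ∈ qInterval q, (((1 - q) * z : ℝ) : ℂ) * f z = K z - K (q * z))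
    (hK : ContinuousAt K 0)
    (hs : ∀ a : ℝ, (a = 1 / 2 ∨ a = -(1 / 2)) →
      Summable fun n : ℕ => ((a * (1 - q) * q ^ n : ℝ) : ℂ) * f (a * q ^ n)) :
    HasJackson q f (K (1 / 2) - K (-(1 / 2))) := by
  have key : ∀ a : ℝ, (a = 1 / 2 ∨ a = -(1 / 2)) →
      HasSum (fun n : ℕ => ((a * (1 - q) * q ^ n : ℝ) : ℂ) * f (a * q ^ n)) (K a - K 0) := by
    intro a ha
    refine (hs a ha).hasSum_iff_tendsto_nat.2 ?_
    have hmem : ∀ n : ℕ, a * q ^ n ∈ qInterval q := by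
      rcases ha with rfl | rfl
      · exact half_mul_pow_mem_qInterval q
      · exact neg_half_mul_pow_mem_qInterval q
    have : ∀ n : ℕ, ∑ k ∈ Finset.range n, ((a * (1 - q) * q ^ k : ℝ) : ℂ) * f (a * q ^ k) =
        K a - K (a * q ^ n) := fun n => by
      induction n with
      | zero => simp
      | succ n ih =>
        have h' := h _ (hmem n)
        rw [Finset.sum_range_succ, ih, show a * (1 - q) * q ^ n = (1 - q) * (a * q ^ n) by ring, h',
          show q * (a * q ^ n) = a * q ^ (n + 1) by ring]
        ring
    simp only [this]
    have hl : Tendsto (fun n : ℕ => a * q ^ n) atTop (𝓝 0) := by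
      simpa using (tendsto_pow_atTop_nhds_zero_of_lt_one hq0.le hq1).const_mul a
    exact (hK.tendsto.comp hl).const_sub _
  -- The limit K 0 of both halves drops out of their difference.
  exact ⟨_, _, key _ (Or.inl rfl), key _ (Or.inr rfl), by ring⟩

/-- Bounded functions on the `q`-interval are Jackson integrable. -/
lemma summable_jackson_of_bounded (hq0 : 0 < q) (hq1 : q < 1) {f : ℝ → ℂ} {C : ℝ}
    (h : ∀ z ∈ qInterval q, ‖f z‖ ≤ C) (a : ℝ) (ha : a = 1 / 2 ∨ a = -(1 / 2)) :
    Summable fun n : ℕ => ((a * (1 - q) * q ^ n : ℝ) : ℂ) * f (a * q ^ n) := by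
  have hmem : ∀ n : ℕ, a * q ^ n ∈ qInterval q := by
    rcases ha with rfl | rfl
    · exact half_mul_pow_mem_qInterval q
    · exact neg_half_mul_pow_mem_qInterval q
  refine Summable.of_norm_bounded
    ((summable_geometric_of_lt_one hq0.le hq1).mul_left (|a * (1 - q)| * C)) fun n => ?_
  rw [norm_mul, norm_real, Real.norm_eq_abs, abs_mul, abs_of_pos (pow_pos hq0 n)]
  have := mul_le_mul_of_nonneg_left (h _ (hmem n))
    (mul_nonneg (abs_nonneg (a * (1 - q))) (pow_nonneg hq0.le n))
  linarith

/-- Functions that are continuous on `[-1/2, 1/2]` are Jackson integrable. -/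
lemma summable_jackson_of_continuousOn (hq0 : 0 < q) (hq1 : q < 1) {f : ℝ → ℂ}
    (h : ContinuousOn f (Icc (-(1 / 2)) (1 / 2))) (a : ℝ) (ha : a = 1 / 2 ∨ a = -(1 / 2)) :
    Summable fun n : ℕ => ((a * (1 - q) * q ^ n : ℝ) : ℂ) * f (a * q ^ n) := by
  obtain ⟨C, hC⟩ := isCompact_Icc.exists_bound_of_continuousOn h
  exact summable_jackson_of_bounded hq0 hq1
    (fun z hz => hC z (abs_le.1 (abs_le_of_mem_qInterval hq0 hq1 hz))) a ha

end Jackson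

/-! ### Jackson integrals of products of q-exponentials -/

section Integrals

variable {q z : ℝ} {ρ ρ' : ℂ}

lemma qPochInf_qArg_eq (hq0 : 0 < q) (hq1 : q < 1) (z : ℝ) (ρ : ℂ) :
    qPochInf (qArg q z ρ) q = (1 - qArg q z ρ) * qPochInf (qArg q (q * z) ρ) q := by
  rw [qPochInf_eq hq0 hq1, qArg_mul]

lemma one_sub_qArg_ne_zero (hq1 : q < 1) (hz : |z| ≤ 1 / 2) (h : ‖ρ‖ < 2 / (1 - q)) :
    1 - qArg q z ρ ≠ 0 := one_sub_ne_zero_of_norm_lt (norm_qArg_lt hq1 hz h)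

lemma continuous_qPochInf_qArg (hq0 : 0 < q) (hq1 : q < 1) (ρ : ℂ) :
    Continuous fun z : ℝ => qPochInf (qArg q z ρ) q :=
  (differentiable_qPochInf hq0 hq1).continuous.comp (by unfold qArg; fun_prop)

/-- The kernel whose `q`-difference quotient is the integrand of `L`. -/
def lKernel (q z : ℝ) (ρ' ρ : ℂ) : ℂ :=
  qPochInf (qArg q z ρ') q * (qPochInf (qArg q z ρ) q)⁻¹ / (I * (ρ - ρ'))

/-- `L⁺` and `L⁻` as functions of two independent complex variables. -/
def lPair (q : ℝ) (ρ' ρ : ℂ) : ℂ := lKernel q (1 / 2) ρ' ρ - lKernel q (-(1 / 2)) ρ' ρ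

/-- Let w and w' be i(1-q)z times ρ and ρ'. Going from qz to z multiplies the quotient of products
by (1 - w')/(1 - w), and (1 - w')/(1 - w) - 1 = (w - w')/(1 - w) with w - w' = i(1-q)z(ρ - ρ'). -/
lemma lKernel_sub (hq0 : 0 < q) (hq1 : q < 1) (hz : |z| ≤ 1 / 2) (h : ‖ρ‖ < 2 / (1 - q))
    (hne : ρ - ρ' ≠ 0) :
    (((1 - q) * z : ℝ) : ℂ) * (qPochInf (qArg q (q * z) ρ') q * (qPochInf (qArg q z ρ) q)⁻¹) =
      lKernel q z ρ' ρ - lKernel q (q * z) ρ' ρ := by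
  have h1 := one_sub_qArg_ne_zero hq1 hz h
  have h2 := qPochInf_qArg_ne_zero hq0 hq1 hz h
  have e := qPochInf_qArg_eq hq0 hq1 z ρ
  have h3 : qPochInf (qArg q (q * z) ρ) q ≠ 0 := fun h0 => h2 (by rw [e, h0, mul_zero])
  rw [lKernel, lKernel, qPochInf_qArg_eq hq0 hq1 z ρ', e]
  have e3 : I * (((1 - q) * z : ℝ) : ℂ) * (ρ - ρ') = qArg q z ρ - qArg q z ρ' := by
    simp only [qArg]; ring
  generalize qPochInf (qArg q (q * z) ρ) q = A at *
  generalize qPochInf (qArg q (q * z) ρ') q = B at *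
  field_simp
  linear_combination B * e3

/-- The `ρ`-derivative of the `q`-exponential. -/
def qexpDeriv (q z : ℝ) (ρ : ℂ) : ℂ :=
  -(I * (((1 - q) * z : ℝ) : ℂ) * deriv (fun a => qPochInf a q) (qArg q z ρ)) /
      qPochInf (qArg q z ρ) q ^ 2

/-- The `ρ`-derivative of `lKernel`. -/
def lKernelDeriv (q z : ℝ) (ρ' ρ : ℂ) : ℂ :=
  qPochInf (qArg q z ρ') q *
    (qexpDeriv q z ρ / (I * (ρ - ρ')) - (qPochInf (qArg q z ρ) q)⁻¹ * I / (I * (ρ - ρ')) ^ 2)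

lemma hasDerivAt_qexp (hq0 : 0 < q) (hq1 : q < 1) (hz : |z| ≤ 1 / 2) (h : ‖ρ‖ < 2 / (1 - q)) :
    HasDerivAt (fun ρ => (qPochInf (qArg q z ρ) q)⁻¹) (qexpDeriv q z ρ) ρ := by
  have h1 : HasDerivAt (qArg q z) (I * (((1 - q) * z : ℝ) : ℂ)) ρ := by
    exact ((hasDerivAt_id' ρ).const_mul (I * (((1 - q) * z : ℝ) : ℂ))).congr_deriv (mul_one _)
  have h2 := ((differentiable_qPochInf hq0 hq1 (qArg q z ρ)).hasDerivAt.comp ρ h1).fun_inv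
    (qPochInf_qArg_ne_zero hq0 hq1 hz h)
  refine h2.congr_deriv ?_
  rw [qexpDeriv, mul_comm (deriv _ _)]
  rfl

lemma hasDerivAt_lKernel (hq0 : 0 < q) (hq1 : q < 1) (hz : |z| ≤ 1 / 2) (h : ‖ρ‖ < 2 / (1 - q))
    (hne : ρ - ρ' ≠ 0) :
    HasDerivAt (lKernel q z ρ') (lKernelDeriv q z ρ' ρ) ρ := by
  have h1 : HasDerivAt (fun ρ => I * (ρ - ρ')) I ρ := by
    simpa using ((hasDerivAt_id ρ).sub_const ρ').const_mul I
  refine ((((hasDerivAt_qexp hq0 hq1 hz h).const_mul (qPochInf (qArg q z ρ') q)).fun_div h1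
    (mul_ne_zero I_ne_zero hne))).congr_deriv ?_
  rw [lKernelDeriv]
  have := mul_ne_zero I_ne_zero hne
  generalize I * (ρ - ρ') = d at *
  field_simp

lemma isOpen_sub_ne (ρ' : ℂ) : IsOpen {ρ : ℂ | ρ - ρ' ≠ 0} :=
  isOpen_ne_fun (by fun_prop) continuous_const

/-- Differentiating the telescoping identity in ρ makes the derivative of the integrand telescope
too, so no interchange of derivative and sum is required later. -/
lemma lKernelDeriv_sub (hq0 : 0 < q) (hq1 : q < 1) (hz : |z| ≤ 1 / 2) (h : ‖ρ‖ < 2 / (1 - q))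
    (hne : ρ - ρ' ≠ 0) :
    (((1 - q) * z : ℝ) : ℂ) * (qPochInf (qArg q (q * z) ρ') q * qexpDeriv q z ρ) =
      lKernelDeriv q z ρ' ρ - lKernelDeriv q (q * z) ρ' ρ := by
  have hqz : |q * z| ≤ 1 / 2 := by
    rw [abs_mul, abs_of_pos hq0]
    exact (mul_le_of_le_one_left (abs_nonneg z) hq1.le).trans hz
  have h1 := ((hasDerivAt_qexp hq0 hq1 hz h).const_mul
    (qPochInf (qArg q (q * z) ρ') q)).const_mul (((1 - q) * z : ℝ) : ℂ)
  have h2 := (hasDerivAt_lKernel hq0 hq1 hz h hne).fun_sub (hasDerivAt_lKernel hq0 hq1 hqz h hne)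
  refine (h1.congr_of_eventuallyEq ?_).unique h2
  have o1 : IsOpen {ρ : ℂ | ‖ρ‖ < 2 / (1 - q)} := isOpen_lt continuous_norm continuous_const
  filter_upwards [o1.mem_nhds h, (isOpen_sub_ne ρ').mem_nhds hne] with w hw hw'
  exact (lKernel_sub hq0 hq1 hz hw hw').symm

lemma continuousOn_qexp (hq0 : 0 < q) (hq1 : q < 1) (h : ‖ρ‖ < 2 / (1 - q)) :
    ContinuousOn (fun z : ℝ => (qPochInf (qArg q z ρ) q)⁻¹) (Icc (-(1 / 2)) (1 / 2)) :=
  (continuous_qPochInf_qArg hq0 hq1 ρ).continuousOn.inv₀ fun _ hz =>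
    qPochInf_qArg_ne_zero hq0 hq1 (abs_le.2 hz) h

lemma continuousOn_qexpDeriv (hq0 : 0 < q) (hq1 : q < 1) (h : ‖ρ‖ < 2 / (1 - q)) :
    ContinuousOn (fun z : ℝ => qexpDeriv q z ρ) (Icc (-(1 / 2)) (1 / 2)) := by
  have hc : Continuous (deriv fun a => qPochInf a q) :=
    ((differentiable_qPochInf hq0 hq1).contDiff (n := 1)).continuous_deriv le_rfl
  have ha : Continuous fun z : ℝ => qArg q z ρ := by unfold qArg; fun_prop
  refine ContinuousOn.div (Continuous.continuousOn ?_)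
    ((continuous_qPochInf_qArg hq0 hq1 ρ).pow 2).continuousOn fun z hz =>
      pow_ne_zero 2 (qPochInf_qArg_ne_zero hq0 hq1 (abs_le.2 hz) h)
  have := hc.comp ha
  fun_prop

lemma continuousAt_lKernelDeriv (hq0 : 0 < q) (hq1 : q < 1) (h : ‖ρ‖ < 2 / (1 - q)) :
    ContinuousAt (fun z : ℝ => lKernelDeriv q z ρ' ρ) 0 := by
  have hn : Icc (-(1 / 2) : ℝ) (1 / 2) ∈ 𝓝 0 := Icc_mem_nhds (by norm_num) (by norm_num)
  exact (continuous_qPochInf_qArg hq0 hq1 ρ').continuousAt.mul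
    ((((continuousOn_qexpDeriv hq0 hq1 h).continuousAt hn).div_const _).sub
      ((((continuousOn_qexp hq0 hq1 h).continuousAt hn).mul_const I).div_const _))

lemma continuousAt_lKernel (hq0 : 0 < q) (hq1 : q < 1) (h : ‖ρ‖ < 2 / (1 - q)) :
    ContinuousAt (fun z : ℝ => lKernel q z ρ' ρ) 0 := by
  have hn : Icc (-(1 / 2) : ℝ) (1 / 2) ∈ 𝓝 0 := Icc_mem_nhds (by norm_num) (by norm_num)
  exact ((continuous_qPochInf_qArg hq0 hq1 ρ').continuousAt.mul
    ((continuousOn_qexp hq0 hq1 h).continuousAt hn)).div_const _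

lemma continuous_qPochInf_qArg_mul (hq0 : 0 < q) (hq1 : q < 1) (ρ : ℂ) :
    Continuous fun z : ℝ => qPochInf (qArg q (q * z) ρ) q :=
  (continuous_qPochInf_qArg hq0 hq1 ρ).comp (continuous_const_mul q)

lemma continuousOn_integrand (hq0 : 0 < q) (hq1 : q < 1) {f : ℝ → ℂ}
    (hf : ContinuousOn f (Icc (-(1 / 2)) (1 / 2))) (ρ : ℂ) :
    ContinuousOn (fun z : ℝ => qPochInf (qArg q (q * z) ρ) q * f z) (Icc (-(1 / 2)) (1 / 2)) :=
  (continuous_qPochInf_qArg_mul hq0 hq1 ρ).continuousOn.mul hf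

lemma hasJackson_lPair (hq0 : 0 < q) (hq1 : q < 1) (h : ‖ρ‖ < 2 / (1 - q)) (hne : ρ - ρ' ≠ 0) :
    HasJackson q (fun z => qPochInf (qArg q (q * z) ρ') q * (qPochInf (qArg q z ρ) q)⁻¹)
      (lPair q ρ' ρ) := by
  unfold lPair
  have hs := summable_jackson_of_continuousOn hq0 hq1
    (continuousOn_integrand hq0 hq1 (continuousOn_qexp hq0 hq1 h) ρ')
  have hK := continuousAt_lKernel (ρ' := ρ') hq0 hq1 h
  have ht := fun z hz => lKernel_sub hq0 hq1 (z := z) (abs_le_of_mem_qInterval hq0 hq1 hz) h hne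
  have key := HasJackson.of_telescope hq0 hq1 ht hK hs
  exact key

lemma hasDerivAt_lPair (hq0 : 0 < q) (hq1 : q < 1) (h : ‖ρ‖ < 2 / (1 - q)) (hne : ρ - ρ' ≠ 0) :
    HasDerivAt (lPair q ρ') (lKernelDeriv q (1 / 2) ρ' ρ - lKernelDeriv q (-(1 / 2)) ρ' ρ) ρ :=
  (hasDerivAt_lKernel hq0 hq1 (by norm_num [abs_of_pos]) h hne).fun_sub
    (hasDerivAt_lKernel hq0 hq1 (by norm_num [abs_of_pos]) h hne)

lemma hasJackson_deriv_lPair (hq0 : 0 < q) (hq1 : q < 1) (h : ‖ρ‖ < 2 / (1 - q))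
    (hne : ρ - ρ' ≠ 0) :
    HasJackson q (fun z => qPochInf (qArg q (q * z) ρ') q * qexpDeriv q z ρ)
      (deriv (lPair q ρ') ρ) := by
  rw [(hasDerivAt_lPair hq0 hq1 h hne).deriv]
  have hs := summable_jackson_of_continuousOn hq0 hq1
    (continuousOn_integrand hq0 hq1 (continuousOn_qexpDeriv hq0 hq1 h) ρ')
  have hK := continuousAt_lKernelDeriv (ρ' := ρ') hq0 hq1 h
  have ht := fun z hz => lKernelDeriv_sub hq0 hq1 (z := z)
    (abs_le_of_mem_qInterval hq0 hq1 hz) h hne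
  have key := HasJackson.of_telescope hq0 hq1 ht hK hs
  exact key

/-- For equal parameters the kernel degenerates, but the integrand is 1/(1 - w). The contributions
of z and -z combine to a multiple of 1/(1 - w²), which gives the partial fractions of M. -/
lemma hasJackson_MFun (hq0 : 0 < q) (hq1 : q < 1) (h : ‖ρ‖ < 2 / (1 - q)) :
    HasJackson q (fun z => qPochInf (qArg q (q * z) ρ) q * (qPochInf (qArg q z ρ) q)⁻¹)
      (MFun q ρ) := by
  have hs := summable_jackson_of_continuousOn hq0 hq1
    (continuousOn_integrand hq0 hq1 (continuousOn_qexp hq0 hq1 h) ρ)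
  have h1 := hs _ (Or.inl rfl)
  have h2 := hs _ (Or.inr rfl)
  refine ⟨_, _, h1.hasSum, h2.hasSum, ((h1.hasSum.sub h2.hasSum).unique ?_).symm⟩
  have e : ∀ z : ℝ, |z| ≤ 1 / 2 →
      qPochInf (qArg q (q * z) ρ) q * (qPochInf (qArg q z ρ) q)⁻¹ = (1 - qArg q z ρ)⁻¹ := by
    intro z hz
    have h3 := qPochInf_qArg_ne_zero hq0 hq1 hz h
    have h4 := one_sub_qArg_ne_zero hq1 hz h
    refine eq_inv_of_mul_eq_one_left ?_
    rw [mul_right_comm, mul_comm _ (1 - _), ← qPochInf_qArg_eq hq0 hq1, mul_inv_cancel₀ h3]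
  refine (hasSum_MFun hq0 hq1 h).congr_fun fun n => ?_
  have m1 := abs_le_of_mem_qInterval hq0 hq1 (half_mul_pow_mem_qInterval q n)
  have m2 := abs_le_of_mem_qInterval hq0 hq1 (neg_half_mul_pow_mem_qInterval q n)
  rw [e _ m1, e _ m2]
  have n1 := one_sub_qArg_ne_zero hq1 m1 h
  have n2 := one_sub_qArg_ne_zero hq1 m2 h
  have n3 := one_add_sq_ne_zero hq1 (norm_scale_lt hq0 hq1 h n)
  have e1 : qArg q (-(1 / 2) * q ^ n) ρ = -qArg q (1 / 2 * q ^ n) ρ := by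
    simp only [qArg]; push_cast; ring
  have e2 : 1 + ((1 - q) / 2 * ((q : ℂ) ^ n * ρ)) ^ 2 =
      (1 - qArg q (1 / 2 * q ^ n) ρ) * (1 - qArg q (-(1 / 2) * q ^ n) ρ) := by
    simp only [qArg]; push_cast
    linear_combination (((1 - q) / 2 * ((q : ℂ) ^ n * ρ)) ^ 2) * I_sq
  rw [e2]
  rw [e1] at n2 ⊢
  push_cast
  generalize qArg q (1 / 2 * q ^ n) ρ = w at *
  field_simp
  ring

end Integrals

/-! ### `L⁺` and `L⁻` as functions of two independent variables -/

/-- Since ρ₊ and ρ₋ are annihilated by ∂₋ and ∂₊ respectively, these operators differentiate a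
holomorphic function of the pair slot by slot. -/
lemma hasWirtingerAt_prod {f : ℂ × ℂ → ℂ} {t r : ℝ}
    (hf : DifferentiableAt ℂ f (rhoP t r, rhoM t r)) :
    HasWirtingerAt (fun t r => f (rhoP t r, rhoM t r))
      (deriv (fun w => f (w, rhoM t r)) (rhoP t r))
      (deriv (fun w => f (rhoP t r, w)) (rhoM t r)) t r := by
  set L := fderiv ℂ f (rhoP t r, rhoM t r) with hL
  have d1 : deriv (fun w => f (w, rhoM t r)) (rhoP t r) = L (1, 0) :=
    (HasFDerivAt.comp_hasDerivAt (rhoP t r) hf.hasFDerivAt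
      ((hasDerivAt_id (rhoP t r)).prodMk (hasDerivAt_const (rhoP t r) (rhoM t r)))).deriv
  have d2 : deriv (fun w => f (rhoP t r, w)) (rhoM t r) = L (0, 1) :=
    (HasFDerivAt.comp_hasDerivAt (rhoM t r) hf.hasFDerivAt
      ((hasDerivAt_const (rhoM t r) (rhoP t r)).prodMk (hasDerivAt_id (rhoM t r)))).deriv
  have hR := hf.hasFDerivAt.restrictScalars ℝ
  have p := hasWirtingerAt_rhoP (hasDerivAt_id' (rhoP t r))
  have m := hasWirtingerAt_rhoM (hasDerivAt_id' (rhoM t r))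
  rw [d1, d2]
  refine ⟨(hR.comp_hasDerivAt t (p.1.prodMk m.1)).congr_deriv ?_,
    (hR.comp_hasDerivAt r (p.2.prodMk m.2)).congr_deriv ?_⟩
  · rw [← map_add]
    simp [L]
  · rw [← map_sub, ← smul_eq_mul (a := I) (b := L _), ← map_smul]
    simp [L]

section Pair

variable {q t r : ℝ} {ρ ρ' : ℂ}

lemma lPair_eq (q : ℝ) (ρ' ρ : ℂ) :
    lPair q ρ' ρ = (pFun q ρ' * (pFun q ρ)⁻¹ - mFun q ρ' * (mFun q ρ)⁻¹) / (I * (ρ - ρ')) := by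
  rw [lPair, lKernel, lKernel, qPochInf_qArg_half, qPochInf_qArg_half, qPochInf_qArg_neg_half,
    qPochInf_qArg_neg_half, sub_div]

lemma differentiableAt_lPair (hq0 : 0 < q) (hq1 : q < 1) (h : ‖ρ‖ < 2 / (1 - q))
    (hne : ρ - ρ' ≠ 0) : DifferentiableAt ℂ (fun w : ℂ × ℂ => lPair q w.1 w.2) (ρ', ρ) := by
  have p1 : DifferentiableAt ℂ (fun w : ℂ × ℂ => pFun q w.1) (ρ', ρ) :=
    (differentiable_pFun hq0 hq1).comp differentiable_fst _
  have m1 : DifferentiableAt ℂ (fun w : ℂ × ℂ => mFun q w.1) (ρ', ρ) :=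
    (differentiable_mFun hq0 hq1).comp differentiable_fst _
  have p2 : DifferentiableAt ℂ (fun w : ℂ × ℂ => (pFun q w.2)⁻¹) (ρ', ρ) :=
    DifferentiableAt.fun_inv ((differentiable_pFun hq0 hq1).comp differentiable_snd _)
      (pFun_ne_zero hq0 hq1 h)
  have m2 : DifferentiableAt ℂ (fun w : ℂ × ℂ => (mFun q w.2)⁻¹) (ρ', ρ) :=
    DifferentiableAt.fun_inv ((differentiable_mFun hq0 hq1).comp differentiable_snd _)
      (mFun_ne_zero hq0 hq1 h)
  have d : DifferentiableAt ℂ (fun w : ℂ × ℂ => (I * (w.2 - w.1))⁻¹) (ρ', ρ) :=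
    DifferentiableAt.fun_inv (by fun_prop) (mul_ne_zero I_ne_zero hne)
  simp only [lPair_eq, div_eq_mul_inv]
  exact ((p1.mul p2).sub (m1.mul m2)).mul d

/-- The boundary terms of the telescoped integral agree with the closed form supplied by the
`q`-binomial theorem. -/
lemma LP_eq_lPair (hq0 : 0 < q) (hq1 : q < 1) (h : (t, r) ∈ halfDisc q) :
    LP q t r = lPair q (rhoP t r) (rhoM t r) := by
  have h1 := pFun_ne_zero hq0 hq1 (norm_rhoM_lt hq1 h)
  have h2 := mFun_ne_zero hq0 hq1 (norm_rhoM_lt hq1 h)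
  have hd := rhoP_ne_rhoM (t := t) h.1
  have hd' : rhoM t r - rhoP t r ≠ 0 := sub_ne_zero.2 (sub_ne_zero.1 hd).symm
  rw [LP_eq hq0 hq1 h, lPair_eq, wFun, hFun]
  rw [← neg_sub (rhoP t r)] at hd' ⊢
  field_simp
  ring

lemma LM_eq_lPair (hq0 : 0 < q) (hq1 : q < 1) (h : (t, r) ∈ halfDisc q) :
    LM q t r = lPair q (rhoM t r) (rhoP t r) := by
  have h1 := pFun_ne_zero hq0 hq1 (norm_rhoP_lt hq1 h)
  have h2 := mFun_ne_zero hq0 hq1 (norm_rhoP_lt hq1 h)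
  have hd := rhoP_ne_rhoM (t := t) h.1
  rw [LM_eq hq0 hq1 h, lPair_eq, wFun, hFun]
  field_simp

/-- The derivative of `L⁺` in `ρ₋` is the one with respect to its second variable. -/
lemma exists_hasWirtingerAt_LP_lPair (hq0 : 0 < q) (hq1 : q < 1) (h : (t, r) ∈ halfDisc q) :
    ∃ a, HasWirtingerAt (LP q) a (deriv (lPair q (rhoP t r)) (rhoM t r)) t r := by
  have hd' : rhoM t r - rhoP t r ≠ 0 := sub_ne_zero.2 (sub_ne_zero.1 (rhoP_ne_rhoM h.1)).symm
  exact ⟨_, (hasWirtingerAt_prod (f := fun w => lPair q w.1 w.2) (differentiableAt_lPair hq0 hq1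
    (norm_rhoM_lt hq1 h) hd')).congr (isOpen_halfDisc q) (fun z hz => LP_eq_lPair hq0 hq1 hz) h⟩

/-- The derivative of `L⁻` in `ρ₊` is the one with respect to its second variable. -/
lemma exists_hasWirtingerAt_LM_lPair (hq0 : 0 < q) (hq1 : q < 1) (h : (t, r) ∈ halfDisc q) :
    ∃ b, HasWirtingerAt (LM q) (deriv (lPair q (rhoM t r)) (rhoP t r)) b t r := by
  have hd := differentiableAt_lPair hq0 hq1 (norm_rhoP_lt hq1 h) (rhoP_ne_rhoM (t := t) h.1)
  have hs : DifferentiableAt ℂ (fun w : ℂ × ℂ => lPair q w.2 w.1) (rhoP t r, rhoM t r) :=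
    DifferentiableAt.comp (rhoP t r, rhoM t r) (f := Prod.swap)
      (g := fun w : ℂ × ℂ => lPair q w.1 w.2) hd
      (differentiable_snd.prodMk differentiable_fst _)
  exact ⟨_, (hasWirtingerAt_prod hs).congr (isOpen_halfDisc q)
    (fun z hz => LM_eq_lPair hq0 hq1 hz) h⟩

end Pair

/-! ### Branches of the inverse square root -/

/-- Near z a continuous branch is n(z) times the principal square root of (L n(z)²)⁻¹, a quantity
close to 1. Continuity keeps n/n(z) in the right half plane, so the principal root is the right one.
-/
lemma differentiableAt_of_sq_mul_eq_one {E : Type*} [NormedAddCommGroup E] [NormedSpace ℝ E]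
    {n L : E → ℂ} {V : Set E} (hV : IsOpen V) (hn : ContinuousOn n V)
    (h : ∀ z ∈ V, n z ^ 2 * L z = 1) {z : E} (hz : z ∈ V) (hL : DifferentiableAt ℝ L z) :
    DifferentiableAt ℝ n z := by
  have hn0 : n z ≠ 0 := fun h0 => by simpa [h0] using h z hz
  have hs1 : (L z * n z ^ 2)⁻¹ = 1 := by rw [mul_comm, h z hz, inv_one]
  have hs : DifferentiableAt ℝ (fun w => (L w * n z ^ 2)⁻¹) z :=
    (hL.mul_const _).fun_inv (by rw [mul_comm, h z hz]; exact one_ne_zero)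
  have hpow : DifferentiableAt ℝ (fun u : ℂ => u ^ (2⁻¹ : ℂ)) ((L z * n z ^ 2)⁻¹) := by
    rw [hs1]
    exact ((hasDerivAt_id (1 : ℂ)).cpow_const (by simp)).differentiableAt.restrictScalars ℝ
  have hcomp := (DifferentiableAt.comp z hpow hs).const_mul (n z)
  refine hcomp.congr_of_eventuallyEq ?_
  have hre : ∀ᶠ w in 𝓝 z, 0 < (n w / n z).re := by
    have hc : ContinuousAt (fun w => (n w / n z).re) z :=
      continuous_re.continuousAt.comp ((hn.continuousAt (hV.mem_nhds hz)).div_const _)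
    refine hc.eventually (lt_mem_nhds ?_)
    simp only [div_self hn0, one_re]
    exact one_pos
  filter_upwards [hre, hV.mem_nhds hz] with w hw hwV
  have e : (L w * n z ^ 2)⁻¹ = (n w / n z) ^ 2 := by
    rw [div_pow, mul_inv, ← eq_inv_of_mul_eq_one_left (h w hwV)]
    rfl
  simp only [Function.comp_apply]
  rw [e, sq_cpow_two_inv hw, mul_div_cancel₀ _ hn0]

/-- Differentiate n²L = 1 and replace n² by 1/L; the result no longer depends on the branch. -/
lemma deriv_of_sq_mul_eq_one {n L : ℝ → ℂ} {n' L' : ℂ} {s : ℝ} (hn : HasDerivAt n n' s)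
    (hL : HasDerivAt L L' s) (h : ∀ᶠ y in 𝓝 s, n y ^ 2 * L y = 1) :
    n s * n' * L s = -(1 / 2) * (L' / L s) := by
  have h1 := ((hn.fun_pow 2).fun_mul hL).congr_of_eventuallyEq
    (f₁ := fun _ => 1) (h.mono fun y hy => hy.symm)
  have h2 := h1.unique (hasDerivAt_const s (1 : ℂ))
  have h3 := h.self_of_nhds
  have hL0 : L s ≠ 0 := fun h0 => by simp [h0] at h3
  have h4 : n s ^ 2 = (L s)⁻¹ := eq_inv_of_mul_eq_one_left h3
  rw [h4] at h2
  push_cast at h2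
  linear_combination (1 / 2) * h2

/-! ### Derivatives of functions of `x̂` -/

section SpecDeriv

variable {x : Spacetime} {F G : ℝ → ℝ → ℂ}

/-- The partial derivative `∂F/∂x_μ` of a function of `(t, r)`. -/
def dRad (F : ℝ → ℝ → ℂ) (x : Spacetime) (μ : Fin 4) : ℂ :=
  gradT μ * dT F (x 0) (radius x) + gradR x μ * dR F (x 0) (radius x)

lemma hasDerivAt_spec (hr : 0 < radius x)
    (hF : DifferentiableAt ℝ (fun z : ℝ × ℝ => F z.1 z.2) (x 0, radius x))
    (hG : DifferentiableAt ℝ (fun z : ℝ × ℝ => G z.1 z.2) (x 0, radius x))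
    (μ : Fin 4) (i j : Fin 2) :
    HasDerivAt (fun s => spec (Function.update x μ s)
        (F (Function.update x μ s 0) (radius (Function.update x μ s)))
        (G (Function.update x μ s 0) (radius (Function.update x μ s))) i j)
      ((spec x (dRad F x μ) (dRad G x μ) +
        ((F (x 0) (radius x) - G (x 0) (radius x)) / 2) • dxhat x μ) i j) (x μ) := by
  have hf := hasDerivAt_radial hr hF μ
  have hg := hasDerivAt_radial hr hG μ
  have hx := hasDerivAt_xhat hr μ i j
  simp only [spec, Matrix.add_apply, Matrix.smul_apply, smul_eq_mul]
  refine ((((hf.fun_add hg).div_const 2).mul_const ((1 : M2) i j)).fun_add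
    (((hf.fun_sub hg).div_const 2).fun_mul hx)).congr_deriv ?_
  simp only [Function.update_eq_self, dRad, real_smul]
  ring

lemma differentiableAt_radial {E : Type*} [NormedAddCommGroup E] [NormedSpace ℝ E]
    {F : ℝ → ℝ → E} (hr : 0 < radius x)
    (hF : DifferentiableAt ℝ (fun z : ℝ × ℝ => F z.1 z.2) (x 0, radius x)) :
    DifferentiableAt ℝ (fun y : Spacetime => F (y 0) (radius y)) x :=
  DifferentiableAt.comp x (g := fun z : ℝ × ℝ => F z.1 z.2)
    (f := fun y : Spacetime => (y 0, radius y)) hF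
    ((differentiableAt_apply 0 x).prodMk
      ((contDiffAt_radius (n := 1) hr).differentiableAt one_ne_zero))

lemma differentiableAt_xhat (hr : 0 < radius x) (i j : Fin 2) :
    DifferentiableAt ℝ (fun y => xhat y i j) x := by
  have hR := (contDiffAt_radius (n := 1) hr).differentiableAt one_ne_zero
  have hinv : DifferentiableAt ℝ (fun y => (radius y)⁻¹) x := hR.fun_inv hr.ne'
  have hc : ∀ a : Fin 4, DifferentiableAt ℝ (fun y : Spacetime => y a) x := fun a =>
    differentiableAt_apply a x
  simp only [xhat, Matrix.sum_apply, Matrix.smul_apply, smul_eq_mul, div_eq_mul_inv]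
  exact DifferentiableAt.fun_sum fun a _ =>
    (ofRealCLM.differentiableAt.comp x ((hc a.succ).mul hinv)).mul_const _

lemma differentiableAt_spec (hr : 0 < radius x)
    (hF : DifferentiableAt ℝ (fun z : ℝ × ℝ => F z.1 z.2) (x 0, radius x))
    (hG : DifferentiableAt ℝ (fun z : ℝ × ℝ => G z.1 z.2) (x 0, radius x)) (i j : Fin 2) :
    DifferentiableAt ℝ (fun y : Spacetime =>
      spec y (F (y 0) (radius y)) (G (y 0) (radius y)) i j) x := by
  have hf := differentiableAt_radial hr hF
  have hg := differentiableAt_radial hr hG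
  have hx := differentiableAt_xhat hr i j
  simp only [spec, Matrix.add_apply, Matrix.smul_apply, smul_eq_mul, div_eq_mul_inv]
  exact (((hf.add hg).mul_const _).mul_const _).add (((hf.sub hg).mul_const _).mul hx)

lemma dxhat_zero (x : Spacetime) : dxhat x 0 = 0 := by
  simp [dxhat, gradR, Fin.succ_ne_zero]

/-- The symmetric part of the product of Pauli matrices drops out because a unit vector is
orthogonal to its differential; the antisymmetric part carries iε. This produces the g_A term. -/
lemma xhat_mul_dxhat (hr : 0 < radius x) (j : Fin 3) :
    xhat x * dxhat x j.succ = I • ∑ i : Fin 3, ∑ k : Fin 3,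
      ((epsilon i j k * (x i.succ / radius x ^ 2) : ℝ) : ℂ) • pauli k := by
  have hrc : (radius x : ℂ) ≠ 0 := by exact_mod_cast hr.ne'
  have h2 : (radius x : ℂ) ^ 2 = x 1 ^ 2 + x 2 ^ 2 + x 3 ^ 2 := by exact_mod_cast radius_sq x
  ext a b
  fin_cases j <;> fin_cases a <;> fin_cases b <;>
    simp [xhat, dxhat, gradR, pauli, Fin.sum_univ_three, Matrix.mul_apply, Fin.sum_univ_two,
      epsilon] <;>
    field_simp <;> ring_nf <;> simp only [I_sq, h2] <;> ring

end SpecDeriv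

/-! ### The solution `v` in closed form -/

section Solution

variable {q z : ℝ} {np nm : ℝ → ℝ → ℝ → ℂ} {x : Spacetime}

lemma hasSum_qexpTerm (hq0 : 0 < q) (hq1 : q < 1) (hx : x ∈ region q) (hz : |z| ≤ 1 / 2) :
    HasSum (qexpTerm q ((I * (((1 - q) * z : ℝ) : ℂ)) • (quat x)ᴴ))
      (spec x (qPochInf (qArg q z (rhoM (x 0) (radius x))) q)⁻¹
        (qPochInf (qArg q z (rhoP (x 0) (radius x))) q)⁻¹) := by
  rw [conjTranspose_quat hx.1]
  refine (hasSum_spec (hasSum_qexp hq0 hq1 (norm_qArg_lt hq1 hz (norm_rhoM_lt hq1 hx)))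
    (hasSum_qexp hq0 hq1 (norm_qArg_lt hq1 hz (norm_rhoP_lt hq1 hx)))).congr_fun fun n => ?_
  exact qexpTerm_spec hx.1 q _ n

/-- The argument changes sign because (1 - q⁻¹)qz = -(1-q)z, and the factor q in the entire product
shifts z to qz. -/
lemma hasSum_qexpTerm_inv (hq0 : 0 < q) (hq1 : q < 1) (hx : x ∈ region q) (z : ℝ) :
    HasSum (qexpTerm q⁻¹ ((I * (((1 - q⁻¹) * (q * z) : ℝ) : ℂ)) • (quat x)ᴴ))
      (spec x (qPochInf (-qArg q (q * z) (rhoM (x 0) (radius x))) q)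
        (qPochInf (-qArg q (q * z) (rhoP (x 0) (radius x))) q)) := by
  have e : ∀ ρ : ℂ, q * (I * (((1 - q⁻¹) * (q * z) : ℝ) : ℂ) * ρ) = -qArg q (q * z) ρ := fun ρ => by
    have hqc : (q : ℂ) ≠ 0 := by exact_mod_cast hq0.ne'
    simp only [qArg]
    push_cast
    field_simp
    ring
  rw [conjTranspose_quat hx.1, ← e, ← e]
  refine (hasSum_spec (hasSum_qexp_inv hq0 hq1 _) (hasSum_qexp_inv hq0 hq1 _)).congr_fun
    fun n => ?_
  exact qexpTerm_spec hx.1 q⁻¹ _ n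

/-- The `P₊` component of `v`. -/
def vPlus (q : ℝ) (np : ℝ → ℝ → ℝ → ℂ) (z t r : ℝ) : ℂ :=
  np q t r * (qPochInf (qArg q z (rhoM t r)) q)⁻¹

/-- The `P₋` component of `v`. -/
def vMinus (q : ℝ) (nm : ℝ → ℝ → ℝ → ℂ) (z t r : ℝ) : ℂ :=
  nm q t r * (qPochInf (qArg q z (rhoP t r)) q)⁻¹

lemma vSol_eq (hq0 : 0 < q) (hq1 : q < 1) (hx : x ∈ region q) (hz : |z| ≤ 1 / 2) :
    vSol np nm q x z =
      spec x (vPlus q np z (x 0) (radius x)) (vMinus q nm z (x 0) (radius x)) := by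
  rw [vSol, qexpMat, (hasSum_qexpTerm hq0 hq1 hx hz).tsum_eq, normFun_eq_spec, spec_mul hx.1,
    vPlus, vMinus, mul_comm, mul_comm (nm _ _ _)]

/-- The adjoint conjugates the eigenvalues and so exchanges ρ₊ and ρ₋. Each eigencomponent of v*v
therefore pairs different parameters, whence L± and not M±. -/
lemma qStar_vSol (hq0 : 0 < q) (hq1 : q < 1) (hN : IsNormBranch q np nm) (hx : x ∈ region q)
    (z : ℝ) :
    qStar q (vSol np nm) x z =
      spec x (np q (x 0) (radius x) * qPochInf (qArg q (q * z) (rhoP (x 0) (radius x))) q)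
        (nm q (x 0) (radius x) * qPochInf (qArg q (q * z) (rhoM (x 0) (radius x))) q) := by
  obtain ⟨c1, c2⟩ := hN.conj _ hx
  have e : ∀ ρ, (starRingEnd ℂ) (-qArg q (q * z) ρ) = qArg q (q * z) ((starRingEnd ℂ) ρ) :=
    fun ρ => by simp [qArg]
  rw [qStar, vSol, qexpMat, (hasSum_qexpTerm_inv hq0 hq1 hx z).tsum_eq, normFun_eq_spec,
    spec_mul hx.1, conjTranspose_spec, map_mul, map_mul, conj_qPochInf hq0 hq1,
    conj_qPochInf hq0 hq1, e, e, conj_rhoP, conj_rhoM, c1, c2, conj_conj, conj_conj, mul_comm,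
    mul_comm (nm _ _ _)]

/-- On an eigenspace f(qz) = (1 - i(1-q)zρ) f(z), so D_q f = iρf and iD_q f + ρf = 0. -/
lemma qDeriv_vSol (hq0 : 0 < q) (hq1 : q < 1) (hx : x ∈ region q) (hz : z ∈ qInterval q) :
    I • qDeriv q (vSol np nm q x) z + (quat x)ᴴ * vSol np nm q x z = 0 := by
  have hz1 := abs_le_of_mem_qInterval hq0 hq1 hz
  have hz2 := abs_le_of_mem_qInterval hq0 hq1 (mul_mem_qInterval hz)
  have hzc : (z : ℂ) ≠ 0 := by exact_mod_cast ne_zero_of_mem_qInterval hq0 hz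
  have hqc : (1 - q : ℂ) ≠ 0 := by simpa using one_sub_ofReal_pow_ne_zero hq0 hq1 0
  have key : ∀ (ρ n : ℂ), ‖ρ‖ < 2 / (1 - q) →
      I * ((((1 - q) * z : ℝ) : ℂ)⁻¹ * (n * (qPochInf (qArg q z ρ) q)⁻¹ -
        n * (qPochInf (qArg q (q * z) ρ) q)⁻¹)) + ρ * (n * (qPochInf (qArg q z ρ) q)⁻¹) = 0 := by
    intro ρ n h
    have h1 := qPochInf_qArg_ne_zero hq0 hq1 hz2 h
    have h2 := one_sub_qArg_ne_zero hq1 hz1 h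
    rw [qPochInf_qArg_eq hq0 hq1 z ρ]
    have e : qArg q z ρ = I * (((1 - q) * z : ℝ) : ℂ) * ρ := rfl
    have h3 : (((1 - q) * z : ℝ) : ℂ) ≠ 0 := by push_cast; exact mul_ne_zero hqc hzc
    generalize qPochInf (qArg q (q * z) ρ) q = A at *
    generalize qArg q z ρ = w at *
    generalize (((1 - q) * z : ℝ) : ℂ) = c at *
    field_simp
    linear_combination n * I * e + n * c * ρ * I_sq
  rw [qDeriv, vSol_eq hq0 hq1 hx hz1, vSol_eq hq0 hq1 hx hz2, conjTranspose_quat hx.1, spec_sub,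
    smul_spec, smul_spec, spec_mul hx.1, spec_add, vPlus, vPlus, vMinus, vMinus,
    key _ _ (norm_rhoM_lt hq1 hx), key _ _ (norm_rhoP_lt hq1 hx)]
  simp [spec]

/-! ### Differentiability of `v` -/

lemma IsNormBranch.differentiableAt (hN : IsNormBranch q np nm) (hq0 : 0 < q) (hq1 : q < 1)
    {p : ℝ × ℝ} (hp : p ∈ halfDisc q) :
    DifferentiableAt ℝ (fun z : ℝ × ℝ => np q z.1 z.2) p ∧
      DifferentiableAt ℝ (fun z : ℝ × ℝ => nm q z.1 z.2) p := by
  have hV := isOpen_halfDisc q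
  have h1 := ((contDiffOn_LP (n := 1) hq0 hq1).differentiableOn one_ne_zero).differentiableAt
    (hV.mem_nhds hp)
  have h2 := ((contDiffOn_LM (n := 1) hq0 hq1).differentiableOn one_ne_zero).differentiableAt
    (hV.mem_nhds hp)
  exact ⟨differentiableAt_of_sq_mul_eq_one hV hN.contP (fun z hz => (hN.sq q (Or.inl rfl) z hz).1)
    hp h1, differentiableAt_of_sq_mul_eq_one hV hN.contM
    (fun z hz => (hN.sq q (Or.inl rfl) z hz).2) hp h2⟩

lemma differentiableAt_qexp_rho (hq0 : 0 < q) (hq1 : q < 1) (hz : |z| ≤ 1 / 2) {p : ℝ × ℝ}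
    (hp : p ∈ halfDisc q) :
    DifferentiableAt ℝ (fun w : ℝ × ℝ => (qPochInf (qArg q z (rhoM w.1 w.2)) q)⁻¹) p ∧
      DifferentiableAt ℝ (fun w : ℝ × ℝ => (qPochInf (qArg q z (rhoP w.1 w.2)) q)⁻¹) p := by
  have h1 := (hasDerivAt_qexp hq0 hq1 hz (norm_rhoM_lt hq1 hp)).differentiableAt.restrictScalars ℝ
  have h2 := (hasDerivAt_qexp hq0 hq1 hz (norm_rhoP_lt hq1 hp)).differentiableAt.restrictScalars ℝ
  exact ⟨DifferentiableAt.comp p (g := fun ρ => (qPochInf (qArg q z ρ) q)⁻¹)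
      (f := fun w : ℝ × ℝ => rhoM w.1 w.2) h1 ((contDiff_rhoM (n := 1)).differentiable one_ne_zero p),
    DifferentiableAt.comp p (g := fun ρ => (qPochInf (qArg q z ρ) q)⁻¹)
      (f := fun w : ℝ × ℝ => rhoP w.1 w.2) h2 ((contDiff_rhoP (n := 1)).differentiable one_ne_zero p)⟩

lemma differentiableAt_vPlus_vMinus (hN : IsNormBranch q np nm) (hq0 : 0 < q) (hq1 : q < 1)
    (hz : |z| ≤ 1 / 2) {p : ℝ × ℝ} (hp : p ∈ halfDisc q) :
    DifferentiableAt ℝ (fun w : ℝ × ℝ => vPlus q np z w.1 w.2) p ∧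
      DifferentiableAt ℝ (fun w : ℝ × ℝ => vMinus q nm z w.1 w.2) p := by
  obtain ⟨n1, n2⟩ := hN.differentiableAt hq0 hq1 hp
  obtain ⟨e1, e2⟩ := differentiableAt_qexp_rho hq0 hq1 hz hp
  exact ⟨n1.mul e1, n2.mul e2⟩

lemma differentiableAt_vSol (hN : IsNormBranch q np nm) (hq0 : 0 < q) (hq1 : q < 1)
    (hx : x ∈ region q) (hz : |z| ≤ 1 / 2) (i j : Fin 2) :
    DifferentiableAt ℝ (fun y => vSol np nm q y z i j) x := by
  obtain ⟨h1, h2⟩ := differentiableAt_vPlus_vMinus hN hq0 hq1 hz hx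
  refine (differentiableAt_spec hx.1 h1 h2 i j).congr_of_eventuallyEq ?_
  filter_upwards [(isOpen_region q).mem_nhds hx] with y hy
  rw [vSol_eq hq0 hq1 hy hz]

lemma vpd_vSol (hN : IsNormBranch q np nm) (hq0 : 0 < q) (hq1 : q < 1)
    (hx : x ∈ region q) (hz : |z| ≤ 1 / 2) (μ : Fin 4) :
    vpd μ (vSol np nm) q x z =
      spec x (dRad (vPlus q np z) x μ) (dRad (vMinus q nm z) x μ) +
        ((vPlus q np z (x 0) (radius x) - vMinus q nm z (x 0) (radius x)) / 2) • dxhat x μ := by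
  obtain ⟨h1, h2⟩ := differentiableAt_vPlus_vMinus hN hq0 hq1 hz hx
  ext i j
  refine ((hasDerivAt_spec hx.1 h1 h2 μ i j).congr_of_eventuallyEq ?_).deriv
  filter_upwards [eventually_update_mem (isOpen_region q) hx μ] with s hs
  rw [vSol_eq hq0 hq1 hs hz]

lemma dRad_vPlus (hN : IsNormBranch q np nm) (hq0 : 0 < q) (hq1 : q < 1)
    (hx : x ∈ region q) (hz : |z| ≤ 1 / 2) (μ : Fin 4) :
    dRad (vPlus q np z) x μ =
      dRad (np q) x μ * (qPochInf (qArg q z (rhoM (x 0) (radius x))) q)⁻¹ +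
        np q (x 0) (radius x) * (gradT μ - I * gradR x μ) *
          qexpDeriv q z (rhoM (x 0) (radius x)) := by
  have hn := (hN.differentiableAt hq0 hq1 hx).1
  have he := hasWirtingerAt_rhoM (hasDerivAt_qexp hq0 hq1 hz (norm_rhoM_lt hq1 hx))
  have e1 := ((hasDerivAt_dT (F := np q) hn).fun_mul he.1).deriv
  have e2 := ((hasDerivAt_dR (F := np q) hn).fun_mul he.2).deriv
  simp only [dRad]
  rw [show dT (vPlus q np z) (x 0) (radius x) = _ from e1,
    show dR (vPlus q np z) (x 0) (radius x) = _ from e2]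
  ring

lemma dRad_vMinus (hN : IsNormBranch q np nm) (hq0 : 0 < q) (hq1 : q < 1)
    (hx : x ∈ region q) (hz : |z| ≤ 1 / 2) (μ : Fin 4) :
    dRad (vMinus q nm z) x μ =
      dRad (nm q) x μ * (qPochInf (qArg q z (rhoP (x 0) (radius x))) q)⁻¹ +
        nm q (x 0) (radius x) * (gradT μ + I * gradR x μ) *
          qexpDeriv q z (rhoP (x 0) (radius x)) := by
  have hn := (hN.differentiableAt hq0 hq1 hx).2
  have he := hasWirtingerAt_rhoP (hasDerivAt_qexp hq0 hq1 hz (norm_rhoP_lt hq1 hx))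
  have e1 := ((hasDerivAt_dT (F := nm q) hn).fun_mul he.1).deriv
  have e2 := ((hasDerivAt_dR (F := nm q) hn).fun_mul he.2).deriv
  simp only [dRad]
  rw [show dT (vMinus q nm z) (x 0) (radius x) = _ from e1,
    show dR (vMinus q nm z) (x 0) (radius x) = _ from e2]
  ring

/-! ### Normalization and connection -/

lemma dT_dR_of_sq_mul_eq_one {n L : ℝ → ℝ → ℂ} {a b : ℂ} {t r : ℝ}
    (hn : DifferentiableAt ℝ (fun z : ℝ × ℝ => n z.1 z.2) (t, r))
    (hL : HasWirtingerAt L a b t r) {V : Set (ℝ × ℝ)} (hV : IsOpen V)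
    (h : ∀ z ∈ V, n z.1 z.2 ^ 2 * L z.1 z.2 = 1) (hx : (t, r) ∈ V) :
    n t r * dT n t r * L t r = -(1 / 2) * ((a + b) / L t r) ∧
      n t r * dR n t r * L t r = -(1 / 2) * (I * (a - b) / L t r) := by
  have c1 : ContinuousAt (fun s : ℝ => (s, r)) t := by fun_prop
  have c2 : ContinuousAt (fun s : ℝ => (t, s)) r := by fun_prop
  have m1 : ∀ᶠ s in 𝓝 t, n s r ^ 2 * L s r = 1 := by
    filter_upwards [c1.preimage_mem_nhds (hV.mem_nhds hx)] with s hs using h (s, r) hs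
  have m2 : ∀ᶠ s in 𝓝 r, n t s ^ 2 * L t s = 1 := by
    filter_upwards [c2.preimage_mem_nhds (hV.mem_nhds hx)] with s hs using h (t, s) hs
  exact ⟨deriv_of_sq_mul_eq_one (n := fun s => n s r) (L := fun s => L s r)
      (hasDerivAt_dT hn) hL.1 m1,
    deriv_of_sq_mul_eq_one (n := fun s => n t s) (L := fun s => L t s)
      (hasDerivAt_dR hn) hL.2 m2⟩

lemma dRad_of_sq_mul_eq_one {n L : ℝ → ℝ → ℂ} {a b : ℂ}
    (hn : DifferentiableAt ℝ (fun z : ℝ × ℝ => n z.1 z.2) (x 0, radius x))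
    (hL : HasWirtingerAt L a b (x 0) (radius x)) {V : Set (ℝ × ℝ)} (hV : IsOpen V)
    (h : ∀ z ∈ V, n z.1 z.2 ^ 2 * L z.1 z.2 = 1) (hx : (x 0, radius x) ∈ V) (μ : Fin 4) :
    n (x 0) (radius x) * dRad n x μ * L (x 0) (radius x) =
      -(1 / 2) * ((gradT μ * (a + b) + gradR x μ * (I * (a - b))) / L (x 0) (radius x)) := by
  obtain ⟨e1, e2⟩ := dT_dR_of_sq_mul_eq_one hn hL hV h hx
  rw [dRad]
  linear_combination (gradT μ : ℂ) * e1 + (gradR x μ : ℂ) * e2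

lemma rhoM_sub_rhoP_ne_zero {t r : ℝ} (hr : 0 < r) : rhoM t r - rhoP t r ≠ 0 :=
  sub_ne_zero.2 (sub_ne_zero.1 (rhoP_ne_rhoM hr)).symm

/-- On P± the integrals are L±, and the branches satisfy n±²L± = 1. -/
lemma hasJackson_qStar_vSol (hN : IsNormBranch q np nm) (hq0 : 0 < q) (hq1 : q < 1)
    (hx : x ∈ region q) :
    HasJackson q (fun z => qStar q (vSol np nm) x z * vSol np nm q x z) 1 := by
  set t := x 0
  set r := radius x
  have hxr : (t, r) ∈ halfDisc q := hx
  have h1 := ((hasJackson_lPair hq0 hq1 (norm_rhoM_lt hq1 hxr)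
    (rhoM_sub_rhoP_ne_zero hxr.1)).const_mul (np q t r ^ 2)).smul_const (spec x 1 0)
  have h2 := ((hasJackson_lPair hq0 hq1 (norm_rhoP_lt hq1 hxr)
    (rhoP_ne_rhoM hxr.1)).const_mul (nm q t r ^ 2)).smul_const (spec x 0 1)
  rw [← LP_eq_lPair hq0 hq1 hxr] at h1
  rw [← LM_eq_lPair hq0 hq1 hxr] at h2
  obtain ⟨s1, s2⟩ := hN.sq q (Or.inl rfl) (t, r) hxr
  have h := h1.add h2
  rw [show np q t r ^ 2 * LP q t r = 1 from s1, show nm q t r ^ 2 * LM q t r = 1 from s2,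
    ← spec_eq_smul_add, spec_one] at h
  refine h.congr fun z hz => ?_
  rw [qStar_vSol hq0 hq1 hN hx, vSol_eq hq0 hq1 hx (abs_le_of_mem_qInterval hq0 hq1 hz),
    spec_mul hx.1, ← spec_eq_smul_add, vPlus, vMinus]
  congr 1 <;> ring

/-- The `P±` components of `<v, ∂_μ v>`. -/
lemma hasJackson_dRad (hN : IsNormBranch q np nm) (hq0 : 0 < q) (hq1 : q < 1)
    (hx : x ∈ region q) {a b c d : ℂ} (hP : HasWirtingerAt (LP q) a b (x 0) (radius x))
    (hM : HasWirtingerAt (LM q) c d (x 0) (radius x)) (μ : Fin 4) :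
    HasJackson q (fun z => np q (x 0) (radius x) *
        qPochInf (qArg q (q * z) (rhoP (x 0) (radius x))) q * dRad (vPlus q np z) x μ)
      ((gradT μ * (b - a) - I * gradR x μ * (a + b)) / (2 * LP q (x 0) (radius x))) ∧
    HasJackson q (fun z => nm q (x 0) (radius x) *
        qPochInf (qArg q (q * z) (rhoM (x 0) (radius x))) q * dRad (vMinus q nm z) x μ)
      ((gradT μ * (c - d) + I * gradR x μ * (c + d)) / (2 * LM q (x 0) (radius x))) := by
  obtain ⟨a', hP'⟩ := exists_hasWirtingerAt_LP_lPair hq0 hq1 hx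
  obtain ⟨d', hM'⟩ := exists_hasWirtingerAt_LM_lPair hq0 hq1 hx
  -- Wirtinger derivatives are unique, so the second-slot derivative of the pair function is the
  -- given ∂₋-derivative of L⁺; similarly for L⁻ and ∂₊.
  have eb : deriv (lPair q (rhoP (x 0) (radius x))) (rhoM (x 0) (radius x)) = b :=
    hP'.dMinus_eq.symm.trans hP.dMinus_eq
  have ec : deriv (lPair q (rhoM (x 0) (radius x))) (rhoP (x 0) (radius x)) = c :=
    hM'.dPlus_eq.symm.trans hM.dPlus_eq
  obtain ⟨s1, s2⟩ := hN.sq q (Or.inl rfl) _ hx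
  have L1 := LP_ne_zero hq0 hq1 hx
  have L2 := LM_ne_zero hq0 hq1 hx
  constructor
  · have h1 := (hasJackson_lPair hq0 hq1 (norm_rhoM_lt hq1 hx)
      (rhoM_sub_rhoP_ne_zero hx.1)).const_mul (np q (x 0) (radius x) * dRad (np q) x μ)
    have h2 := (hasJackson_deriv_lPair hq0 hq1 (norm_rhoM_lt hq1 hx)
      (rhoM_sub_rhoP_ne_zero hx.1)).const_mul
        (np q (x 0) (radius x) ^ 2 * (gradT μ - I * gradR x μ))
    rw [← LP_eq_lPair hq0 hq1 hx, dRad_of_sq_mul_eq_one (hN.differentiableAt hq0 hq1 hx).1 hP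
      (isOpen_halfDisc q) (fun z hz => (hN.sq q (Or.inl rfl) z hz).1) hx] at h1
    rw [eb, show np q (x 0) (radius x) ^ 2 = (LP q (x 0) (radius x))⁻¹ from
      eq_inv_of_mul_eq_one_left s1] at h2
    -- The branch contributes -dL⁺/(2L⁺) and the exponential contributes ∂₋L⁺/L⁺ in the direction of
    -- dρ₋. Together they leave half of ∂₋ minus ∂₊.
    have h := h1.add h2
    convert! h.congr fun z hz => ?_ using 1
    · field_simp
      ring
    · rw [dRad_vPlus hN hq0 hq1 hx (abs_le_of_mem_qInterval hq0 hq1 hz),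
        ← show np q (x 0) (radius x) ^ 2 = (LP q (x 0) (radius x))⁻¹ from
          eq_inv_of_mul_eq_one_left s1]
      ring
  · have h1 := (hasJackson_lPair hq0 hq1 (norm_rhoP_lt hq1 hx)
      (rhoP_ne_rhoM hx.1)).const_mul (nm q (x 0) (radius x) * dRad (nm q) x μ)
    have h2 := (hasJackson_deriv_lPair hq0 hq1 (norm_rhoP_lt hq1 hx)
      (rhoP_ne_rhoM hx.1)).const_mul
        (nm q (x 0) (radius x) ^ 2 * (gradT μ + I * gradR x μ))
    rw [← LM_eq_lPair hq0 hq1 hx, dRad_of_sq_mul_eq_one (hN.differentiableAt hq0 hq1 hx).2 hM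
      (isOpen_halfDisc q) (fun z hz => (hN.sq q (Or.inl rfl) z hz).2) hx] at h1
    rw [ec, show nm q (x 0) (radius x) ^ 2 = (LM q (x 0) (radius x))⁻¹ from
      eq_inv_of_mul_eq_one_left s2] at h2
    have h := h1.add h2
    convert! h.congr fun z hz => ?_ using 1
    · field_simp
      ring
    · rw [dRad_vMinus hN hq0 hq1 hx (abs_le_of_mem_qInterval hq0 hq1 hz),
        ← show nm q (x 0) (radius x) ^ 2 = (LM q (x 0) (radius x))⁻¹ from
          eq_inv_of_mul_eq_one_left s2]
      ring

end Solution

/-! ### The connection i<v, dv> -/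

section Connection

variable {q : ℝ} {np nm : ℝ → ℝ → ℝ → ℂ} {x : Spacetime}

/-- The integrals that multiply `dx̂` in `<v, dv>`. -/
lemma hasJackson_vPlus_sub_vMinus (hN : IsNormBranch q np nm) (hq0 : 0 < q) (hq1 : q < 1)
    {t r : ℝ} (h : (t, r) ∈ halfDisc q) :
    HasJackson q (fun z => np q t r * qPochInf (qArg q (q * z) (rhoP t r)) q *
        (vPlus q np z t r - vMinus q nm z t r))
      (1 - np q t r * nm q t r * MFun q (rhoP t r)) ∧
    HasJackson q (fun z => nm q t r * qPochInf (qArg q (q * z) (rhoM t r)) q *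
        (vPlus q np z t r - vMinus q nm z t r))
      (np q t r * nm q t r * MFun q (rhoM t r) - 1) := by
  obtain ⟨s1, s2⟩ := hN.sq q (Or.inl rfl) (t, r) h
  have h1 := (hasJackson_lPair hq0 hq1 (norm_rhoM_lt hq1 h)
    (rhoM_sub_rhoP_ne_zero h.1)).const_mul (np q t r ^ 2)
  have h2 := (hasJackson_lPair hq0 hq1 (norm_rhoP_lt hq1 h)
    (rhoP_ne_rhoM h.1)).const_mul (nm q t r ^ 2)
  have h3 := (hasJackson_MFun hq0 hq1 (norm_rhoP_lt hq1 h)).const_mul (np q t r * nm q t r)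
  have h4 := (hasJackson_MFun hq0 hq1 (norm_rhoM_lt hq1 h)).const_mul (np q t r * nm q t r)
  rw [← LP_eq_lPair hq0 hq1 h, show np q t r ^ 2 * LP q t r = 1 from s1] at h1
  rw [← LM_eq_lPair hq0 hq1 h, show nm q t r ^ 2 * LM q t r = 1 from s2] at h2
  constructor
  · refine (h1.sub h3).congr fun z _ => ?_
    rw [vPlus, vMinus]
    ring
  · refine (h4.sub h2).congr fun z _ => ?_
    rw [vPlus, vMinus]
    ring

lemma hasJackson_vpd (hN : IsNormBranch q np nm) (hq0 : 0 < q) (hq1 : q < 1)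
    (hx : x ∈ region q) {a b c d : ℂ} (hP : HasWirtingerAt (LP q) a b (x 0) (radius x))
    (hM : HasWirtingerAt (LM q) c d (x 0) (radius x)) (μ : Fin 4) :
    HasJackson q (fun z => qStar q (vSol np nm) x z * vpd μ (vSol np nm) q x z)
      (spec x ((gradT μ * (b - a) - I * gradR x μ * (a + b)) / (2 * LP q (x 0) (radius x)))
          ((gradT μ * (c - d) + I * gradR x μ * (c + d)) / (2 * LM q (x 0) (radius x))) +
        spec x ((1 - np q (x 0) (radius x) * nm q (x 0) (radius x) *
            MFun q (rhoP (x 0) (radius x))) / 2)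
          ((np q (x 0) (radius x) * nm q (x 0) (radius x) *
            MFun q (rhoM (x 0) (radius x)) - 1) / 2) * dxhat x μ) := by
  obtain ⟨j1, j2⟩ := hasJackson_dRad hN hq0 hq1 hx hP hM μ
  obtain ⟨k1, k2⟩ := hasJackson_vPlus_sub_vMinus hN hq0 hq1 hx
  have h := ((j1.smul_const (spec x 1 0)).add (j2.smul_const (spec x 0 1))).add
    (((k1.const_mul (1 / 2)).smul_const (spec x 1 0 * dxhat x μ)).add
      ((k2.const_mul (1 / 2)).smul_const (spec x 0 1 * dxhat x μ)))
  have e : ∀ α β : ℂ, α • (spec x 1 0 * dxhat x μ) + β • (spec x 0 1 * dxhat x μ) =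
      spec x α β * dxhat x μ := fun α β => by
    rw [spec_eq_smul_add (a := α), add_mul, smul_mul_assoc, smul_mul_assoc]
  rw [← spec_eq_smul_add, e, one_div_mul_eq_div, one_div_mul_eq_div] at h
  refine h.congr fun z hz => ?_
  have hz1 := abs_le_of_mem_qInterval hq0 hq1 hz
  rw [qStar_vSol hq0 hq1 hN hx, vpd_vSol hN hq0 hq1 hx hz1, mul_add, spec_mul hx.1,
    ← spec_eq_smul_add, e, mul_smul_comm, ← smul_mul_assoc, smul_spec]
  congr 3 <;> ring

lemma logDeriv_of_hasWirtingerAt {F G : ℝ → ℝ → ℂ} {a b c d : ℂ} {t r : ℝ}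
    (hF : HasWirtingerAt F a b t r) (hG : HasWirtingerAt G c d t r) (hF0 : F t r ≠ 0)
    (hG0 : G t r ≠ 0) :
    logDeriv (fun s => F s r / G s r) t = (a + b) / F t r - (c + d) / G t r ∧
      logDeriv (fun s => F t s / G t s) r = I * (a - b) / F t r - I * (c - d) / G t r ∧
      logDeriv (fun s => F s r * G s r) t = (a + b) / F t r + (c + d) / G t r ∧
      logDeriv (fun s => F t s * G t s) r = I * (a - b) / F t r + I * (c - d) / G t r := by
  have hd := hF.div hG hG0
  have hm := hF.mul hG
  refine ⟨?_, ?_, ?_, ?_⟩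
  · rw [logDeriv_apply, hd.1.deriv]; field_simp; ring
  · rw [logDeriv_apply, hd.2.deriv]; field_simp; ring
  · rw [logDeriv_apply, hm.1.deriv]; field_simp; ring
  · rw [logDeriv_apply, hm.2.deriv]; field_simp; ring

/-- The derivatives of the eigencomponents give the Ω terms. The coefficient of dx̂ is a function of
x̂: its scalar part yields f, and its x̂ part yields g_A through x̂ dx̂. -/
lemma qConnection_eq_qbps (hN : IsNormBranch q np nm) (hq0 : 0 < q) (hq1 : q < 1)
    (hx : x ∈ region q) (μ : Fin 4) :
    QInnerConverges q (vSol np nm) (vpd μ (vSol np nm)) x ∧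
      qConnection q (vSol np nm) μ x = qbps q μ x := by
  obtain ⟨a, b, hP⟩ := exists_hasWirtingerAt_LP hq0 hq1 hx
  obtain ⟨c, d, hM⟩ := exists_hasWirtingerAt_LM hq0 hq1 hx
  obtain ⟨c1, c2, hS⟩ := (hasJackson_vpd hN hq0 hq1 hx hP hM μ).eval
  refine ⟨⟨c1, c2⟩, ?_⟩
  have hr : 0 < radius x := hx.1
  have hrc : (radius x : ℂ) ≠ 0 := by exact_mod_cast hr.ne'
  have L1 := LP_ne_zero hq0 hq1 hx
  have L2 := LM_ne_zero hq0 hq1 hx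
  obtain ⟨l1, l2, l3, l4⟩ := logDeriv_of_hasWirtingerAt hP hM L1 L2
  -- The product condition on the branches fixes the common sign of the M-terms in f and g_A.
  have hmul : (LP q (x 0) (radius x) * LM q (x 0) (radius x)) ^ (-(1 / 2) : ℂ) =
      np q (x 0) (radius x) * nm q (x 0) (radius x) := (hN.mul _ hx).symm
  rw [qConnection, qInner, hS]
  generalize np q (x 0) (radius x) * nm q (x 0) (radius x) = N at *
  induction μ using Fin.cases with
  | zero =>
    rw [dxhat_zero, mul_zero, add_zero]
    simp only [qbps, Fin.cases_zero, drOmega, l2, l4, gradT, gradR, spec]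
    simp only [if_true]
    push_cast
    match_scalars <;> field_simp <;> ring
  | succ j =>
    have e : ∀ α β : ℂ, spec x α β * dxhat x j.succ = ((α + β) / 2) • dxhat x j.succ +
        (((α - β) / 2) * I) • ∑ i : Fin 3, ∑ k : Fin 3,
          ((epsilon i j k * (x i.succ / radius x ^ 2) : ℝ) : ℂ) • pauli k := fun α β => by
      rw [spec, add_mul, smul_mul_assoc, smul_mul_assoc, one_mul, xhat_mul_dxhat hr, smul_smul]
    rw [e]
    simp only [qbps, Fin.cases_succ, dtOmega, l1, l3, pd_xhat hr, fFun, gFun, hmul, spec, gradT,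
      gradR, Fin.succ_ne_zero, if_false]
    generalize ∑ i : Fin 3, ∑ k : Fin 3,
          ((epsilon i j k * (x i.succ / radius x ^ 2) : ℝ) : ℂ) • pauli k = Y
    push_cast
    match_scalars <;> field_simp <;> ring_nf <;> simp only [I_sq] <;> ring

end Connection

end QADHMN

end

theorem mainTheorem1 (q : ℝ) (hq0 : 0 < q) (hq1 : q < 1) :
    -- reduction of the anti-selfduality equations in Witten's form
    (∀ (V : Set (ℝ × ℝ)) (ψ φ₁ φ₂ : ℝ → ℝ → ℝ), IsOpen V → (∀ z ∈ V, 0 < z.2) →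
      ContDiffOn ℝ 2 (fun z : ℝ × ℝ => ψ z.1 z.2) V →
      ContDiffOn ℝ 2 (fun z : ℝ × ℝ => φ₁ z.1 z.2) V →
      ContDiffOn ℝ 2 (fun z : ℝ × ℝ => φ₂ z.1 z.2) V →
      (∀ z ∈ V, φ₁ z.1 z.2 ^ 2 + φ₂ z.1 z.2 ^ 2 ≠ 0) →
      ((∀ x : QADHMN.Spacetime, (x 0, QADHMN.radius x) ∈ V →
          QADHMN.IsASDAt
            (QADHMN.wittenConnection (QADHMN.potA0 ψ) (QADHMN.potA1 ψ) φ₁ φ₂) x) ↔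
        (QADHMN.CauchyRiemannOn (fun t r => Real.exp (-ψ t r) * φ₁ t r)
            (fun t r => Real.exp (-ψ t r) * φ₂ t r) V ∧
          QADHMN.LiouvilleOn (QADHMN.wittenLiouville φ₁ φ₂) V))) ∧
    -- the series and products involved converge
    (∀ z ∈ QADHMN.halfDisc q,
      (∀ p : ℝ, (p = q ∨ p = q⁻¹) →
        Summable (QADHMN.lambdaTerm p (QADHMN.rhoP z.1 z.2) (QADHMN.rhoM z.1 z.2)) ∧
        Summable (QADHMN.lambdaTerm p (QADHMN.rhoM z.1 z.2) (QADHMN.rhoP z.1 z.2))) ∧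
      Summable (QADHMN.MTerm q (QADHMN.rhoP z.1 z.2)) ∧
      Summable (QADHMN.MTerm q (QADHMN.rhoM z.1 z.2))) ∧
    (∀ a : ℂ, Multipliable (fun k : ℕ => 1 - a * (q : ℂ) ^ k) ∧
      Multipliable (fun k : ℕ => 1 - a * ((q ^ 2 : ℝ) : ℂ) ^ k)) ∧
    -- the q-ADHMN construction yields the connection `qbps`
    (∃ np nm : ℝ → ℝ → ℝ → ℂ, QADHMN.IsNormBranch q np nm) ∧
    (∀ np nm : ℝ → ℝ → ℝ → ℂ, QADHMN.IsNormBranch q np nm → ∀ x ∈ QADHMN.region q,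
      (∀ z ∈ QADHMN.qInterval q,
        Summable (QADHMN.qexpTerm q
          ((Complex.I * (((1 - q) * z : ℝ) : ℂ)) • (QADHMN.quat x).conjTranspose)) ∧
        Summable (QADHMN.qexpTerm q⁻¹
          ((Complex.I * (((1 - q⁻¹) * (q * z) : ℝ) : ℂ)) • (QADHMN.quat x).conjTranspose)) ∧
        (∀ i j : Fin 2,
          DifferentiableAt ℝ (fun y => QADHMN.vSol np nm q y z i j) x) ∧
        Complex.I • QADHMN.qDeriv q (QADHMN.vSol np nm q x) z +
          (QADHMN.quat x).conjTranspose * QADHMN.vSol np nm q x z = 0) ∧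
      QADHMN.QInnerConverges q (QADHMN.vSol np nm) (QADHMN.vSol np nm) x ∧
      QADHMN.qInner q (QADHMN.vSol np nm) (QADHMN.vSol np nm) x = 1 ∧
      (∀ μ : Fin 4,
        QADHMN.QInnerConverges q (QADHMN.vSol np nm)
          (QADHMN.vpd μ (QADHMN.vSol np nm)) x ∧
        QADHMN.qConnection q (QADHMN.vSol np nm) μ x = QADHMN.qbps q μ x)) ∧
    -- it is Witten's axisymmetric form, up to an abelian pure gauge trace part
    (∀ z ∈ QADHMN.halfDisc q,
      0 < (QADHMN.LP q z.1 z.2 * QADHMN.LM q z.1 z.2).re ∧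
      (QADHMN.LP q z.1 z.2 * QADHMN.LM q z.1 z.2).im = 0 ∧
      0 < QADHMN.phi1Q q z.1 z.2 ^ 2 + QADHMN.phi2Q q z.1 z.2 ^ 2) ∧
    ContDiffOn ℝ ∞ (fun z : ℝ × ℝ => QADHMN.psiQ q z.1 z.2) (QADHMN.halfDisc q) ∧
    ContDiffOn ℝ ∞ (fun z : ℝ × ℝ => QADHMN.phi1Q q z.1 z.2) (QADHMN.halfDisc q) ∧
    ContDiffOn ℝ ∞ (fun z : ℝ × ℝ => QADHMN.phi2Q q z.1 z.2) (QADHMN.halfDisc q) ∧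
    (∀ (μ : Fin 4) (i j : Fin 2),
      ContDiffOn ℝ ∞ (fun x => QADHMN.qbps q μ x i j) (QADHMN.region q)) ∧
    (∀ μ : Fin 4, ∀ x ∈ QADHMN.region q,
      QADHMN.qbps q μ x =
        QADHMN.wittenConnection (QADHMN.potA0 (QADHMN.psiQ q)) (QADHMN.potA1 (QADHMN.psiQ q))
          (QADHMN.phi1Q q) (QADHMN.phi2Q q) μ x +
        ((QADHMN.qbps q μ x).trace / 2) • (1 : QADHMN.M2)) ∧
    (∃ u : QADHMN.Spacetime → ℝ,
      ContDiffOn ℝ ∞ u (QADHMN.region q) ∧ (∀ x ∈ QADHMN.region q, 0 < u x) ∧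
      ∀ μ : Fin 4, ∀ x ∈ QADHMN.region q,
        QADHMN.gaugeTransform (fun y => (u y : ℂ) • (1 : QADHMN.M2)) (QADHMN.qbps q) μ x =
          QADHMN.wittenConnection (QADHMN.potA0 (QADHMN.psiQ q))
            (QADHMN.potA1 (QADHMN.psiQ q)) (QADHMN.phi1Q q) (QADHMN.phi2Q q) μ x) ∧
    -- its anti-selfduality, the Cauchy–Riemann equations and the Liouville equation
    (∀ x ∈ QADHMN.region q, QADHMN.IsASDAt (QADHMN.qbps q) x ∧
      QADHMN.IsASDAt (QADHMN.wittenConnection (QADHMN.potA0 (QADHMN.psiQ q))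
        (QADHMN.potA1 (QADHMN.psiQ q)) (QADHMN.phi1Q q) (QADHMN.phi2Q q)) x) ∧
    (∀ z ∈ QADHMN.halfDisc q,
      ((Real.exp (-QADHMN.psiQ q z.1 z.2) * QADHMN.phi1Q q z.1 z.2 : ℝ) : ℂ) +
        Complex.I * ((Real.exp (-QADHMN.psiQ q z.1 z.2) * QADHMN.phi2Q q z.1 z.2 : ℝ) : ℂ) =
          -Complex.I * QADHMN.MFun q (QADHMN.rhoM z.1 z.2)) ∧
    QADHMN.CauchyRiemannOn
      (fun t r => Real.exp (-QADHMN.psiQ q t r) * QADHMN.phi1Q q t r)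
      (fun t r => Real.exp (-QADHMN.psiQ q t r) * QADHMN.phi2Q q t r) (QADHMN.halfDisc q) ∧
    (∀ z ∈ QADHMN.halfDisc q,
      QADHMN.dPlus (fun t r =>
        QADHMN.dMinus (fun t' r' => QADHMN.LP q t' r' / QADHMN.LM q t' r') t r /
          (QADHMN.LP q t r / QADHMN.LM q t r)) z.1 z.2 = 0 ∧
      QADHMN.dPlus (fun t r =>
        QADHMN.dMinus (fun t' r' => QADHMN.LP q t' r' * QADHMN.LM q t' r') t r /
          (QADHMN.LP q t r * QADHMN.LM q t r)) z.1 z.2 =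
        1 / (2 * (z.2 : ℂ) ^ 2) *
          (1 - QADHMN.MFun q (QADHMN.rhoP z.1 z.2) * QADHMN.MFun q (QADHMN.rhoM z.1 z.2) /
            (QADHMN.LP q z.1 z.2 * QADHMN.LM q z.1 z.2))) ∧
    -- the Liouville solution and its generating function
    ContDiffOn ℝ ∞ (fun z : ℝ × ℝ =>
      QADHMN.liouvilleSol (QADHMN.gMero q) (QADHMN.gMero q) z.1 z.2) (QADHMN.halfDisc q) ∧
    QADHMN.LiouvilleOn (QADHMN.liouvilleSol (QADHMN.gMero q) (QADHMN.gMero q))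
      (QADHMN.halfDisc q) ∧
    (∀ z ∈ QADHMN.halfDisc q,
      QADHMN.wittenLiouville (QADHMN.phi1Q q) (QADHMN.phi2Q q) z.1 z.2 =
        QADHMN.liouvilleSol (QADHMN.gMero q) (QADHMN.gMero q) z.1 z.2 ∧
      QADHMN.liouvilleSol (fun ρ => (QADHMN.gMero q ρ)⁻¹) (fun ρ => (QADHMN.gMero q ρ)⁻¹)
          z.1 z.2 =
        QADHMN.liouvilleSol (QADHMN.gMero q) (QADHMN.gMero q) z.1 z.2 ∧
      QADHMN.gMero q (QADHMN.rhoP z.1 z.2) ≠ QADHMN.gMero q (QADHMN.rhoM z.1 z.2)) ∧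
    Meromorphic (QADHMN.gMero q) ∧
    (∀ ρ : ℂ, ‖ρ‖ < 2 / (1 - q) →
      QADHMN.pFun q ρ ≠ 0 ∧ QADHMN.mFun q ρ ≠ 0 ∧ QADHMN.MFun q ρ ≠ 0 ∧
      HasDerivAt (QADHMN.gMero q)
        (Complex.I * QADHMN.gMero q ρ * QADHMN.MFun q ρ) ρ) ∧
    (∀ ρ : ℂ, QADHMN.pFun q ρ ≠ 0 →
      HasProd (fun n : ℕ => (QADHMN.pole q n - ρ) / (QADHMN.pole q n + ρ))
        (QADHMN.gMero q ρ) ∧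
      QADHMN.gMero q ρ =
        QADHMN.qexp q ((1 - q) * Complex.I * ρ / 2) *
          QADHMN.qExp q ((1 - q) * Complex.I * ρ / 2)) ∧
    (∀ ρ : ℂ, QADHMN.mFun q ρ ≠ 0 →
      HasProd (fun n : ℕ => (QADHMN.pole q n + ρ) / (QADHMN.pole q n - ρ))
        (QADHMN.gMero q ρ)⁻¹ ∧
      (QADHMN.gMero q ρ)⁻¹ =
        QADHMN.qexp q (-((1 - q) * Complex.I * ρ / 2)) *
          QADHMN.qExp q (-((1 - q) * Complex.I * ρ / 2))) ∧
    -- the two identities for `L⁺` and `L⁻`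
    (∀ z ∈ QADHMN.halfDisc q,
      QADHMN.LM q z.1 z.2 ≠ 0 ∧
      QADHMN.LP q z.1 z.2 / QADHMN.LM q z.1 z.2 =
        QADHMN.qPochInf (-((1 - q) / 2) ^ 2 * QADHMN.rhoP z.1 z.2 ^ 2) (q ^ 2) /
          QADHMN.qPochInf (-((1 - q) / 2) ^ 2 * QADHMN.rhoM z.1 z.2 ^ 2) (q ^ 2) ∧
      QADHMN.LP q z.1 z.2 * QADHMN.LM q z.1 z.2 =
        -(QADHMN.pFun q (QADHMN.rhoM z.1 z.2) * QADHMN.mFun q (QADHMN.rhoP z.1 z.2) -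
            QADHMN.pFun q (QADHMN.rhoP z.1 z.2) * QADHMN.mFun q (QADHMN.rhoM z.1 z.2)) ^ 2 /
          (QADHMN.pFun q (QADHMN.rhoP z.1 z.2) * QADHMN.mFun q (QADHMN.rhoP z.1 z.2) *
            (QADHMN.pFun q (QADHMN.rhoM z.1 z.2) * QADHMN.mFun q (QADHMN.rhoM z.1 z.2)) *
            (QADHMN.rhoP z.1 z.2 - QADHMN.rhoM z.1 z.2) ^ 2)) := by
  have hdisc := QADHMN.isOpen_halfDisc q
  have hq2 : q ^ 2 < 1 := pow_lt_one₀ hq0.le hq1 two_ne_zero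
  refine ⟨fun V ψ φ₁ φ₂ hV hpos hψ h1 h2 hne => QADHMN.witten_reduction hV hpos hψ h1 h2 hne,
    fun z hz => ⟨fun p hp => QADHMN.summable_lambdaTerm hq0 hq1 hz hp,
      (QADHMN.summable_norm_MTerm hq0 hq1 (QADHMN.norm_rhoP_lt hq1 hz)).of_norm,
      (QADHMN.summable_norm_MTerm hq0 hq1 (QADHMN.norm_rhoM_lt hq1 hz)).of_norm⟩,
    fun a => ⟨QADHMN.multipliable_qPoch hq0 hq1 a,
      QADHMN.multipliable_qPoch (pow_pos hq0 2) hq2 a⟩,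
    QADHMN.exists_isNormBranch hq0 hq1, ?_,
    fun z hz => ⟨?_, ?_, QADHMN.phi_sq_add_sq_pos hq0 hq1 hz⟩,
    QADHMN.contDiffOn_psiQ hq0 hq1, QADHMN.contDiffOn_phi1Q hq0 hq1,
    QADHMN.contDiffOn_phi2Q hq0 hq1, QADHMN.contDiffOn_qbps hq0 hq1,
    fun μ x hx => QADHMN.qbps_traceless_part hq0 hq1 hx μ, QADHMN.exists_gauge hq0 hq1,
    fun x hx => ⟨QADHMN.isASDAt_qbps hq0 hq1 hx, QADHMN.isASDAt_wittenQ hq0 hq1 hx⟩,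
    fun z hz => QADHMN.exp_mul_phi_eq hq0 hq1 hz, QADHMN.cauchyRiemannOn_phiQ hq0 hq1,
    fun z hz => ⟨QADHMN.dPlus_dMinus_log_div hq0 hq1 hz, QADHMN.dPlus_dMinus_log_mul hq0 hq1 hz⟩,
    QADHMN.contDiffOn_liouvilleSol hq0 hq1, QADHMN.liouvilleOn_liouvilleSol hq0 hq1,
    fun z hz => ⟨QADHMN.wittenLiouville_eq_liouvilleSol hq0 hq1 hz,
      QADHMN.liouvilleSol_inv hq0 hq1 hz,
      sub_ne_zero.1 (QADHMN.gMero_sub_ne_zero hq0 hq1 hz)⟩,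
    QADHMN.meromorphic_gMero hq0 hq1,
    fun ρ hρ => ⟨QADHMN.pFun_ne_zero hq0 hq1 hρ, QADHMN.mFun_ne_zero hq0 hq1 hρ,
      QADHMN.MFun_ne_zero hq0 hq1 hρ, QADHMN.hasDerivAt_gMero hq0 hq1 hρ⟩,
    fun ρ hρ => QADHMN.gMero_product hq0 hq1 ρ hρ, fun ρ hρ => QADHMN.gMero_inv_product hq0 hq1 ρ hρ,
    fun z hz => ⟨QADHMN.LM_ne_zero hq0 hq1 hz, ?_, QADHMN.LP_mul_LM hq0 hq1 hz⟩⟩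
  · intro np nm hN x hx
    obtain ⟨c1, c2, hS⟩ := (QADHMN.hasJackson_qStar_vSol hN hq0 hq1 hx).eval
    refine ⟨fun z hz => ?_, ⟨c1, c2⟩, hS, fun μ => QADHMN.qConnection_eq_qbps hN hq0 hq1 hx μ⟩
    have hz1 := QADHMN.abs_le_of_mem_qInterval hq0 hq1 hz
    exact ⟨(QADHMN.hasSum_qexpTerm hq0 hq1 hx hz1).summable,
      (QADHMN.hasSum_qexpTerm_inv hq0 hq1 hx z).summable,
      QADHMN.differentiableAt_vSol hN hq0 hq1 hx hz1, QADHMN.qDeriv_vSol hq0 hq1 hx hz⟩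
  · rw [QADHMN.LP_mul_LM_eq_norm_sq hq0 hq1 hz, Complex.ofReal_re]
    exact pow_pos (QADHMN.norm_LP_pos hq0 hq1 hz) 2
  · rw [QADHMN.LP_mul_LM_eq_norm_sq hq0 hq1 hz, Complex.ofReal_im]
  · rw [QADHMN.LP_div_LM hq0 hq1 hz, QADHMN.hFun, QADHMN.hFun, QADHMN.pFun_mul_mFun hq0 hq1,
      QADHMN.pFun_mul_mFun hq0 hq1]
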